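/- Let $R$ be an integral domain, $n\ge 1$, and $\sigma=(\sigma_1^{1/2},\dots,\sigma_n^{1/2})$ commuting automorphisms of $R$; put $\sigma_i=(\sigma_i^{1/2})^2$. For $t\in (R\setminus\{0\})^n$ let $\tilde A(t)$ be the ring obtained from $R$ by adjoining generators $X_1^\pm,\dots,X_n^\pm$ with relations $X_i^\pm r=\sigma_i^{\pm1}(r)X_i^\pm$ ($r\in R$), $X_i^\pm X_i^\mp=\sigma_i^{\pm1/2}(t_i)$, and $X_i^\pm X_j^\mp=X_j^\mp X_i^\pm$ for $i\ne j$, and let $A(t)$ be its quotient by the ideal of $R$-torsion elements. Let $\Omega$ be the set of $t$ for which $R\to A(t)$ is injective. The group $\mathbb Z^n$ acts on $\operatorname{MaxSpec}R$ by $g\cdot\mathfrak m=\sigma_1^{g_1}\cdots\sigma_n^{g_n}(\mathfrak m)$. Let $\mathcal O$ be a torsion-free orbit, i.e. one with trivial stabilizers, and put $\Omega_{\mathcal O}^\times=\{t\in\Omega : \sigma_i^{1/2}(t_i)\notin\bigcup_{\mathfrak m\in\mathcal O}\mathfrak m \text{ for all } i\}$. Let $A(t)\text{-wmod}_{\mathcal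 O}$ be the category of $A(t)$-modules $M=\bigoplus_{\mathfrak m}M_{\mathfrak m}$, $M_{\mathfrak m}=\{v:\mathfrak m v=0\}$, with every $M_{\mathfrak m}$ finite dimensional over $R/\mathfrak m$ and $M_{\mathfrak m}=0$ for $\mathfrak m\notin\mathcal O$. Let $K_0$ (resp. $K_0^{\mathrm{split}}$) be its Grothendieck group with respect to short exact sequences (resp. direct sums). For a submonoid $\Gamma\subset\Omega$ (under componentwise multiplication) let $$\mathscr A(\Gamma,\mathcal O)=\bigoplus_{t\in\Gamma}\mathbb C\otimes_{\mathbb Z}K_0(A(t)\text{-wmod}_{\mathcal O}),\qquad \mathscr A^{\mathrm{split}}(\Gamma,\mathcal O)=\bigoplus_{t\in\Gamma}\mathbb C\otimes_{\mathbb Z}K_0^{\mathrm{split}}(A(t)\text{-wmod}_{\mathcal O}).$$ For $M\in A(t)\text{-wmod}_{\mathcal O}$ and $M'\in A(t')\text{-wmod}_{\mathcal O}$ the ring $\tilde A(tt')$ acts on $M\otimes_R M'$, with $X_i^\pm$ acting as $X_i^\pm\otimes X_i^\pm$. Call $(t,t')$ *admissible* if for all such $M,M'$ this action descends to $A(tt')$.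 The product is given by $[M][M']=[M\otimes_R M']$ in degrees $(t,t')$ that are admissible, and by convention is $0$ in degrees $(t,t')$ that are not admissible. Let $\Gamma_1,\Gamma_2\subset\Omega$ be submonoids and $\gamma:\Gamma_1\to\Omega_{\mathcal O}^\times$ a monoid map such that $\phi(t)=\gamma(t)\,t$ defines a monoid isomorphism $\phi:\Gamma_1\to\Gamma_2$. Then: 1. $(t,t')$ is admissible if and only if $(\phi(t),\phi(t'))$ is, for all $t,t'\in\Gamma_1$. 2. For every $t\in\Gamma_1$ the category $A(\gamma(t))\text{-wmod}_{\mathcal O}$ has a simple object $M^{\gamma(t)}$, unique up to isomorphism. 3. There are isomorphisms of $\mathbb C$-algebras $$\mathscr A(\Gamma_1,\mathcal O)\cong\mathscr A(\Gamma_2,\mathcal O),\qquad \mathscr A^{\mathrm{split}}(\Gamma_1,\mathcal O)\cong\mathscr A^{\mathrm{split}}(\Gamma_2,\mathcal O),$$ which map the component of degree $t$ onto the component of degree $\phi(t)$ for all $t\in\Gamma_1$, and which send $[M]$, for $M\in A(t)\text{-wmod}_{\mathcal O}$, to $[M\otimes_R M^{\gamma(t)}]$, where $M\otimes_R M^{\gamma(t)}$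 is indeed an $A(\phi(t))$-module. -/

import Mathlib

open scoped TensorProduct DirectSum

universe u

namespace TGWA

/-! ### Twisted generalized Weyl algebras

Throughout, `σ i : RingAut R` is the automorphism `σ_i^{1/2}`, so that `σ_i = σ i ^ 2`.
A sign `±` is an element `ε : ℤˣ`. -/

section Algebra

variable {R : Type u} [CommRing R] {n : ℕ}

/-- Generators: the elements of `R`, and the symbols `X_i^±`. -/
inductive Gen (R : Type u) (n : ℕ) : Type u
  | coeff (r : R) : Gen R n
  | X (i : Fin n) (ε : ℤˣ) : Gen R n

/-- Defining relations of the twisted generalized Weyl construction. The first three say that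
`R` maps in by a ring homomorphism. -/
inductive Rel (σ : Fin n → RingAut R) (t : Fin n → R) :
    FreeAlgebra ℤ (Gen R n) → FreeAlgebra ℤ (Gen R n) → Prop
  | coeff_one : Rel σ t (FreeAlgebra.ι ℤ (.coeff 1)) 1
  | coeff_add (r s : R) : Rel σ t (FreeAlgebra.ι ℤ (.coeff (r + s)))
      (FreeAlgebra.ι ℤ (.coeff r) + FreeAlgebra.ι ℤ (.coeff s))
  | coeff_mul (r s : R) : Rel σ t (FreeAlgebra.ι ℤ (.coeff (r * s)))
      (FreeAlgebra.ι ℤ (.coeff r) * FreeAlgebra.ι ℤ (.coeff s))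
  | X_coeff (i : Fin n) (ε : ℤˣ) (r : R) :
      Rel σ t (FreeAlgebra.ι ℤ (.X i ε) * FreeAlgebra.ι ℤ (.coeff r))
        (FreeAlgebra.ι ℤ (.coeff ((σ i ^ (2 * (ε : ℤ))) r)) * FreeAlgebra.ι ℤ (.X i ε))
  | X_X (i : Fin n) (ε : ℤˣ) :
      Rel σ t (FreeAlgebra.ι ℤ (.X i ε) * FreeAlgebra.ι ℤ (.X i (-ε)))
        (FreeAlgebra.ι ℤ (.coeff ((σ i ^ (ε : ℤ)) (t i))))
  | X_comm (i j : Fin n) (hij : i ≠ j) (ε : ℤˣ) :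
      Rel σ t (FreeAlgebra.ι ℤ (.X i ε) * FreeAlgebra.ι ℤ (.X j (-ε)))
        (FreeAlgebra.ι ℤ (.X j (-ε)) * FreeAlgebra.ι ℤ (.X i ε))

/-- The twisted generalized Weyl construction `Ã(R, σ, t)`. -/
def Constr (σ : Fin n → RingAut R) (t : Fin n → R) : Type u := RingQuot (Rel σ t)

instance (σ : Fin n → RingAut R) (t : Fin n → R) : Ring (Constr σ t) :=
  inferInstanceAs (Ring (RingQuot (Rel σ t)))

/-- The quotient map from the free ring. -/
def Constr.mk (σ : Fin n → RingAut R) (t : Fin n → R) :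
    FreeAlgebra ℤ (Gen R n) →+* Constr σ t := RingQuot.mkRingHom (Rel σ t)

theorem Constr.mk_rel {σ : Fin n → RingAut R} {t : Fin n → R} {a b : FreeAlgebra ℤ (Gen R n)}
    (h : Rel σ t a b) : Constr.mk σ t a = Constr.mk σ t b := RingQuot.mkRingHom_rel h

/-- The structure map `R → Ã(R, σ, t)`. -/
def Constr.coeff (σ : Fin n → RingAut R) (t : Fin n → R) : R →+* Constr σ t :=
  RingHom.mk'
    { toFun := fun r => Constr.mk σ t (FreeAlgebra.ι ℤ (.coeff r))
      map_one' := (Constr.mk_rel Rel.coeff_one).trans (map_one _)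
      map_mul' := fun r s => (Constr.mk_rel (Rel.coeff_mul r s)).trans (map_mul _ _ _) }
    (fun r s => (Constr.mk_rel (Rel.coeff_add r s)).trans (map_add _ _ _))

/-- The generators `X_i^±` of `Ã(R, σ, t)`. -/
def Constr.X (σ : Fin n → RingAut R) (t : Fin n → R) (i : Fin n) (ε : ℤˣ) : Constr σ t :=
  Constr.mk σ t (FreeAlgebra.ι ℤ (.X i ε))

/-- The `R`-torsion elements of `Ã(R, σ, t)`, for `R` an integral domain. They form the two-sided
ideal `I`. -/
def Constr.IsTorsion (σ : Fin n → RingAut R) (t : Fin n → R) (a : Constr σ t) : Prop :=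
  ∃ r : R, r ≠ 0 ∧ Constr.coeff σ t r * a = 0

/-- The twisted generalized Weyl algebra `A(t) = A(R, σ, t) = Ã(R, σ, t) / I`, for `R` an integral
domain. -/
def Alg (σ : Fin n → RingAut R) (t : Fin n → R) : Type u :=
  RingQuot (fun a b : Constr σ t => Constr.IsTorsion σ t a ∧ b = 0)

instance (σ : Fin n → RingAut R) (t : Fin n → R) : Ring (Alg σ t) :=
  inferInstanceAs (Ring (RingQuot (fun a b : Constr σ t => Constr.IsTorsion σ t a ∧ b = 0)))

/-- The quotient map `Ã(R, σ, t) → A(R, σ, t)`. -/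
def Alg.mk (σ : Fin n → RingAut R) (t : Fin n → R) : Constr σ t →+* Alg σ t :=
  RingQuot.mkRingHom _

/-- The structure map `R → A(t)`. -/
def Alg.coeff (σ : Fin n → RingAut R) (t : Fin n → R) : R →+* Alg σ t :=
  (Alg.mk σ t).comp (Constr.coeff σ t)

/-- The generators `X_i^±` of `A(t)`. -/
def Alg.X (σ : Fin n → RingAut R) (t : Fin n → R) (i : Fin n) (ε : ℤˣ) : Alg σ t :=
  Alg.mk σ t (Constr.X σ t i ε)

/-- `A(R, σ, t)` is consistent if `R → A(R, σ, t)` is injective. -/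
def Consistent (σ : Fin n → RingAut R) (t : Fin n → R) : Prop :=
  Function.Injective (Alg.coeff σ t)

/-- The set `Ω`. -/
def Omega (σ : Fin n → RingAut R) : Set (Fin n → R) :=
  {t | (∀ i, t i ≠ 0) ∧ Consistent σ t}

/-- The automorphism `σ_1^{g_1} ⋯ σ_n^{g_n}` of `R`. -/
def shift (σ : Fin n → RingAut R) (g : Fin n → ℤ) : RingAut R :=
  (List.ofFn fun i => σ i ^ (2 * g i)).prod

/-- `O` is an orbit of the action of `ℤⁿ` on the maximal ideals of `R`. -/
def IsOrbit (σ : Fin n → RingAut R) (O : Set (MaximalSpectrum R)) : Prop :=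
  ∃ m₀ : MaximalSpectrum R,
    O = {m | ∃ g : Fin n → ℤ, m.asIdeal = m₀.asIdeal.map (shift σ g)}

/-- The stabilizers in `ℤⁿ` of the points of `O` are trivial. -/
def IsTorsionFreeOrbit (σ : Fin n → RingAut R) (O : Set (MaximalSpectrum R)) : Prop :=
  IsOrbit σ O ∧ ∀ m ∈ O, ∀ g : Fin n → ℤ, m.asIdeal.map (shift σ g) = m.asIdeal → g = 0

/-- The set `Ω_O^×`. -/
def OmegaUnits (σ : Fin n → RingAut R) (O : Set (MaximalSpectrum R)) : Set (Fin n → R) :=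
  {t | t ∈ Omega σ ∧ ∀ i, ∀ m ∈ O, σ i (t i) ∉ m.asIdeal}

theorem X_mul_coeff (σ : Fin n → RingAut R) (t : Fin n → R) (i : Fin n) (ε : ℤˣ) (r : R) :
    Alg.X σ t i ε * Alg.coeff σ t r =
      Alg.coeff σ t ((σ i ^ (2 * (ε : ℤ))) r) * Alg.X σ t i ε := by
  change Alg.mk σ t _ * Alg.mk σ t _ = Alg.mk σ t _ * Alg.mk σ t _
  rw [← map_mul, ← map_mul]
  congr 1
  change Constr.mk σ t _ * Constr.mk σ t _ = Constr.mk σ t _ * Constr.mk σ t _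
  rw [← map_mul, ← map_mul]
  exact Constr.mk_rel (Rel.X_coeff i ε r)

theorem X_mul_X (σ : Fin n → RingAut R) (t : Fin n → R) (i : Fin n) (ε : ℤˣ) :
    Alg.X σ t i ε * Alg.X σ t i (-ε) = Alg.coeff σ t ((σ i ^ (ε : ℤ)) (t i)) := by
  change Alg.mk σ t _ * Alg.mk σ t _ = Alg.mk σ t _
  rw [← map_mul]
  congr 1
  change Constr.mk σ t _ * Constr.mk σ t _ = Constr.mk σ t _
  rw [← map_mul]
  exact Constr.mk_rel (Rel.X_X i ε)

theorem X_comm (σ : Fin n → RingAut R) (t : Fin n → R) {i j : Fin n} (hij : i ≠ j) (ε : ℤˣ) :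
    Alg.X σ t i ε * Alg.X σ t j (-ε) = Alg.X σ t j (-ε) * Alg.X σ t i ε := by
  change Alg.mk σ t _ * Alg.mk σ t _ = Alg.mk σ t _ * Alg.mk σ t _
  rw [← map_mul, ← map_mul]
  congr 1
  change Constr.mk σ t _ * Constr.mk σ t _ = Constr.mk σ t _ * Constr.mk σ t _
  rw [← map_mul, ← map_mul]
  exact Constr.mk_rel (Rel.X_comm i j hij ε)

/-! ### Weight modules -/

/-- The weight space `M_m = {v ∈ M | m v = 0}`. -/
def weightSpace (M : Type u) [AddCommGroup M] [Module R M] (m : MaximalSpectrum R) :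
    Submodule R M :=
  Submodule.torsionBySet R M m.asIdeal

theorem iSupIndep_weightSpace (M : Type u) [AddCommGroup M] [Module R M] :
    iSupIndep (weightSpace (R := R) M) := by
  rw [iSupIndep_iff_supIndep]
  exact fun S => Submodule.supIndep_torsionBySet_ideal fun m _ m' _ h =>
    m.isMaximal.coprime_of_ne m'.isMaximal fun e => h (MaximalSpectrum.ext e)

/-- The objects of `A(t)-wmod_O`: weight modules with finite dimensional weight spaces and with
support contained in `O`. The `R`-module structure is the one induced by `R → A(t)`; a weight space
is finite dimensional over the field `R / m` iff it is finitely generated over `R`. -/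
structure WMod (σ : Fin n → RingAut R) (O : Set (MaximalSpectrum R)) (t : Fin n → R) :
    Type (u + 1) where
  carrier : Type u
  [addCommGroup : AddCommGroup carrier]
  [moduleR : Module R carrier]
  [module : Module (Alg σ t) carrier]
  coeff_smul : ∀ (r : R) (v : carrier), Alg.coeff σ t r • v = r • v
  iSup_weightSpace : ⨆ m : MaximalSpectrum R, weightSpace carrier m = ⊤
  finite : ∀ m : MaximalSpectrum R, Module.Finite R (weightSpace carrier m)
  support : ∀ m : MaximalSpectrum R, m ∉ O → weightSpace carrier m = ⊥

attribute [instance] WMod.addCommGroup WMod.moduleR WMod.module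

instance (σ : Fin n → RingAut R) (O : Set (MaximalSpectrum R)) (t : Fin n → R) :
    CoeSort (WMod σ O t) (Type u) := ⟨WMod.carrier⟩

variable {σ : Fin n → RingAut R} {O : Set (MaximalSpectrum R)} {s t t' : Fin n → R}

open scoped Classical in
/-- `M` is the internal direct sum of its weight spaces. -/
theorem WMod.isInternal (M : WMod σ O t) :
    DirectSum.IsInternal (fun m : MaximalSpectrum R => weightSpace (M : Type u) m) :=
  (DirectSum.isInternal_submodule_iff_iSupIndep_and_iSup_eq_top _).2
    ⟨iSupIndep_weightSpace _, M.iSup_weightSpace⟩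

theorem WMod.isSemisimple (M : WMod σ O t) : IsSemisimpleModule R M := by
  refine isSemisimpleModule_of_isSemisimpleModule_submodule'
    (p := fun m : MaximalSpectrum R => weightSpace (M : Type u) m) (fun m => ?_) M.iSup_weightSpace
  have hm := Submodule.torsionBySet_isTorsionBySet (R := R) (M := M) (m.asIdeal : Set R)
  let := m.isMaximal
  let := Ideal.Quotient.field m.asIdeal
  let := hm.module
  exact hm.isSemisimpleModule_iff.1 inferInstance

/-- A linear map of `A(t)`-modules is `R`-linear. -/
def toRLinear {M N : WMod σ O t} (f : M →ₗ[Alg σ t] N) : M →ₗ[R] N where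
  toFun := f
  map_add' := map_add f
  map_smul' r v := by
    rw [← M.coeff_smul, map_smul, N.coeff_smul, RingHom.id_apply]

/-! ### Tensor products of weight modules -/

theorem end_mul_apply {A : Type u} [AddCommGroup A] (f g : AddMonoid.End A) (x : A) :
    (f * g) x = f (g x) := rfl

theorem toAddMonoidEnd_apply' {A : Type u} [AddCommGroup A] [Module R A] (r : R) (x : A) :
    Module.toAddMonoidEnd R A r x = r • x := rfl

/-- The operator `X_i^±(t) ⊗ X_i^±(t')` on `M ⊗_R N`. -/
noncomputable def tensorX (M : WMod σ O t) (N : WMod σ O t') (i : Fin n) (ε : ℤˣ) :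
    AddMonoid.End (M ⊗[R] N) :=
  TensorProduct.liftAddHom
    (AddMonoidHom.mk' (fun v => AddMonoidHom.mk' (fun w =>
        (Alg.X σ t i ε • v) ⊗ₜ[R] (Alg.X σ t' i ε • w))
      (fun w w' => by rw [smul_add, TensorProduct.tmul_add]))
      (fun v v' => by ext w; simp [smul_add, TensorProduct.add_tmul]))
    (fun r v w => by
      simp only [AddMonoidHom.mk'_apply]
      rw [← M.coeff_smul, ← N.coeff_smul, smul_smul, smul_smul, X_mul_coeff, X_mul_coeff,
        ← smul_smul, ← smul_smul, M.coeff_smul, N.coeff_smul, TensorProduct.smul_tmul])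

@[simp] theorem tensorX_tmul (M : WMod σ O t) (N : WMod σ O t') (i : Fin n) (ε : ℤˣ)
    (v : M) (w : N) :
    tensorX M N i ε (v ⊗ₜ w) = (Alg.X σ t i ε • v) ⊗ₜ (Alg.X σ t' i ε • w) := rfl

/-- The action of the generators of `Ã(tt')` on `M ⊗_R N`. -/
noncomputable def tensorGen (M : WMod σ O t) (N : WMod σ O t') :
    Gen R n → AddMonoid.End (M ⊗[R] N)
  | .coeff r => Module.toAddMonoidEnd R (M ⊗[R] N) r
  | .X i ε => tensorX M N i ε

/-- The action of `Ã(s)`, `s = tt'`, on `M ⊗_R N`, for `M` an `A(t)`-module and `N` an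
`A(t')`-module: `r ∈ R` acts by scalar multiplication and `X_i^±` by
`X_i^±(t) ⊗ X_i^±(t')`. -/
noncomputable def tensorHom (hs : s = t * t') (M : WMod σ O t) (N : WMod σ O t') :
    Constr σ s →+* AddMonoid.End (M ⊗[R] N) :=
  RingQuot.lift ⟨(FreeAlgebra.lift ℤ (tensorGen M N)).toRingHom, by
    intro a b h
    refine DFunLike.ext _ _ fun x => ?_
    simp only [AlgHom.toRingHom_eq_coe, RingHom.coe_coe]
    induction h with
    | coeff_one => simp [tensorGen]
    | coeff_add r s => simp [tensorGen]
    | coeff_mul r s => simp [tensorGen]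
    | X_coeff i ε r =>
      simp only [map_mul, FreeAlgebra.lift_ι_apply, tensorGen, end_mul_apply,
        toAddMonoidEnd_apply']
      induction x with
      | zero => simp
      | add x y hx hy => simp only [smul_add, map_add, hx, hy]
      | tmul v w =>
        rw [TensorProduct.smul_tmul', tensorX_tmul, tensorX_tmul, TensorProduct.smul_tmul',
          ← M.coeff_smul, ← M.coeff_smul, smul_smul, smul_smul, X_mul_coeff]
    | X_X i ε =>
      subst hs
      simp only [map_mul, FreeAlgebra.lift_ι_apply, tensorGen, end_mul_apply,
        toAddMonoidEnd_apply', Pi.mul_apply]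
      induction x with
      | zero => simp
      | add x y hx hy => simp only [smul_add, map_add, hx, hy]
      | tmul v w =>
        rw [tensorX_tmul, tensorX_tmul, smul_smul, smul_smul, X_mul_X, X_mul_X, M.coeff_smul,
          N.coeff_smul, TensorProduct.smul_tmul_smul, mul_smul]
    | X_comm i j hij ε =>
      simp only [map_mul, FreeAlgebra.lift_ι_apply, tensorGen, end_mul_apply]
      induction x with
      | zero => simp
      | add x y hx hy => simp only [map_add, hx, hy]
      | tmul v w =>
        simp only [tensorX_tmul, smul_smul]
        rw [X_comm σ t hij, X_comm σ t' hij]⟩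

theorem tensorHom_mk (hs : s = t * t') (M : WMod σ O t) (N : WMod σ O t')
    (a : FreeAlgebra ℤ (Gen R n)) :
    tensorHom hs M N (Constr.mk σ s a) = FreeAlgebra.lift ℤ (tensorGen M N) a :=
  RingQuot.lift_mkRingHom_apply _ _ _

/-- The `Ã(tt')`-module structure of `M ⊗_R N` descends to `A(tt')`. -/
def TensorActs (hs : s = t * t') (M : WMod σ O t) (N : WMod σ O t') : Prop :=
  ∀ a : Constr σ s, Constr.IsTorsion σ s a → tensorHom hs M N a = 0

/-- The action of `A(tt')` on `M ⊗_R N`. -/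
noncomputable def tensorAlgHom {hs : s = t * t'} {M : WMod σ O t} {N : WMod σ O t'}
    (h : TensorActs hs M N) : Alg σ s →+* AddMonoid.End (M ⊗[R] N) :=
  RingQuot.lift ⟨tensorHom hs M N, fun a b hab => by rw [hab.2, h a hab.1, map_zero]⟩

theorem tensorAlgHom_mk {hs : s = t * t'} {M : WMod σ O t} {N : WMod σ O t'}
    (h : TensorActs hs M N) (a : Constr σ s) :
    tensorAlgHom h (Alg.mk σ s a) = tensorHom hs M N a :=
  RingQuot.lift_mkRingHom_apply _ _ _

theorem tensorAlgHom_coeff {hs : s = t * t'} {M : WMod σ O t} {N : WMod σ O t'}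
    (h : TensorActs hs M N) (r : R) (x : M ⊗[R] N) :
    tensorAlgHom h (Alg.coeff σ s r) x = r • x := by
  change tensorAlgHom h (Alg.mk σ s (Constr.mk σ s _)) x = _
  rw [tensorAlgHom_mk, tensorHom_mk, FreeAlgebra.lift_ι_apply]
  rfl

theorem iSup_range_weight (M : WMod σ O t) (N : WMod σ O t') :
    ⨆ m : MaximalSpectrum R, LinearMap.range (TensorProduct.map
      (weightSpace (M : Type u) m).subtype (weightSpace (N : Type u) m).subtype) = ⊤ := by
  rw [eq_top_iff, ← TensorProduct.span_tmul_eq_top, Submodule.span_le]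
  rintro _ ⟨v, w, rfl⟩
  have hv : v ∈ ⨆ m : MaximalSpectrum R, weightSpace (M : Type u) m := by
    rw [M.iSup_weightSpace]; trivial
  have hw : w ∈ ⨆ m : MaximalSpectrum R, weightSpace (N : Type u) m := by
    rw [N.iSup_weightSpace]; trivial
  induction hv using Submodule.iSup_induction' with
  | zero => rw [TensorProduct.zero_tmul]; exact Submodule.zero_mem _
  | add x y _ _ hx hy => rw [TensorProduct.add_tmul]; exact Submodule.add_mem _ hx hy
  | mem m v hv =>
    induction hw using Submodule.iSup_induction' with
    | zero => rw [TensorProduct.tmul_zero]; exact Submodule.zero_mem _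
    | add x y _ _ hx hy => rw [TensorProduct.tmul_add]; exact Submodule.add_mem _ hx hy
    | mem m' w hw =>
      by_cases h : m = m'
      · subst h
        exact Submodule.mem_iSup_of_mem m ⟨⟨v, hv⟩ ⊗ₜ ⟨w, hw⟩, rfl⟩
      · have hc : m.asIdeal ⊔ m'.asIdeal = ⊤ :=
          m.isMaximal.coprime_of_ne m'.isMaximal fun e => h (MaximalSpectrum.ext e)
        obtain ⟨a, ha, b, hb, hab⟩ :=
          Submodule.mem_sup.1 ((Ideal.eq_top_iff_one _).1 hc)
        have h0 : v ⊗ₜ[R] w = 0 := by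
          have hva : a • v = 0 := (Submodule.mem_torsionBySet_iff _ _).1 hv ⟨a, ha⟩
          have hwb : b • w = 0 := (Submodule.mem_torsionBySet_iff _ _).1 hw ⟨b, hb⟩
          calc v ⊗ₜ[R] w = (a + b) • (v ⊗ₜ[R] w) := by rw [hab, one_smul]
            _ = (a • v) ⊗ₜ[R] w + v ⊗ₜ[R] (b • w) := by
              rw [add_smul, TensorProduct.smul_tmul', TensorProduct.tmul_smul]
            _ = 0 := by rw [hva, hwb, TensorProduct.zero_tmul, TensorProduct.tmul_zero, add_zero]
        rw [h0]; exact Submodule.zero_mem _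

theorem range_weight_eq (M : WMod σ O t) (N : WMod σ O t') :
    (fun m : MaximalSpectrum R => LinearMap.range (TensorProduct.map
      (weightSpace (M : Type u) m).subtype (weightSpace (N : Type u) m).subtype)) =
    fun m => weightSpace (M ⊗[R] N) m := by
  refine ((iSupIndep_weightSpace (R := R) (M ⊗[R] N)).le_iff_eq_of_iSup_eq_top
    (iSup_range_weight M N)).1 fun m => ?_
  rintro _ ⟨x, rfl⟩
  refine (Submodule.mem_torsionBySet_iff _ _).2 fun a => ?_
  induction x with
  | zero => simp
  | add x y hx hy => rw [map_add, smul_add, hx, hy, add_zero]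
  | tmul v w =>
    rw [TensorProduct.map_tmul, TensorProduct.smul_tmul',
      show (a : R) • (weightSpace (M : Type u) m).subtype v = 0 from
        (Submodule.mem_torsionBySet_iff _ _).1 v.2 a, TensorProduct.zero_tmul]

/-- The object `M ⊗_R N` of `A(tt')-wmod_O`. -/
noncomputable def tensorObj {hs : s = t * t'} {M : WMod σ O t} {N : WMod σ O t'}
    (h : TensorActs hs M N) : WMod σ O s where
  carrier := M ⊗[R] N
  module := Module.compHom (M ⊗[R] N) (tensorAlgHom h)
  coeff_smul r x := tensorAlgHom_coeff h r x
  iSup_weightSpace := by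
    rw [← iSup_range_weight M N]
    exact iSup_congr fun m => (congrFun (range_weight_eq M N) m).symm
  finite m := by
    have := M.finite m
    have := N.finite m
    rw [← congrFun (range_weight_eq M N) m]
    infer_instance
  support m hm := by
    rw [← congrFun (range_weight_eq M N) m, eq_bot_iff]
    rintro _ ⟨x, rfl⟩
    induction x with
    | zero => simp
    | add x y hx hy => rw [map_add]; exact Submodule.add_mem _ hx hy
    | tmul v w =>
      have hv : (v : M) = 0 := by
        have := (M.support m hm).le v.2
        rwa [Submodule.mem_bot] at this
      simp [TensorProduct.map_tmul, hv]

theorem map_tensorGen {M M' : WMod σ O t} {N N' : WMod σ O t'}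
    (f : M →ₗ[Alg σ t] M') (g : N →ₗ[Alg σ t'] N') (c : FreeAlgebra ℤ (Gen R n)) :
    ∀ x : M ⊗[R] N, TensorProduct.map (toRLinear f) (toRLinear g)
        (FreeAlgebra.lift ℤ (tensorGen M N) c x) =
      FreeAlgebra.lift ℤ (tensorGen M' N') c
        (TensorProduct.map (toRLinear f) (toRLinear g) x) := by
  induction c using FreeAlgebra.induction with
  | grade0 k =>
    intro x
    rw [AlgHom.commutes, AlgHom.commutes, algebraMap_int_eq, algebraMap_int_eq]
    change TensorProduct.map (toRLinear f) (toRLinear g) (k • x) =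
      k • TensorProduct.map (toRLinear f) (toRLinear g) x
    exact map_zsmul _ _ _
  | grade1 y =>
    intro x
    rw [FreeAlgebra.lift_ι_apply, FreeAlgebra.lift_ι_apply]
    cases y with
    | coeff r => exact map_smul (TensorProduct.map (toRLinear f) (toRLinear g)) r x
    | X i ε =>
      simp only [tensorGen]
      induction x with
      | zero => simp
      | add x y hx hy => simp only [map_add, hx, hy]
      | tmul v w =>
        change f (Alg.X σ t i ε • v) ⊗ₜ[R] g (Alg.X σ t' i ε • w) =
          (Alg.X σ t i ε • f v) ⊗ₜ[R] (Alg.X σ t' i ε • g w)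
        rw [map_smul, map_smul]
  | mul a b ha hb =>
    intro x
    rw [map_mul, map_mul, end_mul_apply, end_mul_apply, ha, hb]
  | add a b ha hb =>
    intro x
    rw [map_add, map_add]
    exact (map_add _ _ _).trans (congrArg₂ (· + ·) (ha x) (hb x))

/-- The morphism `f ⊗ g` of `A(tt')`-modules. -/
noncomputable def tensorMap {hs : s = t * t'} {M M' : WMod σ O t} {N N' : WMod σ O t'}
    (h : TensorActs hs M N) (h' : TensorActs hs M' N')
    (f : M →ₗ[Alg σ t] M') (g : N →ₗ[Alg σ t'] N') :
    tensorObj h →ₗ[Alg σ s] tensorObj h' where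
  toFun := TensorProduct.map (toRLinear f) (toRLinear g)
  map_add' := map_add (TensorProduct.map (toRLinear f) (toRLinear g))
  map_smul' a x := by
    obtain ⟨b, rfl⟩ := RingQuot.mkRingHom_surjective _ a
    obtain ⟨c, rfl⟩ := RingQuot.mkRingHom_surjective _ b
    change TensorProduct.map (toRLinear f) (toRLinear g)
        (tensorAlgHom h (Alg.mk σ s (Constr.mk σ s c)) x) =
      tensorAlgHom h' (Alg.mk σ s (Constr.mk σ s c))
        (TensorProduct.map (toRLinear f) (toRLinear g) x)
    rw [tensorAlgHom_mk, tensorAlgHom_mk, tensorHom_mk, tensorHom_mk]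
    exact map_tensorGen f g c x

/-! ### Grothendieck groups -/

/-- Two kinds of Grothendieck groups: `K_0` and `K_0^split`. -/
inductive Kind
  | ordinary
  | split

/-- `P` is an extension of `N` by `M`: there is a short exact sequence `0 → M → P → N → 0`. For the
split kind: `P ≅ M ⊕ N`. -/
def IsExtension : Kind → WMod σ O t → WMod σ O t → WMod σ O t → Prop
  | .ordinary, M, P, N => ∃ (f : M →ₗ[Alg σ t] P) (g : P →ₗ[Alg σ t] N),
      Function.Injective f ∧ Function.Exact f g ∧ Function.Surjective g
  | .split, M, P, N => Nonempty (P ≃ₗ[Alg σ t] (M × N))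

/-- The relations `[P] - [M] - [N]`. -/
def relations (κ : Kind) (σ : Fin n → RingAut R) (O : Set (MaximalSpectrum R)) (t : Fin n → R) :
    Set (FreeAbelianGroup (WMod σ O t)) :=
  {x | ∃ M P N : WMod σ O t, IsExtension κ M P N ∧
    x = FreeAbelianGroup.of P - FreeAbelianGroup.of M - FreeAbelianGroup.of N}

/-- The Grothendieck group `K_0(A(t)-wmod_O)`, resp. the split Grothendieck group
`K_0^split(A(t)-wmod_O)`. -/
abbrev K0 (κ : Kind) (σ : Fin n → RingAut R) (O : Set (MaximalSpectrum R)) (t : Fin n → R) :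
    Type (u + 1) :=
  FreeAbelianGroup (WMod σ O t) ⧸ AddSubgroup.closure (relations κ σ O t)

/-- The class `[M]`. -/
def K0.cls (κ : Kind) (M : WMod σ O t) : K0 κ σ O t :=
  QuotientAddGroup.mk (FreeAbelianGroup.of M)

/-- Additive invariants of modules factor through the Grothendieck group. -/
noncomputable def K0.lift (κ : Kind) {G : Type (u + 1)} [AddCommGroup G] (F : WMod σ O t → G)
    (hF : ∀ M P N, IsExtension κ M P N → F P = F M + F N) : K0 κ σ O t →+ G :=
  QuotientAddGroup.lift _ (FreeAbelianGroup.lift F) ((AddSubgroup.closure_le _).2 (by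
    rintro _ ⟨M, P, N, h, rfl⟩
    change FreeAbelianGroup.lift F _ = 0
    simp [hF M P N h]))

@[simp] theorem K0.lift_cls (κ : Kind) {G : Type (u + 1)} [AddCommGroup G] (F : WMod σ O t → G)
    (hF : ∀ M P N, IsExtension κ M P N → F P = F M + F N) (M : WMod σ O t) :
    K0.lift κ F hF (K0.cls κ M) = F M :=
  FreeAbelianGroup.lift_apply_of F M

theorem K0.hom_ext (κ : Kind) {G : Type (u + 1)} [AddCommGroup G] {f g : K0 κ σ O t →+ G}
    (h : ∀ M, f (K0.cls κ M) = g (K0.cls κ M)) : f = g := by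
  refine QuotientAddGroup.addMonoidHom_ext _ (FreeAbelianGroup.lift_ext _ _ fun M => ?_)
  exact h M

theorem K0.cls_add (κ : Kind) {M P N : WMod σ O t} (h : IsExtension κ M P N) :
    K0.cls κ P = K0.cls κ M + K0.cls κ N := by
  have hmem : FreeAbelianGroup.of P - FreeAbelianGroup.of M - FreeAbelianGroup.of N ∈
      relations κ σ O t := ⟨M, P, N, h, rfl⟩
  have := (QuotientAddGroup.eq_zero_iff _).2 (AddSubgroup.subset_closure hmem)
  rw [QuotientAddGroup.mk_sub, QuotientAddGroup.mk_sub, sub_sub, sub_eq_zero] at this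
  exact this

theorem isExtension_split_iff {M P N : WMod σ O t} :
    IsExtension .split M P N ↔ ∃ (p₁ : P →ₗ[Alg σ t] M) (p₂ : P →ₗ[Alg σ t] N)
      (i₁ : M →ₗ[Alg σ t] P) (i₂ : N →ₗ[Alg σ t] P),
      (∀ x, p₁ (i₁ x) = x) ∧ (∀ x, p₂ (i₁ x) = 0) ∧ (∀ x, p₁ (i₂ x) = 0) ∧
        (∀ x, p₂ (i₂ x) = x) ∧ ∀ x, i₁ (p₁ x) + i₂ (p₂ x) = x := by
  constructor
  · rintro ⟨e⟩
    refine ⟨(LinearMap.fst _ _ _).comp e.toLinearMap, (LinearMap.snd _ _ _).comp e.toLinearMap,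
      e.symm.toLinearMap.comp (LinearMap.inl _ _ _), e.symm.toLinearMap.comp (LinearMap.inr _ _ _),
      ?_, ?_, ?_, ?_, ?_⟩
    · intro x; simp
    · intro x; simp
    · intro x; simp
    · intro x; simp
    · intro x
      apply e.injective
      simp
  · rintro ⟨p₁, p₂, i₁, i₂, h11, h21, h12, h22, h⟩
    refine ⟨LinearEquiv.ofLinearMap (p₁.prod p₂) (i₁.coprod i₂) ?_ ?_⟩
    · refine LinearMap.ext fun x => Prod.ext ?_ ?_
      · simp [h11, h12]
      · simp [h21, h22]
    · refine LinearMap.ext fun x => ?_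
      simpa using h x

section tensorMap

variable {hs : s = t * t'} {M M' M'' : WMod σ O t} {N N' N'' : WMod σ O t'}

theorem tensorMap_id (h : TensorActs hs M N) (x : tensorObj h) :
    tensorMap h h LinearMap.id LinearMap.id x = x := by
  exact LinearMap.congr_fun (TensorProduct.map_id (R := R) (M := M) (N := N)) x

theorem tensorMap_tensorMap (h : TensorActs hs M N) (h' : TensorActs hs M' N')
    (h'' : TensorActs hs M'' N'') (f : M →ₗ[Alg σ t] M') (g : N →ₗ[Alg σ t'] N')
    (f' : M' →ₗ[Alg σ t] M'') (g' : N' →ₗ[Alg σ t'] N'') (x : tensorObj h) :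
    tensorMap h' h'' f' g' (tensorMap h h' f g x) = tensorMap h h'' (f'.comp f) (g'.comp g) x := by
  exact (LinearMap.congr_fun (TensorProduct.map_comp (toRLinear f') (toRLinear g')
    (toRLinear f) (toRLinear g)) x).symm

theorem tensorMap_add_left (h : TensorActs hs M N) (h' : TensorActs hs M' N')
    (f f' : M →ₗ[Alg σ t] M') (g : N →ₗ[Alg σ t'] N') (x : tensorObj h) :
    tensorMap h h' (f + f') g x = tensorMap h h' f g x + tensorMap h h' f' g x := by
  exact LinearMap.congr_fun
    (TensorProduct.map_add_left (toRLinear f) (toRLinear f') (toRLinear g)) x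

theorem tensorMap_add_right (h : TensorActs hs M N) (h' : TensorActs hs M' N')
    (f : M →ₗ[Alg σ t] M') (g g' : N →ₗ[Alg σ t'] N') (x : tensorObj h) :
    tensorMap h h' f (g + g') x = tensorMap h h' f g x + tensorMap h h' f g' x := by
  exact LinearMap.congr_fun
    (TensorProduct.map_add_right (toRLinear f) (toRLinear g) (toRLinear g')) x

theorem tensorMap_zero_left (h : TensorActs hs M N) (h' : TensorActs hs M' N')
    (g : N →ₗ[Alg σ t'] N') (x : tensorObj h) : tensorMap h h' 0 g x = 0 := by
  exact LinearMap.congr_fun (TensorProduct.map_zero_left (M := M) (M₂ := M') (toRLinear g)) x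

theorem tensorMap_zero_right (h : TensorActs hs M N) (h' : TensorActs hs M' N')
    (f : M →ₗ[Alg σ t] M') (x : tensorObj h) : tensorMap h h' f 0 x = 0 := by
  exact LinearMap.congr_fun (TensorProduct.map_zero_right (N := N) (N₂ := N') (toRLinear f)) x

end tensorMap

theorem isExtension_tensor_left {hs : s = t * t'} {κ : Kind} {M P N : WMod σ O t}
    (Q : WMod σ O t') (hM : TensorActs hs M Q) (hP : TensorActs hs P Q) (hN : TensorActs hs N Q)
    (h : IsExtension κ M P N) :
    IsExtension κ (tensorObj hM) (tensorObj hP) (tensorObj hN) := by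
  cases κ with
  | ordinary =>
    obtain ⟨f, g, hf, hfg, hg⟩ := h
    refine ⟨tensorMap hM hP f LinearMap.id, tensorMap hP hN g LinearMap.id, ?_, ?_, ?_⟩
    · have := P.isSemisimple
      obtain ⟨p, hp⟩ := IsSemisimpleModule.extension_property (toRLinear f) hf LinearMap.id
      refine Function.LeftInverse.injective (g := TensorProduct.map p LinearMap.id) fun x => ?_
      change TensorProduct.map p LinearMap.id
        (TensorProduct.map (toRLinear f) (LinearMap.id : Q →ₗ[R] Q) x) = x
      rw [← LinearMap.comp_apply, ← TensorProduct.map_comp, hp, LinearMap.id_comp,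
        TensorProduct.map_id, LinearMap.id_apply]
    · exact rTensor_exact (f := toRLinear f) (g := toRLinear g) Q hfg hg
    · exact LinearMap.rTensor_surjective (Q : Type u) (g := toRLinear g) hg
  | split =>
    obtain ⟨p₁, p₂, i₁, i₂, h11, h21, h12, h22, h⟩ := isExtension_split_iff.1 h
    refine isExtension_split_iff.2 ⟨tensorMap hP hM p₁ LinearMap.id,
      tensorMap hP hN p₂ LinearMap.id, tensorMap hM hP i₁ LinearMap.id,
      tensorMap hN hP i₂ LinearMap.id, fun x => ?_, fun x => ?_, fun x => ?_, fun x => ?_,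
      fun x => ?_⟩
    · rw [tensorMap_tensorMap, show p₁.comp i₁ = LinearMap.id from LinearMap.ext h11]
      exact tensorMap_id _ x
    · rw [tensorMap_tensorMap, show p₂.comp i₁ = 0 from LinearMap.ext h21]
      exact tensorMap_zero_left _ _ _ x
    · rw [tensorMap_tensorMap, show p₁.comp i₂ = 0 from LinearMap.ext h12]
      exact tensorMap_zero_left _ _ _ x
    · rw [tensorMap_tensorMap, show p₂.comp i₂ = LinearMap.id from LinearMap.ext h22]
      exact tensorMap_id _ x
    · rw [tensorMap_tensorMap, tensorMap_tensorMap, ← tensorMap_add_left,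
        show i₁.comp p₁ + i₂.comp p₂ = LinearMap.id from LinearMap.ext h]
      exact tensorMap_id _ x

theorem isExtension_tensor_right {hs : s = t * t'} {κ : Kind} {M P N : WMod σ O t'}
    (Q : WMod σ O t) (hM : TensorActs hs Q M) (hP : TensorActs hs Q P) (hN : TensorActs hs Q N)
    (h : IsExtension κ M P N) :
    IsExtension κ (tensorObj hM) (tensorObj hP) (tensorObj hN) := by
  cases κ with
  | ordinary =>
    obtain ⟨f, g, hf, hfg, hg⟩ := h
    refine ⟨tensorMap hM hP LinearMap.id f, tensorMap hP hN LinearMap.id g, ?_, ?_, ?_⟩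
    · have := P.isSemisimple
      obtain ⟨p, hp⟩ := IsSemisimpleModule.extension_property (toRLinear f) hf LinearMap.id
      refine Function.LeftInverse.injective (g := TensorProduct.map LinearMap.id p) fun x => ?_
      change TensorProduct.map LinearMap.id p
        (TensorProduct.map (LinearMap.id : Q →ₗ[R] Q) (toRLinear f) x) = x
      rw [← LinearMap.comp_apply, ← TensorProduct.map_comp, hp, LinearMap.id_comp,
        TensorProduct.map_id, LinearMap.id_apply]
    · exact lTensor_exact (f := toRLinear f) (g := toRLinear g) Q hfg hg
    · exact LinearMap.lTensor_surjective (Q : Type u) (g := toRLinear g) hg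
  | split =>
    obtain ⟨p₁, p₂, i₁, i₂, h11, h21, h12, h22, h⟩ := isExtension_split_iff.1 h
    refine isExtension_split_iff.2 ⟨tensorMap hP hM LinearMap.id p₁,
      tensorMap hP hN LinearMap.id p₂, tensorMap hM hP LinearMap.id i₁,
      tensorMap hN hP LinearMap.id i₂, fun x => ?_, fun x => ?_, fun x => ?_, fun x => ?_,
      fun x => ?_⟩
    · rw [tensorMap_tensorMap, show p₁.comp i₁ = LinearMap.id from LinearMap.ext h11]
      exact tensorMap_id _ x
    · rw [tensorMap_tensorMap, show p₂.comp i₁ = 0 from LinearMap.ext h21]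
      exact tensorMap_zero_right _ _ _ x
    · rw [tensorMap_tensorMap, show p₁.comp i₂ = 0 from LinearMap.ext h12]
      exact tensorMap_zero_right _ _ _ x
    · rw [tensorMap_tensorMap, show p₂.comp i₂ = LinearMap.id from LinearMap.ext h22]
      exact tensorMap_id _ x
    · rw [tensorMap_tensorMap, tensorMap_tensorMap, ← tensorMap_add_right,
        show i₁.comp p₁ + i₂.comp p₂ = LinearMap.id from LinearMap.ext h]
      exact tensorMap_id _ x

/-- `M ⊗_R N` is a module over `A(tt')` for all `M` in `A(t)-wmod_O` and `N` in `A(t')-wmod_O`. -/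
def TensorDefined (σ : Fin n → RingAut R) (O : Set (MaximalSpectrum R)) {s t t' : Fin n → R}
    (hs : s = t * t') : Prop :=
  ∀ (M : WMod σ O t) (N : WMod σ O t'), TensorActs hs M N

open scoped Classical in
/-- The product `K_0(A(t)-wmod_O) × K_0(A(t')-wmod_O) → K_0(A(tt')-wmod_O)`,
`[M] [N] = [M ⊗_R N]`, and likewise for the split Grothendieck groups. For a pair `(t, t')` for
which the `Ã(tt')`-modules `M ⊗_R N` do not all descend to `A(tt')`, so that this formula makes no
sense, the product is set to zero. -/
noncomputable def K0.mul (κ : Kind) (hs : s = t * t') :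
    K0 κ σ O t →+ K0 κ σ O t' →+ K0 κ σ O s :=
  if h : TensorDefined σ O hs then
    K0.lift κ
      (fun M => K0.lift κ (fun N => K0.cls κ (tensorObj (h M N))) fun N P Q hNPQ =>
        K0.cls_add κ (isExtension_tensor_right M _ _ _ hNPQ))
      (fun M P N hMPN =>
        K0.hom_ext κ fun Q => by
          simp only [K0.lift_cls, AddMonoidHom.add_apply]
          exact K0.cls_add κ (isExtension_tensor_left Q _ _ _ hMPN))
  else 0

/-- `[M] [N] = [M ⊗_R N]`. -/
theorem K0.mul_cls (κ : Kind) {hs : s = t * t'} (h : TensorDefined σ O hs) (M : WMod σ O t)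
    (N : WMod σ O t') :
    K0.mul κ hs (K0.cls κ M) (K0.cls κ N) = K0.cls κ (tensorObj (h M N)) := by
  rw [K0.mul, dif_pos h, K0.lift_cls, K0.lift_cls]

/-! ### The graded algebras -/

variable (κ : Kind) (σ : Fin n → RingAut R) (O : Set (MaximalSpectrum R))

/-- The homogeneous component `ℂ ⊗_ℤ K_0(A(t)-wmod_O)`, `t ∈ Γ`. Mathlib's convention is that
gradings are by additive monoids. -/
abbrev Component (Γ : Submonoid (Fin n → R)) (t : Additive Γ) : Type (u + 1) :=
  ℂ ⊗[ℤ] K0 κ σ O (t.toMul : Fin n → R)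

/-- The product of homogeneous elements: `(a ⊗ x) (b ⊗ y) = ab ⊗ xy`. -/
noncomputable def componentMul (Γ : Submonoid (Fin n → R)) (t t' : Additive Γ) :
    Component κ σ O Γ t →ₗ[ℤ] Component κ σ O Γ t' →ₗ[ℤ] Component κ σ O Γ (t + t') :=
  TensorProduct.map₂ (LinearMap.mul ℤ ℂ)
    (AddMonoidHom.toIntLinearMap
      ((addMonoidHomLequivInt ℤ).toAddMonoidHom.comp (K0.mul κ (σ := σ) (O := O)
        (rfl : ((t + t').toMul : Fin n → R) = (t.toMul : Fin n → R) * (t'.toMul : Fin n → R)))))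

noncomputable instance (Γ : Submonoid (Fin n → R)) :
    DirectSum.GNonUnitalNonAssocSemiring (Component κ σ O Γ) where
  mul {t t'} x y := componentMul κ σ O Γ t t' x y
  mul_zero _ := map_zero _
  zero_mul _ := by rw [map_zero, LinearMap.zero_apply]
  mul_add _ _ _ := map_add _ _ _
  add_mul x y z := LinearMap.congr_fun (map_add (componentMul κ σ O Γ _ _) x y) z

/-- The graded algebra `𝒜(Γ, O) = ⨁_{t ∈ Γ} ℂ ⊗_ℤ K_0(A(t)-wmod_O)`, resp. its split version. -/
def GrAlg (Γ : Submonoid (Fin n → R)) : Type (u + 1) :=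
  ⨁ t : Additive Γ, Component κ σ O Γ t

open scoped Classical in
noncomputable instance (Γ : Submonoid (Fin n → R)) :
    NonUnitalNonAssocSemiring (GrAlg κ σ O Γ) :=
  inferInstanceAs (NonUnitalNonAssocSemiring (⨁ t : Additive Γ, Component κ σ O Γ t))

noncomputable instance (Γ : Submonoid (Fin n → R)) : Module ℂ (GrAlg κ σ O Γ) :=
  inferInstanceAs (Module ℂ (⨁ t : Additive Γ, Component κ σ O Γ t))

open scoped Classical in
/-- The inclusion of the homogeneous component of degree `t` into `𝒜(Γ, O)`. -/
noncomputable def GrAlg.of (Γ : Submonoid (Fin n → R)) (t : Γ) :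
    Component κ σ O Γ (Additive.ofMul t) →ₗ[ℂ] GrAlg κ σ O Γ :=
  DirectSum.lof ℂ (Additive Γ) (Component κ σ O Γ) (Additive.ofMul t)

/-- The homogeneous component of degree `t` in `𝒜(Γ, O)`. -/
noncomputable def GrAlg.deg (Γ : Submonoid (Fin n → R)) (t : Γ) :
    Submodule ℂ (GrAlg κ σ O Γ) :=
  LinearMap.range (GrAlg.of κ σ O Γ t)

variable {σ O}

/-- The class `[M]` in `𝒜(Γ, O)` of an object `M` of `A(t)-wmod_O`, `t ∈ Γ`. -/
noncomputable def GrAlg.cls {Γ : Submonoid (Fin n → R)} (t : Γ)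
    (M : WMod σ O (t : Fin n → R)) : GrAlg κ σ O Γ :=
  GrAlg.of κ σ O Γ t ((1 : ℂ) ⊗ₜ K0.cls κ M)

open scoped Classical in
/-- `[M] [N] = [M ⊗_R N]` in `𝒜(Γ, O)`. -/
theorem GrAlg.cls_mul_cls {Γ : Submonoid (Fin n → R)} {t t' : Γ}
    (h : TensorDefined σ O (rfl : ((t * t' : Γ) : Fin n → R) = t * t'))
    (M : WMod σ O (t : Fin n → R)) (N : WMod σ O (t' : Fin n → R)) :
    GrAlg.cls κ t M * GrAlg.cls κ t' N = GrAlg.cls κ (t * t') (tensorObj (h M N)) := by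
  refine (DirectSum.of_mul_of (A := Component κ σ O Γ) (i := Additive.ofMul t)
    (j := Additive.ofMul t') ((1 : ℂ) ⊗ₜ K0.cls κ M) ((1 : ℂ) ⊗ₜ K0.cls κ N)).trans ?_
  change GrAlg.of κ σ O Γ (t * t') (((1 : ℂ) * 1) ⊗ₜ
    K0.mul κ (rfl : ((t * t' : Γ) : Fin n → R) = t * t') (K0.cls κ M) (K0.cls κ N)) = _
  rw [K0.mul_cls κ h, one_mul, GrAlg.cls]

end Algebra

end TGWA

/-! ### Words in `Ã(t)`, their monomials, and the grading. -/

namespace TGWA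

section Words

variable {R : Type u} [CommRing R] {n : ℕ}

/-! ### Relations in `Ã(t)` -/

/-! Everything reduces to words in the letters `X_i^±`. The ring `Ã(t)` is `ℤⁿ`-graded and spanned
over `R` by words, and a word `w` of degree zero equals a coefficient `c_w(t)`, a product of shifts
of the `σ_i^{1/2}(t_i)` (`exists_monomial`). The same function `c_w` serves every `t`, and it is
multiplicative: `c_w(tγ) = c_w(t) c_w(γ)`.

Fix a degree `g` and a word `u` of degree `-g`. For `t ∈ Ω`, a combination `∑ r_w w` of words of
degree `g` is torsion if and only if `∑ r_w c_{wu}(t) = 0` (`sum_monomial_eq_zero_of_isTorsion`,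
`isTorsion_of_sum_monomial_eq_zero`). Passing from `t` to `tγ` therefore only replaces `r_w` by `r_w
c_{wu}(γ)` in the criterion.

For `γ ∈ Ω_O^×` the values `c_w(γ)` are units modulo every `m ∈ O` (`monomial_notMem`). Hence words
act injectively on the weight spaces of an `A(γ)`-module, the induced module `A(γ)/A(γ)m` is
non-zero with one-dimensional weight spaces on `O`, and it is the only simple object. Call it the
line `L_γ`, with basis vectors `e_m`. The map `v ↦ v ⊗ e_m` on `M_m` identifies `M` with `M ⊗ L_γ`
over `R`, and changes `X_i^±` by an invertible scalar on each weight space. Along a word `w` of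
degree `g` these scalars multiply to `c_{wu}(γ) l` with `l` independent of `w`
(`Line.exists_twist`). With the torsion criterion this shows that `M ⊗ L_γ` is a module over
`A(tγ)`, that dividing by the scalars is an inverse construction (`Line.untwist`), and that
admissibility is unchanged (`tensorDefined_iff`). On Grothendieck groups the result is an
isomorphism in each degree.

For multiplicativity, `L_{γ₁} ⊗ L_{γ₂}` again has one-dimensional weight spaces on `O`, so it is the
simple module for `γ₁γ₂`; exchanging the middle factors of `(M ⊗ N) ⊗ (L_{γ₁} ⊗ L_{γ₂})` finishes
the argument (`Line.k0Equiv_mul`). -/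

theorem Constr.X_mul_coeff (σ : Fin n → RingAut R) (t : Fin n → R) (i : Fin n) (ε : ℤˣ) (r : R) :
    Constr.X σ t i ε * Constr.coeff σ t r =
      Constr.coeff σ t ((σ i ^ (2 * (ε : ℤ))) r) * Constr.X σ t i ε := by
  change Constr.mk σ t _ * Constr.mk σ t _ = Constr.mk σ t _ * Constr.mk σ t _
  rw [← map_mul, ← map_mul]
  exact Constr.mk_rel (Rel.X_coeff i ε r)

theorem Constr.X_mul_X (σ : Fin n → RingAut R) (t : Fin n → R) (i : Fin n) (ε : ℤˣ) :
    Constr.X σ t i ε * Constr.X σ t i (-ε) = Constr.coeff σ t ((σ i ^ (ε : ℤ)) (t i)) := by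
  change Constr.mk σ t _ * Constr.mk σ t _ = Constr.mk σ t _
  rw [← map_mul]
  exact Constr.mk_rel (Rel.X_X i ε)

theorem Constr.X_comm (σ : Fin n → RingAut R) (t : Fin n → R) {i j : Fin n} (hij : i ≠ j)
    (ε : ℤˣ) : Constr.X σ t i ε * Constr.X σ t j (-ε) = Constr.X σ t j (-ε) * Constr.X σ t i ε := by
  change Constr.mk σ t _ * Constr.mk σ t _ = Constr.mk σ t _ * Constr.mk σ t _
  rw [← map_mul, ← map_mul]
  exact Constr.mk_rel (Rel.X_comm i j hij ε)

/-! ### Shifts -/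

theorem List.prod_map_mul_of_commute {ι G : Type*} [Monoid G] (l : List ι) (f g : ι → G)
    (h : ∀ i j, Commute (f i) (g j)) :
    (l.map fun i => f i * g i).prod = (l.map f).prod * (l.map g).prod := by
  induction l with
  | nil => simp
  | cons a l ih =>
    have hc : Commute (l.map f).prod (g a) := Commute.list_prod_left _ _ (by
      intro x hx
      obtain ⟨i, -, rfl⟩ := List.mem_map.1 hx
      exact h i a)
    simp only [List.map_cons, List.prod_cons, ih]
    rw [mul_assoc, mul_assoc, ← mul_assoc (g a), ← hc.eq, mul_assoc]

theorem shift_zero (σ : Fin n → RingAut R) : shift σ 0 = 1 := by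
  simp [shift, List.ofFn_eq_map]

theorem shift_add {σ : Fin n → RingAut R} (hσ : ∀ i j, Commute (σ i) (σ j)) (g h : Fin n → ℤ) :
    shift σ (g + h) = shift σ g * shift σ h := by
  simp only [shift, List.ofFn_eq_map]
  rw [← List.prod_map_mul_of_commute]
  · simp [mul_add, zpow_add]
  · exact fun i j => (hσ i j).zpow_zpow _ _

theorem shift_single (σ : Fin n → RingAut R) (i : Fin n) (k : ℤ) :
    shift σ (Pi.single i k) = σ i ^ (2 * k) := by
  simp only [shift, List.ofFn_eq_map]
  rw [List.prod_map_eq_pow_single i]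
  · rw [List.count_eq_one_of_mem (List.nodup_finRange n) (List.mem_finRange i)]
    simp
  · intro j hj _
    simp [hj]

/-! ### Words in the generators -/

/-- The degree in `ℤⁿ` of a word in the letters `X_i^±`. -/
def degree (w : List (Fin n × ℤˣ)) : Fin n → ℤ :=
  (w.map fun x => Pi.single x.1 (x.2 : ℤ)).sum

@[simp] theorem degree_nil : degree ([] : List (Fin n × ℤˣ)) = 0 := rfl

@[simp] theorem degree_cons (x : Fin n × ℤˣ) (w : List (Fin n × ℤˣ)) :
    degree (x :: w) = Pi.single x.1 (x.2 : ℤ) + degree w := by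
  simp [degree]

@[simp] theorem degree_append (w w' : List (Fin n × ℤˣ)) :
    degree (w ++ w') = degree w + degree w' := by
  simp [degree]

/-- The degrees of words form a subgroup, by concatenation and by flipping all signs, and it
contains the standard basis. The lemma supplies the auxiliary words `u` of degree `-g`. -/
theorem exists_degree_eq (g : Fin n → ℤ) : ∃ w : List (Fin n × ℤˣ), degree w = g := by
  let H : AddSubgroup (Fin n → ℤ) :=
    { carrier := {g | ∃ w : List (Fin n × ℤˣ), degree w = g}
      zero_mem' := ⟨[], rfl⟩
      add_mem' := by
        rintro _ _ ⟨v, rfl⟩ ⟨w, rfl⟩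
        exact ⟨v ++ w, degree_append v w⟩
      neg_mem' := by
        rintro _ ⟨w, rfl⟩
        refine ⟨w.map fun x => (x.1, -x.2), ?_⟩
        induction w with
        | nil => simp
        | cons x w ih =>
          rw [List.map_cons, degree_cons, degree_cons, ih, neg_add]
          simp [Pi.single_neg] }
  change g ∈ H
  rw [← Finset.univ_sum_single g]
  refine sum_mem fun i _ => ?_
  have h : Pi.single i (1 : ℤ) ∈ H := ⟨[(i, 1)], by simp⟩
  have := H.zsmul_mem h (g i)
  rwa [← Pi.single_smul', smul_eq_mul, mul_one] at this

/-- The image in `Ã(t)` of a word. -/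
def word (σ : Fin n → RingAut R) (t : Fin n → R) (w : List (Fin n × ℤˣ)) : Constr σ t :=
  (w.map fun x => Constr.X σ t x.1 x.2).prod

@[simp] theorem word_nil (σ : Fin n → RingAut R) (t : Fin n → R) : word σ t [] = 1 := rfl

@[simp] theorem word_cons (σ : Fin n → RingAut R) (t : Fin n → R) (x : Fin n × ℤˣ)
    (w : List (Fin n × ℤˣ)) : word σ t (x :: w) = Constr.X σ t x.1 x.2 * word σ t w := by
  simp [word]

@[simp] theorem word_append (σ : Fin n → RingAut R) (t : Fin n → R) (w w' : List (Fin n × ℤˣ)) :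
    word σ t (w ++ w') = word σ t w * word σ t w' := by
  simp [word]

theorem word_mul_coeff {σ : Fin n → RingAut R} (hσ : ∀ i j, Commute (σ i) (σ j)) (t : Fin n → R)
    (w : List (Fin n × ℤˣ)) (r : R) :
    word σ t w * Constr.coeff σ t r = Constr.coeff σ t (shift σ (degree w) r) * word σ t w := by
  induction w with
  | nil => simp [shift_zero]
  | cons x w ih =>
    rw [word_cons, mul_assoc, ih, ← mul_assoc, Constr.X_mul_coeff, mul_assoc, degree_cons,
      shift_add hσ, shift_single]
    rfl

/-- Monomials in the elements `σ_j^{±1} ⋯ (σ_i^{1/2}(t_i))`, as functions of `t`. -/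
def IsMonomial (σ : Fin n → RingAut R) (c : (Fin n → R) →* R) : Prop :=
  ∀ S : Submonoid R, (∀ (j : Fin n) (ε : ℤˣ), ∀ r ∈ S, (σ j ^ (2 * (ε : ℤ))) r ∈ S) →
    ∀ t : Fin n → R, (∀ i, σ i (t i) ∈ S) → c t ∈ S

theorem IsMonomial.one (σ : Fin n → RingAut R) : IsMonomial σ 1 := fun S _ _ _ => S.one_mem

theorem IsMonomial.mul {σ : Fin n → RingAut R} {c d : (Fin n → R) →* R} (hc : IsMonomial σ c)
    (hd : IsMonomial σ d) : IsMonomial σ (c * d) := fun S hS t ht =>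
  S.mul_mem (hc S hS t ht) (hd S hS t ht)

theorem IsMonomial.comp {σ : Fin n → RingAut R} {c : (Fin n → R) →* R} (hc : IsMonomial σ c)
    (j : Fin n) (ε : ℤˣ) :
    IsMonomial σ ((MonoidHomClass.toMonoidHom (σ j ^ (2 * (ε : ℤ)))).comp c) := fun S hS t ht =>
  hS j ε _ (hc S hS t ht)

/-- The monomial `σ_i^{±1/2}(t_i)`. -/
def genMonomial (σ : Fin n → RingAut R) (i : Fin n) (ε : ℤˣ) : (Fin n → R) →* R :=
  (MonoidHomClass.toMonoidHom (σ i ^ (ε : ℤ))).comp (Pi.evalMonoidHom (fun _ => R) i)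

/-- `σ_i^{1/2}(t_i)` is a generator, and `σ_i^{-1/2}(t_i)` is its shift by `σ_i^{-1}`. -/
theorem genMonomial_isMonomial (σ : Fin n → RingAut R) (i : Fin n) (ε : ℤˣ) :
    IsMonomial σ (genMonomial σ i ε) := by
  intro S hS t ht
  change (σ i ^ (ε : ℤ)) (t i) ∈ S
  obtain rfl | rfl := Int.units_eq_one_or ε
  · simpa using ht i
  · have h := hS i (-1) _ (ht i)
    have e : σ i ^ ((-1 : ℤˣ) : ℤ) = σ i ^ (2 * ((-1 : ℤˣ) : ℤ)) * σ i := by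
      rw [← zpow_add_one]; norm_num
    rw [e]
    exact h

/-- The word `X_{i_1}^ε X_{i_2}^ε ⋯`. -/
def signWord (ε : ℤˣ) (l : List (Fin n)) : List (Fin n × ℤˣ) := l.map fun i => (i, ε)

theorem X_mul_signWord_of_notMem (σ : Fin n → RingAut R) (t : Fin n → R) (i : Fin n) (ε : ℤˣ)
    (l : List (Fin n)) (h : i ∉ l) :
    Constr.X σ t i ε * word σ t (signWord (-ε) l) =
      word σ t (signWord (-ε) l) * Constr.X σ t i ε := by
  induction l with
  | nil => simp [signWord]
  | cons j l ih =>
    simp only [List.mem_cons, not_or] at h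
    have e : signWord (-ε) (j :: l) = (j, -ε) :: signWord (-ε) l := rfl
    rw [e, word_cons, ← mul_assoc, Constr.X_comm σ t h.1, mul_assoc, ih h.2, mul_assoc]

/-- `X_i^ε` commutes past the letters `X_j^{-ε}`, `j ≠ i`, until the first `X_i^{-ε}`, where the
pair contracts to a coefficient that the letters already passed then shift. The monomial is chosen
before `t`, so that one function serves all `t`. -/
theorem X_mul_signWord_of_mem (σ : Fin n → RingAut R) (i : Fin n) (ε : ℤˣ)
    (l : List (Fin n)) (h : i ∈ l) : ∃ c, IsMonomial σ c ∧ ∀ t,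
      Constr.X σ t i ε * word σ t (signWord (-ε) l) =
        Constr.coeff σ t (c t) * word σ t (signWord (-ε) (l.erase i)) := by
  induction l with
  | nil => simp at h
  | cons j l ih =>
    have e (j : Fin n) (l) : signWord (-ε) (j :: l) = (j, -ε) :: signWord (-ε) l := rfl
    by_cases hj : j = i
    · subst hj
      refine ⟨genMonomial σ j ε, genMonomial_isMonomial σ j ε, fun t => ?_⟩
      rw [e, word_cons, ← mul_assoc, Constr.X_mul_X, List.erase_cons_head]
      rfl
    · obtain ⟨c, hc, h⟩ := ih (by simpa [Ne.symm hj] using h)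
      refine ⟨_, hc.comp j (-ε), fun t => ?_⟩
      rw [List.erase_cons_tail (by simpa using hj), e, e, word_cons, word_cons, ← mul_assoc,
        Constr.X_comm σ t (Ne.symm hj), mul_assoc, h, ← mul_assoc, Constr.X_mul_coeff, mul_assoc]
      rfl

/-- No relation commutes letters of equal sign, so the normal form only collects the positive
letters on the left and keeps the order within each sign. A new letter `X_i^-` on the left either
contracts with a letter of `p` or passes through `p` and joins `q`. -/
theorem word_normalForm (σ : Fin n → RingAut R) (w : List (Fin n × ℤˣ)) :
    ∃ (p q : List (Fin n)) (c : (Fin n → R) →* R), IsMonomial σ c ∧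
      (∀ i, degree w i = p.count i - q.count i) ∧
      ∀ t, word σ t w =
        Constr.coeff σ t (c t) * (word σ t (signWord 1 p) * word σ t (signWord (-1) q)) := by
  induction w with
  | nil => exact ⟨[], [], 1, IsMonomial.one σ, by simp, fun t => by simp [signWord]⟩
  | cons x w ih =>
    obtain ⟨i, ε⟩ := x
    obtain ⟨p, q, c, hc, hd, h⟩ := ih
    obtain rfl | rfl := Int.units_eq_one_or ε
    · refine ⟨i :: p, q, _, hc.comp i 1, fun j => ?_, fun t => ?_⟩
      · rw [degree_cons, Pi.add_apply, hd, List.count_cons, Pi.single_apply]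
        by_cases hij : i = j
        · subst hij; simp; ring
        · simp [hij, Ne.symm hij]
      · rw [word_cons, h, ← mul_assoc, Constr.X_mul_coeff, mul_assoc, ← mul_assoc (Constr.X _ _ _ _)]
        rfl
    · by_cases hip : i ∈ p
      · obtain ⟨d, hd', h'⟩ := X_mul_signWord_of_mem σ i (-1) p hip
        refine ⟨p.erase i, q, _, (hc.comp i (-1)).mul hd', fun j => ?_, fun t => ?_⟩
        · rw [degree_cons, Pi.add_apply, hd, Pi.single_apply]
          by_cases hij : i = j
          · subst hij
            have := List.count_pos_iff.2 hip
            rw [List.count_erase_self, Nat.cast_sub (by omega)]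
            simp; ring
          · rw [List.count_erase_of_ne (Ne.symm hij)]
            simp [Ne.symm hij]
        · have h' := h' t
          rw [neg_neg] at h'
          rw [word_cons, h, ← mul_assoc, Constr.X_mul_coeff, mul_assoc,
            ← mul_assoc (Constr.X _ _ _ _), h', mul_assoc, ← mul_assoc, ← map_mul]
          rfl
      · refine ⟨p, i :: q, _, hc.comp i (-1), fun j => ?_, fun t => ?_⟩
        · rw [degree_cons, Pi.add_apply, hd, List.count_cons, Pi.single_apply]
          by_cases hij : i = j
          · subst hij; simp; ring
          · simp [hij, Ne.symm hij]
        · have h' := X_mul_signWord_of_notMem σ t i (-1) p hip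
          rw [neg_neg] at h'
          rw [word_cons, h, ← mul_assoc, Constr.X_mul_coeff, mul_assoc,
            ← mul_assoc (Constr.X _ _ _ _), h', mul_assoc]
          rfl

/-- The last letter `X_j^+` of the positive word contracts with the first `X_j^-` of the negative
one, so the induction removes positive letters from the right. -/
theorem signWord_mul_signWord_of_perm (σ : Fin n → RingAut R) (p : List (Fin n)) :
    ∀ q : List (Fin n), p.Perm q → ∃ c, IsMonomial σ c ∧ ∀ t,
      word σ t (signWord 1 p) * word σ t (signWord (-1) q) = Constr.coeff σ t (c t) := by
  induction p using List.reverseRecOn with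
  | nil =>
    intro q hq
    rw [List.nil_perm.1 hq]
    exact ⟨1, IsMonomial.one σ, fun t => by simp [signWord]⟩
  | append_singleton p j ih =>
    intro q hq
    have hj : j ∈ q := hq.subset (by simp)
    obtain ⟨d, hd, h⟩ := X_mul_signWord_of_mem σ j 1 q hj
    obtain ⟨c, hc, h'⟩ := ih (q.erase j) (by
      have h1 := (hq.erase j).symm
      refine (h1.trans ?_).symm
      have h2 : (p ++ [j]).Perm (j :: p) := by simp
      simpa using h2.erase j)
    -- The coefficient `d(t)` is moved to the left one letter at a time; each letter shifts it, so
    -- it stays a monomial.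
    have key : ∃ d', IsMonomial σ d' ∧ ∀ t, word σ t (signWord 1 p) * Constr.coeff σ t (d t) =
        Constr.coeff σ t (d' t) * word σ t (signWord 1 p) := by
      generalize signWord 1 p = w
      induction w with
      | nil => exact ⟨d, hd, fun t => by simp⟩
      | cons x w ih =>
        obtain ⟨d', hd', h⟩ := ih
        refine ⟨_, hd'.comp x.1 x.2, fun t => ?_⟩
        rw [word_cons, mul_assoc, h, ← mul_assoc, Constr.X_mul_coeff, mul_assoc]
        rfl
    obtain ⟨d', hd', h''⟩ := key
    refine ⟨_, hd'.mul hc, fun t => ?_⟩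
    have e : signWord (1 : ℤˣ) (p ++ [j]) = signWord 1 p ++ [(j, 1)] := by simp [signWord]
    rw [e, word_append, word_cons, word_nil, mul_one, mul_assoc, h, ← mul_assoc, h'', mul_assoc,
      h', ← map_mul]
    rfl

/-- A word of degree zero is a monomial in the `t_i` and their shifts. -/
theorem exists_monomial (σ : Fin n → RingAut R) {w : List (Fin n × ℤˣ)} (hw : degree w = 0) :
    ∃ c, IsMonomial σ c ∧ ∀ t, word σ t w = Constr.coeff σ t (c t) := by
  obtain ⟨p, q, c, hc, hd, h⟩ := word_normalForm σ w
  obtain ⟨d, hd', h'⟩ := signWord_mul_signWord_of_perm σ p q (List.perm_iff_count.2 fun i => by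
    have := hd i
    rw [hw, Pi.zero_apply] at this
    omega)
  refine ⟨c * d, hc.mul hd', fun t => ?_⟩
  rw [h, h', ← map_mul]
  rfl

open scoped Classical in
/-- The monomial `c` with `w = c(t)` in `Ã(t)`, for a word `w` of degree zero. -/
noncomputable def monomial (σ : Fin n → RingAut R) (w : List (Fin n × ℤˣ)) : (Fin n → R) →* R :=
  if h : degree w = 0 then (exists_monomial σ h).choose else 1

theorem monomial_isMonomial (σ : Fin n → RingAut R) (w : List (Fin n × ℤˣ)) :
    IsMonomial σ (monomial σ w) := by
  unfold monomial
  split_ifs with h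
  · exact (exists_monomial σ h).choose_spec.1
  · exact IsMonomial.one σ

theorem word_eq_monomial (σ : Fin n → RingAut R) (t : Fin n → R) {w : List (Fin n × ℤˣ)}
    (hw : degree w = 0) : word σ t w = Constr.coeff σ t (monomial σ w t) := by
  rw [monomial, dif_pos hw]
  exact (exists_monomial σ hw).choose_spec.2 t

/-! ### Spanning by words, and the grading -/

theorem Constr.induction {σ : Fin n → RingAut R} {t : Fin n → R} {p : Constr σ t → Prop}
    (coeff : ∀ r, p (Constr.coeff σ t r)) (X : ∀ i ε, p (Constr.X σ t i ε))
    (add : ∀ a b, p a → p b → p (a + b)) (mul : ∀ a b, p a → p b → p (a * b)) (a : Constr σ t) :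
    p a := by
  obtain ⟨a, rfl⟩ := RingQuot.mkRingHom_surjective _ a
  change p (Constr.mk σ t a)
  induction a using FreeAlgebra.induction with
  | grade0 k =>
    have h : (Constr.mk σ t).comp (algebraMap ℤ (FreeAlgebra ℤ (Gen R n))) =
        (Constr.coeff σ t).comp (Int.castRingHom R) := RingHom.ext_int _ _
    have h' := RingHom.congr_fun h k
    rw [RingHom.comp_apply] at h'
    rw [h']
    exact coeff _
  | grade1 y =>
    cases y with
    | coeff r => exact coeff r
    | X i ε => exact X i ε
  | mul a b ha hb => rw [map_mul]; exact mul _ _ ha hb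
  | add a b ha hb => rw [map_add]; exact add _ _ ha hb

/-- The combination `∑ f_w w` of words. -/
noncomputable def combination (σ : Fin n → RingAut R) (t : Fin n → R) :
    (List (Fin n × ℤˣ) →₀ R) →+ Constr σ t :=
  Finsupp.liftAddHom fun w =>
    (AddMonoidHom.mulRight (word σ t w)).comp (Constr.coeff σ t).toAddMonoidHom

@[simp] theorem combination_single (σ : Fin n → RingAut R) (t : Fin n → R)
    (w : List (Fin n × ℤˣ)) (r : R) :
    combination σ t (Finsupp.single w r) = Constr.coeff σ t r * word σ t w := by
  simp [combination]

theorem combination_apply (σ : Fin n → RingAut R) (t : Fin n → R) (f : List (Fin n × ℤˣ) →₀ R) :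
    combination σ t f = ∑ w ∈ f.support, Constr.coeff σ t (f w) * word σ t w := rfl

/-- Every coefficient can be moved to the left of every word, so combinations of words are closed
under products. -/
theorem combination_surjective {σ : Fin n → RingAut R} (hσ : ∀ i j, Commute (σ i) (σ j))
    (t : Fin n → R) : Function.Surjective (combination σ t) := by
  intro a
  change a ∈ (combination σ t).range
  induction a using Constr.induction with
  | coeff r => exact ⟨Finsupp.single [] r, by simp⟩
  | X i ε => exact ⟨Finsupp.single [(i, ε)] 1, by simp⟩
  | add a b ha hb => exact add_mem ha hb
  | mul a b ha hb =>
    obtain ⟨f, rfl⟩ := ha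
    obtain ⟨g, rfl⟩ := hb
    rw [combination_apply, combination_apply, Finset.sum_mul_sum]
    refine sum_mem fun w _ => sum_mem fun w' _ => ?_
    refine ⟨Finsupp.single (w ++ w') (f w * shift σ (degree w) (g w')), ?_⟩
    rw [combination_single, word_append, map_mul, mul_assoc, mul_assoc, ← mul_assoc (word σ t w),
      word_mul_coeff hσ, ← mul_assoc (Constr.coeff _ _ _) (word σ t w)]

/-- The coaction on the generators. -/
noncomputable def coactionGen (σ : Fin n → RingAut R) (t : Fin n → R) :
    Gen R n → AddMonoidAlgebra (Constr σ t) (Fin n → ℤ)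
  | .coeff r => .single 0 (Constr.coeff σ t r)
  | .X i ε => .single (Pi.single i (ε : ℤ)) (Constr.X σ t i ε)

/-- The `ℤⁿ`-grading of `Ã(t)`, as a coaction. -/
noncomputable def coaction (σ : Fin n → RingAut R) (t : Fin n → R) :
    Constr σ t →+* AddMonoidAlgebra (Constr σ t) (Fin n → ℤ) :=
  RingQuot.lift ⟨(FreeAlgebra.lift ℤ (coactionGen σ t)).toRingHom, by
    intro a b h
    simp only [AlgHom.toRingHom_eq_coe, RingHom.coe_coe]
    induction h with
    | coeff_one => simp [coactionGen, AddMonoidAlgebra.one_def]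
    | coeff_add r s => simp [coactionGen, AddMonoidAlgebra.single_add]
    | coeff_mul r s => simp [coactionGen, AddMonoidAlgebra.single_mul_single]
    | X_coeff i ε r =>
      simp [coactionGen, AddMonoidAlgebra.single_mul_single, Constr.X_mul_coeff]
    | X_X i ε =>
      simp [coactionGen, AddMonoidAlgebra.single_mul_single, Constr.X_mul_X, Pi.single_neg]
    | X_comm i j hij ε =>
      simp [coactionGen, AddMonoidAlgebra.single_mul_single, Constr.X_comm σ t hij, add_comm]⟩

theorem coaction_coeff (σ : Fin n → RingAut R) (t : Fin n → R) (r : R) :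
    coaction σ t (Constr.coeff σ t r) = .single 0 (Constr.coeff σ t r) := by
  refine (RingQuot.lift_mkRingHom_apply _ _ _).trans ?_
  exact FreeAlgebra.lift_ι_apply _ _

theorem coaction_X (σ : Fin n → RingAut R) (t : Fin n → R) (i : Fin n) (ε : ℤˣ) :
    coaction σ t (Constr.X σ t i ε) = .single (Pi.single i (ε : ℤ)) (Constr.X σ t i ε) := by
  refine (RingQuot.lift_mkRingHom_apply _ _ _).trans ?_
  exact FreeAlgebra.lift_ι_apply _ _

theorem coaction_word (σ : Fin n → RingAut R) (t : Fin n → R) (w : List (Fin n × ℤˣ)) :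
    coaction σ t (word σ t w) = .single (degree w) (word σ t w) := by
  induction w with
  | nil => simp [AddMonoidAlgebra.one_def]
  | cons x w ih =>
    rw [word_cons, map_mul, ih, coaction_X, AddMonoidAlgebra.single_mul_single, degree_cons]

/-- The homogeneous components of a torsion element are torsion. -/
theorem isTorsion_component {σ : Fin n → RingAut R} {t : Fin n → R}
    (F : Finset (List (Fin n × ℤˣ))) (r : List (Fin n × ℤˣ) → R)
    (h : Constr.IsTorsion σ t (∑ w ∈ F, Constr.coeff σ t (r w) * word σ t w)) (g : Fin n → ℤ) :
    Constr.IsTorsion σ t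
      (∑ w ∈ F with degree w = g, Constr.coeff σ t (r w) * word σ t w) := by
  obtain ⟨s, hs, h⟩ := h
  refine ⟨s, hs, ?_⟩
  -- As `s` has degree zero, the coefficient at `g` of the coaction is `s` times the component of
  -- degree `g`.
  have h' := congrArg (fun a => (coaction σ t a).coeff g) h
  simp only [map_mul, map_sum, coaction_coeff, coaction_word, map_zero,
    AddMonoidAlgebra.single_mul_single, zero_add, Finset.mul_sum, AddMonoidAlgebra.coeff_sum,
    AddMonoidAlgebra.coeff_single, AddMonoidAlgebra.coeff_zero, Finsupp.coe_zero,
    Pi.zero_apply, Finsupp.finsetSum_apply, Finsupp.single_apply] at h'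
  rw [Finset.mul_sum, Finset.sum_filter]
  exact h'

variable {σ : Fin n → RingAut R}

theorem IsTorsion.mul_right {t : Fin n → R} {a : Constr σ t} (h : Constr.IsTorsion σ t a)
    (b : Constr σ t) : Constr.IsTorsion σ t (a * b) := by
  obtain ⟨r, hr, h⟩ := h
  exact ⟨r, hr, by rw [← mul_assoc, h, zero_mul]⟩

theorem Consistent.eq_zero {t : Fin n → R} (ht : Consistent σ t) {r : R}
    (h : Constr.IsTorsion σ t (Constr.coeff σ t r)) : r = 0 := by
  refine ht ?_
  rw [map_zero]
  exact (RingQuot.mkRingHom_rel (r := fun a b : Constr σ t => Constr.IsTorsion σ t a ∧ b = 0)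
    ⟨h, rfl⟩).trans (map_zero _)

/-- Right multiplication by `u` brings the torsion element into degree zero, where it is a
coefficient; by consistency a torsion coefficient vanishes. -/
theorem sum_monomial_eq_zero_of_isTorsion {t : Fin n → R} (ht : Consistent σ t) {g : Fin n → ℤ}
    (F : Finset (List (Fin n × ℤˣ))) (r : List (Fin n × ℤˣ) → R) (hF : ∀ w ∈ F, degree w = g)
    (h : Constr.IsTorsion σ t (∑ w ∈ F, Constr.coeff σ t (r w) * word σ t w))
    {u : List (Fin n × ℤˣ)} (hu : degree u = -g) : ∑ w ∈ F, r w * monomial σ (w ++ u) t = 0 := by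
  refine ht.eq_zero ?_
  convert IsTorsion.mul_right h (word σ t u) using 1
  rw [Finset.sum_mul, map_sum]
  refine Finset.sum_congr rfl fun w hw => ?_
  rw [mul_assoc, ← word_append, word_eq_monomial, map_mul]
  rw [degree_append, hF w hw, hu, add_neg_cancel]

/-- A criterion for an additive map to kill the torsion elements of `Ã(t)`. -/
theorem map_isTorsion_eq_zero (hσ : ∀ i j, Commute (σ i) (σ j)) {t : Fin n → R}
    (ht : Consistent σ t) {V : Type*} [AddCommGroup V] (H : Constr σ t →+ V)
    (hH : ∀ (g : Fin n → ℤ) (u : List (Fin n × ℤˣ)) (F : Finset (List (Fin n × ℤˣ)))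
      (r : List (Fin n × ℤˣ) → R), (∀ w ∈ F, degree w = g) → degree u = -g →
      ∑ w ∈ F, r w * monomial σ (w ++ u) t = 0 →
      ∑ w ∈ F, H (Constr.coeff σ t (r w) * word σ t w) = 0)
    (a : Constr σ t) (ha : Constr.IsTorsion σ t a) : H a = 0 := by
  obtain ⟨f, rfl⟩ := combination_surjective hσ t a
  rw [combination_apply] at ha ⊢
  -- Split into homogeneous components; each of them is torsion and can be treated separately.
  rw [← Finset.sum_fiberwise_of_maps_to (fun w hw => Finset.mem_image_of_mem degree hw), map_sum]
  refine Finset.sum_eq_zero fun g _ => ?_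
  obtain ⟨u, hu⟩ := exists_degree_eq (-g)
  have hF : ∀ w ∈ f.support.filter (fun w => degree w = g), degree w = g := fun w hw =>
    (Finset.mem_filter.1 hw).2
  rw [map_sum]
  exact hH g u _ f hF hu
    (sum_monomial_eq_zero_of_isTorsion ht _ _ hF (isTorsion_component _ _ ha g) hu)

end Words

/-! ### Torsion over an integral domain. -/

section Torsion

variable {R : Type u} [CommRing R] [IsDomain R] {n : ℕ} {σ : Fin n → RingAut R}

/-- In a domain the non-zero elements form a submonoid stable under automorphisms, so it contains
all monomials in non-zero `t_i`. -/
theorem monomial_ne_zero (w : List (Fin n × ℤˣ)) {t : Fin n → R} (ht : ∀ i, t i ≠ 0) :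
    monomial σ w t ≠ 0 := by
  refine nonZeroDivisors.ne_zero (monomial_isMonomial σ w (nonZeroDivisors R) ?_ t fun i => ?_)
  · intro j ε r hr
    exact mem_nonZeroDivisors_of_ne_zero (by simpa using nonZeroDivisors.ne_zero hr)
  · exact mem_nonZeroDivisors_of_ne_zero (by simpa using ht i)

/-- The hypothesis says that the element is killed by `u` on the right, hence by `uv` for `v` of
degree `g`. But `uv` is a non-zero coefficient, and moving it to the left of words of degree `g`
shifts it by `g`. Consistency plays no role in this direction. -/
theorem isTorsion_of_sum_monomial_eq_zero (hσ : ∀ i j, Commute (σ i) (σ j)) {t : Fin n → R}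
    (ht : ∀ i, t i ≠ 0) {g : Fin n → ℤ} (F : Finset (List (Fin n × ℤˣ)))
    (r : List (Fin n × ℤˣ) → R) (hF : ∀ w ∈ F, degree w = g) {u : List (Fin n × ℤˣ)}
    (hu : degree u = -g) (h : ∑ w ∈ F, r w * monomial σ (w ++ u) t = 0) :
    Constr.IsTorsion σ t (∑ w ∈ F, Constr.coeff σ t (r w) * word σ t w) := by
  obtain ⟨v, hv⟩ := exists_degree_eq g
  have h1 : (∑ w ∈ F, Constr.coeff σ t (r w) * word σ t w) * word σ t u = 0 := by
    rw [Finset.sum_mul, ← map_zero (Constr.coeff σ t), ← h, map_sum]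
    refine Finset.sum_congr rfl fun w hw => ?_
    rw [mul_assoc, ← word_append, word_eq_monomial, map_mul]
    rw [degree_append, hF w hw, hu, add_neg_cancel]
  have h2 : word σ t u * word σ t v = Constr.coeff σ t (monomial σ (u ++ v) t) := by
    rw [← word_append, word_eq_monomial]
    rw [degree_append, hu, hv, neg_add_cancel]
  refine ⟨shift σ g (monomial σ (u ++ v) t), by simpa using monomial_ne_zero _ ht, ?_⟩
  have h3 : (∑ w ∈ F, Constr.coeff σ t (r w) * word σ t w) *
      Constr.coeff σ t (monomial σ (u ++ v) t) = 0 := by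
    rw [← h2, ← mul_assoc, h1, zero_mul]
  rw [← h3, Finset.mul_sum, Finset.sum_mul]
  refine Finset.sum_congr rfl fun w hw => ?_
  rw [mul_assoc, word_mul_coeff hσ, hF w hw, ← mul_assoc, ← mul_assoc, ← map_mul, ← map_mul,
    mul_comm]

theorem IsTorsion.add {t : Fin n → R} {a b : Constr σ t} (ha : Constr.IsTorsion σ t a)
    (hb : Constr.IsTorsion σ t b) : Constr.IsTorsion σ t (a + b) := by
  obtain ⟨r, hr, ha⟩ := ha
  obtain ⟨s, hs, hb⟩ := hb
  refine ⟨r * s, mul_ne_zero hr hs, ?_⟩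
  rw [mul_add, map_mul, mul_assoc _ _ b, hb, mul_zero, add_zero, ← map_mul, mul_comm, map_mul,
    mul_assoc, ha, mul_zero]

theorem IsTorsion.mul_left {t : Fin n → R} {a : Constr σ t}
    (h : Constr.IsTorsion σ t a) (b : Constr σ t) : Constr.IsTorsion σ t (b * a) := by
  induction b using Constr.induction generalizing a with
  | coeff s =>
    obtain ⟨r, hr, h⟩ := h
    exact ⟨r, hr, by rw [← mul_assoc, ← map_mul, mul_comm r, map_mul, mul_assoc, h, mul_zero]⟩
  | X i ε =>
    obtain ⟨r, hr, h⟩ := h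
    refine ⟨(σ i ^ (2 * (ε : ℤ))) r, by simpa using hr, ?_⟩
    rw [← mul_assoc, ← Constr.X_mul_coeff, mul_assoc, h, mul_zero]
  | add b c hb hc => rw [add_mul]; exact IsTorsion.add (hb h) (hc h)
  | mul b c hb hc => rw [mul_assoc]; exact hb (hc h)

/-- The kernel of `Ã(t) → A(t)` consists of the torsion elements. -/
theorem isTorsion_of_mk_eq_zero {t : Fin n → R} {a : Constr σ t} (h : Alg.mk σ t a = 0) :
    Constr.IsTorsion σ t a := by
  -- The torsion elements form a two-sided ideal, and `A(t)` maps to the quotient by it; so no other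
  -- element dies in `A(t)`.
  let I : TwoSidedIdeal (Constr σ t) := .mk' {a | Constr.IsTorsion σ t a}
    ⟨1, one_ne_zero, mul_zero _⟩ IsTorsion.add
    (fun ⟨r, hr, h⟩ => ⟨r, hr, by rw [mul_neg, h, neg_zero]⟩)
    (fun h => IsTorsion.mul_left h _) (fun h => IsTorsion.mul_right h _)
  have hI : ∀ a, a ∈ I ↔ Constr.IsTorsion σ t a := fun a => TwoSidedIdeal.mem_mk' ..
  let f : Alg σ t →+* I.ringCon.Quotient := RingQuot.lift ⟨I.ringCon.mk', by
    rintro a b ⟨ha, rfl⟩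
    exact (RingCon.eq _).2 ((hI a).2 ha)⟩
  have hf : f (Alg.mk σ t a) = I.ringCon.mk' a := RingQuot.lift_mkRingHom_apply _ _ _
  rw [h, map_zero] at hf
  exact (hI a).1 ((RingCon.eq _).1 hf.symm)

end Torsion

end TGWA

/-! ### Weight modules supported on an orbit. -/

namespace TGWA

section Weights

variable {R : Type u} [CommRing R] {n : ℕ}

/-! ### The action of `ℤⁿ` on the maximal ideals -/

/-- The maximal ideal `σ_1^{g_1} ⋯ σ_n^{g_n}(m)`. -/
def translate (σ : Fin n → RingAut R) (g : Fin n → ℤ) (m : MaximalSpectrum R) :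
    MaximalSpectrum R :=
  ⟨m.asIdeal.map (shift σ g), have := m.isMaximal; Ideal.map_isMaximal_of_equiv (shift σ g)⟩

theorem mem_translate {σ : Fin n → RingAut R} {g : Fin n → ℤ} {m : MaximalSpectrum R} {r : R} :
    r ∈ (translate σ g m).asIdeal ↔ ∃ x ∈ m.asIdeal, shift σ g x = r :=
  Ideal.mem_map_of_equiv (shift σ g) r

theorem shift_mem_translate {σ : Fin n → RingAut R} {g : Fin n → ℤ} {m : MaximalSpectrum R}
    {r : R} : shift σ g r ∈ (translate σ g m).asIdeal ↔ r ∈ m.asIdeal := by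
  rw [mem_translate]
  exact ⟨fun ⟨x, hx, h⟩ => (shift σ g).injective h ▸ hx, fun h => ⟨r, h, rfl⟩⟩

theorem translate_zero (σ : Fin n → RingAut R) (m : MaximalSpectrum R) :
    translate σ 0 m = m := by
  refine MaximalSpectrum.ext (Ideal.ext fun r => ?_)
  rw [mem_translate, shift_zero]
  exact ⟨fun ⟨x, hx, h⟩ => h ▸ hx, fun h => ⟨r, h, rfl⟩⟩

theorem translate_add {σ : Fin n → RingAut R} (hσ : ∀ i j, Commute (σ i) (σ j))
    (g h : Fin n → ℤ) (m : MaximalSpectrum R) :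
    translate σ (g + h) m = translate σ g (translate σ h m) := by
  refine MaximalSpectrum.ext (Ideal.ext fun r => ?_)
  rw [mem_translate, mem_translate, shift_add hσ]
  constructor
  · rintro ⟨x, hx, rfl⟩
    exact ⟨shift σ h x, shift_mem_translate.2 hx, rfl⟩
  · rintro ⟨_, hy, rfl⟩
    obtain ⟨x, hx, rfl⟩ := mem_translate.1 hy
    exact ⟨x, hx, rfl⟩

variable {σ : Fin n → RingAut R} {O : Set (MaximalSpectrum R)}

theorem IsOrbit.translate_mem (hσ : ∀ i j, Commute (σ i) (σ j)) (hO : IsOrbit σ O)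
    {m : MaximalSpectrum R} (hm : m ∈ O) (g : Fin n → ℤ) : translate σ g m ∈ O := by
  obtain ⟨m₀, rfl⟩ := hO
  obtain ⟨h, hm⟩ := hm
  obtain rfl : m = translate σ h m₀ := MaximalSpectrum.ext hm
  refine ⟨g + h, ?_⟩
  rw [← translate_add hσ]
  rfl

theorem IsOrbit.exists_translate (hσ : ∀ i j, Commute (σ i) (σ j)) (hO : IsOrbit σ O)
    {m m' : MaximalSpectrum R} (hm : m ∈ O) (hm' : m' ∈ O) : ∃ g, translate σ g m = m' := by
  obtain ⟨m₀, rfl⟩ := hO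
  obtain ⟨h, hm⟩ := hm
  obtain rfl : m = translate σ h m₀ := MaximalSpectrum.ext hm
  obtain ⟨h', hm'⟩ := hm'
  obtain rfl : m' = translate σ h' m₀ := MaximalSpectrum.ext hm'
  exact ⟨h' - h, by rw [← translate_add hσ, sub_add_cancel]⟩

theorem IsOrbit.nonempty (hO : IsOrbit σ O) : O.Nonempty := by
  obtain ⟨m₀, rfl⟩ := hO
  exact ⟨m₀, 0, congrArg MaximalSpectrum.asIdeal (translate_zero σ m₀).symm⟩

/-- This is how trivial stabilizers enter: a weight in the orbit of `m` determines the degree by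
which it differs from `m`. -/
theorem IsTorsionFreeOrbit.translate_injective (hσ : ∀ i j, Commute (σ i) (σ j))
    (hO : IsTorsionFreeOrbit σ O) {m : MaximalSpectrum R} (hm : m ∈ O) {g h : Fin n → ℤ}
    (e : translate σ g m = translate σ h m) : g = h := by
  have e' : translate σ (-h + g) m = m := by
    rw [translate_add hσ, e, ← translate_add hσ, neg_add_cancel, translate_zero]
  have := hO.2 m hm _ (congrArg MaximalSpectrum.asIdeal e')
  rwa [neg_add_eq_zero, eq_comm] at this

/-- The elements outside all ideals of `O` form a submonoid because these ideals are prime, and it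
is stable under shifts because `O` is an orbit. By hypothesis it contains the `σ_i^{1/2}(γ_i)`,
hence all monomials in them. -/
theorem monomial_notMem (hσ : ∀ i j, Commute (σ i) (σ j)) (hO : IsOrbit σ O) {γ : Fin n → R}
    (hγ : γ ∈ OmegaUnits σ O) (w : List (Fin n × ℤˣ)) {m : MaximalSpectrum R} (hm : m ∈ O) :
    monomial σ w γ ∉ m.asIdeal := by
  let S : Submonoid R :=
    { carrier := {r | ∀ m ∈ O, r ∉ m.asIdeal}
      one_mem' := fun m _ => (Ideal.ne_top_iff_one _).1 m.isMaximal.ne_top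
      mul_mem' := fun ha hb m hm h =>
        (m.isMaximal.isPrime.mem_or_mem h).elim (ha m hm) (hb m hm) }
  refine monomial_isMonomial σ w S ?_ γ (fun i m hm => hγ.2 i m hm) m hm
  intro j ε r hr m hm h
  refine hr _ (hO.translate_mem hσ hm (-Pi.single j (ε : ℤ))) ?_
  rw [← shift_mem_translate (σ := σ) (g := Pi.single j (ε : ℤ)), ← translate_add hσ,
    add_neg_cancel, translate_zero, shift_single]
  exact h

/-! ### Weight spaces -/

theorem exists_mul_sub_one_mem {m : MaximalSpectrum R} {r : R} (hr : r ∉ m.asIdeal) :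
    ∃ d, r * d - 1 ∈ m.asIdeal := by
  have := m.isMaximal
  obtain ⟨d, a, ha, h⟩ := m.isMaximal.exists_inv hr
  exact ⟨d, by
    have e : r * d - 1 = -a := by linear_combination h
    rw [e]; exact neg_mem ha⟩

section Module

variable {M N : Type u} [AddCommGroup M] [Module R M] [AddCommGroup N] [Module R N]

theorem mem_weightSpace {m : MaximalSpectrum R} {v : M} :
    v ∈ weightSpace M m ↔ ∀ a ∈ m.asIdeal, a • v = 0 := by
  rw [weightSpace, Submodule.mem_torsionBySet_iff]
  exact ⟨fun h a ha => h ⟨a, ha⟩, fun h a => h a a.2⟩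

theorem smul_eq_of_sub_mem {m : MaximalSpectrum R} {v : M} (hv : v ∈ weightSpace M m) {r s : R}
    (h : r - s ∈ m.asIdeal) : r • v = s • v := by
  rw [← sub_eq_zero, ← sub_smul]
  exact mem_weightSpace.1 hv _ h

theorem eq_zero_of_smul_eq_zero {m : MaximalSpectrum R} {v : M} (hv : v ∈ weightSpace M m) {r : R}
    (hr : r ∉ m.asIdeal) (h : r • v = 0) : v = 0 := by
  obtain ⟨d, hd⟩ := exists_mul_sub_one_mem hr
  rw [← one_smul R v, ← smul_eq_of_sub_mem hv hd, mul_comm, mul_smul, h, smul_zero]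

theorem sub_mem_of_smul_eq {m : MaximalSpectrum R} {v : M} (hv : v ∈ weightSpace M m)
    (hv0 : v ≠ 0) {r s : R} (h : r • v = s • v) : r - s ∈ m.asIdeal := by
  by_contra hr
  exact hv0 (eq_zero_of_smul_eq_zero hv hr (by rw [sub_smul, h, sub_self]))

theorem map_mem_weightSpace (f : M →ₗ[R] N) {m : MaximalSpectrum R} {v : M}
    (hv : v ∈ weightSpace M m) : f v ∈ weightSpace N m :=
  mem_weightSpace.2 fun a ha => by rw [← map_smul, mem_weightSpace.1 hv a ha, map_zero]

theorem ext_weightSpace (h : ⨆ m : MaximalSpectrum R, weightSpace (R := R) M m = ⊤) {A : Type*}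
    [AddCommGroup A] {f g : M →+ A} (hfg : ∀ m, ∀ v ∈ weightSpace (R := R) M m, f v = g v) : f = g := by
  ext v
  have hv : v ∈ ⨆ m : MaximalSpectrum R, weightSpace (R := R) M m := by rw [h]; trivial
  induction hv using Submodule.iSup_induction' with
  | zero => rw [map_zero, map_zero]
  | add x y _ _ hx hy => rw [map_add, map_add, hx, hy]
  | mem m v hv => exact hfg m v hv

theorem ext_weightSpace_linear (h : ⨆ m : MaximalSpectrum R, weightSpace (R := R) M m = ⊤)
    {f g : M →ₗ[R] N} (hfg : ∀ m, ∀ v ∈ weightSpace (R := R) M m, f v = g v) : f = g :=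
  LinearMap.toAddMonoidHom_injective (ext_weightSpace h hfg)

open scoped Classical in
/-- A linear map can be prescribed on the weight spaces. -/
theorem exists_linearMap_weightSpace (h : ⨆ m : MaximalSpectrum R, weightSpace M m = ⊤)
    (f : ∀ m : MaximalSpectrum R, weightSpace M m →ₗ[R] N) :
    ∃ F : M →ₗ[R] N, ∀ m (v : weightSpace M m), F v = f m v := by
  have hi : DirectSum.IsInternal (fun m : MaximalSpectrum R => weightSpace M m) :=
    (DirectSum.isInternal_submodule_iff_iSupIndep_and_iSup_eq_top _).2
      ⟨iSupIndep_weightSpace _, h⟩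
  let e := LinearEquiv.ofBijective
    (DirectSum.coeLinearMap fun m : MaximalSpectrum R => weightSpace M m) hi
  refine ⟨(DirectSum.toModule R _ N f).comp e.symm.toLinearMap, fun m v => ?_⟩
  have he : e (DirectSum.lof R _ (fun m : MaximalSpectrum R => weightSpace M m) m v) = v :=
    DirectSum.coeLinearMap_lof _ _ _
  rw [LinearMap.comp_apply, LinearEquiv.coe_coe, ← he, LinearEquiv.symm_apply_apply,
    DirectSum.toModule_lof]

/-- The operator acting by the scalar `a m` on the weight space `M_m`. -/
noncomputable def scaleWeights (h : ⨆ m : MaximalSpectrum R, weightSpace M m = ⊤)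
    (a : MaximalSpectrum R → R) : M →ₗ[R] M :=
  (exists_linearMap_weightSpace h fun m => a m • (weightSpace M m).subtype).choose

theorem scaleWeights_apply (h : ⨆ m : MaximalSpectrum R, weightSpace M m = ⊤)
    (a : MaximalSpectrum R → R) {m : MaximalSpectrum R} {v : M} (hv : v ∈ weightSpace M m) :
    scaleWeights h a v = a m • v :=
  (exists_linearMap_weightSpace h fun m => a m • (weightSpace M m).subtype).choose_spec m ⟨v, hv⟩

theorem map_scaleWeights (h : ⨆ m : MaximalSpectrum R, weightSpace M m = ⊤)
    (h' : ⨆ m : MaximalSpectrum R, weightSpace N m = ⊤) (a : MaximalSpectrum R → R)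
    (f : M →ₗ[R] N) (v : M) : f (scaleWeights h a v) = scaleWeights h' a (f v) := by
  refine LinearMap.congr_fun (f := f.comp (scaleWeights h a)) (g := (scaleWeights h' a).comp f)
    (ext_weightSpace_linear h fun m v hv => ?_) v
  rw [LinearMap.comp_apply, LinearMap.comp_apply, scaleWeights_apply h a hv,
    scaleWeights_apply h' a (map_mem_weightSpace f hv), map_smul]

/-! ### Semilinear operators and their words -/

/-- The operators `T_i^±` satisfy `T_i^± r = σ_i^{±1}(r) T_i^±`. -/
def IsSkew (σ : Fin n → RingAut R) (T : Fin n → ℤˣ → AddMonoid.End M) : Prop :=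
  ∀ i ε (r : R) v, T i ε (r • v) = (σ i ^ (2 * (ε : ℤ))) r • T i ε v

/-- The product of the operators `T_i^±` along a word. -/
def opWord (T : Fin n → ℤˣ → AddMonoid.End M) (w : List (Fin n × ℤˣ)) : AddMonoid.End M :=
  (w.map fun x => T x.1 x.2).prod

@[simp] theorem opWord_nil (T : Fin n → ℤˣ → AddMonoid.End M) (v : M) : opWord T [] v = v := rfl

@[simp] theorem opWord_cons (T : Fin n → ℤˣ → AddMonoid.End M) (x : Fin n × ℤˣ)
    (w : List (Fin n × ℤˣ)) (v : M) : opWord T (x :: w) v = T x.1 x.2 (opWord T w v) := by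
  simp [opWord, end_mul_apply]

theorem opWord_append (T : Fin n → ℤˣ → AddMonoid.End M) (w w' : List (Fin n × ℤˣ)) (v : M) :
    opWord T (w ++ w') v = opWord T w (opWord T w' v) := by
  simp [opWord, end_mul_apply]

theorem IsSkew.opWord_smul (hσ : ∀ i j, Commute (σ i) (σ j)) {T : Fin n → ℤˣ → AddMonoid.End M}
    (hT : IsSkew σ T) (w : List (Fin n × ℤˣ)) (r : R) (v : M) :
    opWord T w (r • v) = shift σ (degree w) r • opWord T w v := by
  induction w with
  | nil => simp [shift_zero]
  | cons x w ih =>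
    rw [opWord_cons, ih, hT, opWord_cons, degree_cons, shift_add hσ, shift_single]
    rfl

theorem IsSkew.opWord_mem (hσ : ∀ i j, Commute (σ i) (σ j)) {T : Fin n → ℤˣ → AddMonoid.End M}
    (hT : IsSkew σ T) (w : List (Fin n × ℤˣ)) {m : MaximalSpectrum R} {v : M}
    (hv : v ∈ weightSpace M m) : opWord T w v ∈ weightSpace M (translate σ (degree w) m) := by
  refine mem_weightSpace.2 fun a ha => ?_
  obtain ⟨x, hx, rfl⟩ := mem_translate.1 ha
  rw [← hT.opWord_smul hσ, mem_weightSpace.1 hv x hx, map_zero]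

theorem IsSkew.op_mem (hσ : ∀ i j, Commute (σ i) (σ j)) {T : Fin n → ℤˣ → AddMonoid.End M}
    (hT : IsSkew σ T) (i : Fin n) (ε : ℤˣ) {m : MaximalSpectrum R} {v : M}
    (hv : v ∈ weightSpace M m) :
    T i ε v ∈ weightSpace M (translate σ (Pi.single i (ε : ℤ)) m) := by
  simpa using hT.opWord_mem hσ [(i, ε)] hv

end Module

/-! ### The action of `Ã(t)` on weight modules -/

variable {t : Fin n → R}

theorem map_word_apply {M : Type*} [AddCommGroup M] (H : Constr σ t →+* AddMonoid.End M)
    (w : List (Fin n × ℤˣ)) : H (word σ t w) = opWord (fun i ε => H (Constr.X σ t i ε)) w := by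
  rw [word, opWord, map_list_prod, List.map_map]
  rfl

theorem end_sum_apply {ι M : Type*} [AddCommGroup M] (F : Finset ι) (f : ι → AddMonoid.End M)
    (v : M) : (∑ i ∈ F, f i) v = ∑ i ∈ F, f i v :=
  AddMonoidHom.finsetSum_apply _ _ v

/-- The action of `Ã(t)` on an object of `A(t)-wmod_O`. -/
def WMod.hom (M : WMod σ O t) : Constr σ t →+* AddMonoid.End M :=
  (Module.toAddMonoidEnd (Alg σ t) M).comp (Alg.mk σ t)

theorem WMod.hom_coeff (M : WMod σ O t) (r : R) (v : M) :
    M.hom (Constr.coeff σ t r) v = r • v := M.coeff_smul r v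

/-- The operators `X_i^±` on an object of `A(t)-wmod_O`. -/
def WMod.op (M : WMod σ O t) (i : Fin n) (ε : ℤˣ) : AddMonoid.End M :=
  M.hom (Constr.X σ t i ε)

theorem WMod.isSkew (M : WMod σ O t) : IsSkew σ M.op := by
  intro i ε r v
  rw [← M.hom_coeff r v, ← M.hom_coeff, WMod.op, ← end_mul_apply, ← end_mul_apply, ← map_mul,
    ← map_mul, Constr.X_mul_coeff]

theorem WMod.hom_word (M : WMod σ O t) (w : List (Fin n × ℤˣ)) (v : M) :
    M.hom (word σ t w) v = opWord M.op w v := by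
  rw [map_word_apply]; rfl

theorem WMod.opWord_eq_smul (M : WMod σ O t) {w : List (Fin n × ℤˣ)} (hw : degree w = 0) (v : M) :
    opWord M.op w v = monomial σ w t • v := by
  rw [← M.hom_word, word_eq_monomial σ t hw, M.hom_coeff]

theorem WMod.opWord_opWord (M : WMod σ O t) {u w : List (Fin n × ℤˣ)}
    (h : degree u = -degree w) (v : M) :
    opWord M.op u (opWord M.op w v) = monomial σ (u ++ w) t • v := by
  rw [← opWord_append, M.opWord_eq_smul (by rw [degree_append, h, neg_add_cancel])]

/-- An additive map that is linear over `R` and commutes with the `X_i^±` is linear over `A(t)`. -/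
def linearMapOfOp (M N : WMod σ O t) (f : M →ₗ[R] N)
    (hf : ∀ i ε v, f (M.op i ε v) = N.op i ε (f v)) : M →ₗ[Alg σ t] N where
  toFun := f
  map_add' := map_add f
  map_smul' a v := by
    obtain ⟨a, rfl⟩ := RingQuot.mkRingHom_surjective _ a
    change f (M.hom a v) = N.hom a (f v)
    induction a using Constr.induction generalizing v with
    | coeff r => rw [M.hom_coeff, N.hom_coeff, map_smul]
    | X i ε => exact hf i ε v
    | add a b ha hb =>
      rw [map_add, map_add]
      exact (map_add f _ _).trans (congrArg₂ (· + ·) (ha v) (hb v))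
    | mul a b ha hb => rw [map_mul, map_mul, end_mul_apply, end_mul_apply, ha, hb]

theorem linearMap_op {M N : WMod σ O t} (f : M →ₗ[Alg σ t] N) (i : Fin n) (ε : ℤˣ) (v : M) :
    f (M.op i ε v) = N.op i ε (f v) := map_smul f _ _

/-- An equivalence over `R` that commutes with the `X_i^±` is an equivalence over `A(t)`. -/
def linearEquivOfOp (M N : WMod σ O t) (f : M ≃ₗ[R] N)
    (hf : ∀ i ε v, f (M.op i ε v) = N.op i ε (f v)) : M ≃ₗ[Alg σ t] N :=
  { linearMapOfOp M N f.toLinearMap hf with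
    invFun := f.symm
    left_inv := f.symm_apply_apply
    right_inv := f.apply_symm_apply }

theorem WMod.eq_zero_of_mem (M : WMod σ O t) {m : MaximalSpectrum R} (hm : m ∉ O) {v : M}
    (hv : v ∈ weightSpace (M : Type u) m) : v = 0 := by
  rwa [M.support m hm, Submodule.mem_bot] at hv

/-- Two additive maps agree if they agree on the weight spaces of the points of `O`. -/
theorem WMod.hom_ext (M : WMod σ O t) {A : Type*} [AddCommGroup A] {f g : M →+ A}
    (h : ∀ m ∈ O, ∀ v ∈ weightSpace (M : Type u) m, f v = g v) : f = g := by
  refine ext_weightSpace M.iSup_weightSpace fun m v hv => ?_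
  by_cases hm : m ∈ O
  · exact h m hm v hv
  · rw [M.eq_zero_of_mem hm hv, map_zero, map_zero]

/-- The torsion criterion in the form used on modules: an identity between monomials in `R` makes
the combination torsion in `Ã(t)`, so that it vanishes in `A(t)` and acts by zero. -/
theorem WMod.sum_smul_opWord_eq_zero [IsDomain R] (hσ : ∀ i j, Commute (σ i) (σ j))
    (ht : ∀ i, t i ≠ 0) (M : WMod σ O t) {g : Fin n → ℤ} (F : Finset (List (Fin n × ℤˣ)))
    (r : List (Fin n × ℤˣ) → R) (hF : ∀ w ∈ F, degree w = g) {u : List (Fin n × ℤˣ)}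
    (hu : degree u = -g) (h : ∑ w ∈ F, r w * monomial σ (w ++ u) t = 0) (v : M) :
    ∑ w ∈ F, r w • opWord M.op w v = 0 := by
  have h1 := isTorsion_of_sum_monomial_eq_zero hσ ht F r hF hu h
  have h2 : Alg.mk σ t (∑ w ∈ F, Constr.coeff σ t (r w) * word σ t w) = 0 :=
    (RingQuot.mkRingHom_rel (r := fun a b : Constr σ t => Constr.IsTorsion σ t a ∧ b = 0)
      ⟨h1, rfl⟩).trans (map_zero _)
  have h3 : M.hom (∑ w ∈ F, Constr.coeff σ t (r w) * word σ t w) v = 0 := by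
    change Alg.mk σ t (∑ w ∈ F, Constr.coeff σ t (r w) * word σ t w) • v = 0
    rw [h2, zero_smul]
  rw [map_sum] at h3
  rw [← h3, end_sum_apply]
  refine Finset.sum_congr rfl fun w _ => ?_
  rw [map_mul, end_mul_apply, M.hom_coeff, M.hom_word]

/-! ### Modules over `A(γ)` for `γ ∈ Ω_O^×` -/

variable {γ : Fin n → R}

/-- A word `u` of opposite degree brings the vector back to `N_m`, where `uw` acts by `c_{uw}(γ)`, a
unit modulo `m`. -/
theorem WMod.opWord_ne_zero (hσ : ∀ i j, Commute (σ i) (σ j)) (hO : IsOrbit σ O)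
    (hγ : γ ∈ OmegaUnits σ O) (N : WMod σ O γ) {m : MaximalSpectrum R} (hm : m ∈ O) {v : N}
    (hv : v ∈ weightSpace (N : Type u) m) (hv0 : v ≠ 0) (w : List (Fin n × ℤˣ)) :
    opWord N.op w v ≠ 0 := by
  intro h
  obtain ⟨u, hu⟩ := exists_degree_eq (-degree w)
  have := N.opWord_opWord hu v
  rw [h, map_zero] at this
  exact hv0 (eq_zero_of_smul_eq_zero hv (monomial_notMem hσ hO hγ _ hm) this.symm)

theorem WMod.exists_opWord_eq (hσ : ∀ i j, Commute (σ i) (σ j)) (hO : IsOrbit σ O)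
    (hγ : γ ∈ OmegaUnits σ O) (N : WMod σ O γ) {m : MaximalSpectrum R} (hm : m ∈ O) {v : N}
    (hv : v ∈ weightSpace (N : Type u) m) (u : List (Fin n × ℤˣ)) {g : Fin n → ℤ}
    (hu : degree u = -g) :
    ∃ v' ∈ weightSpace (N : Type u) (translate σ g m), opWord N.op u v' = v := by
  obtain ⟨w, rfl⟩ := exists_degree_eq g
  obtain ⟨d, hd⟩ := exists_mul_sub_one_mem (monomial_notMem hσ hO hγ (u ++ w) hm)
  -- `d` inverts `c_{uw}(γ)` modulo `m`, so `u` sends `w(dv)` to `v`.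
  refine ⟨opWord N.op w (d • v), N.isSkew.opWord_mem hσ w (Submodule.smul_mem _ _ hv), ?_⟩
  rw [N.opWord_opWord hu, smul_smul, smul_eq_of_sub_mem hv hd, one_smul]

/-- The vectors `e m` span the weight spaces `N_m`, `m ∈ O`, which are lines. -/
structure IsLineBasis (N : WMod σ O γ) (e : MaximalSpectrum R → N) : Prop where
  mem : ∀ m ∈ O, e m ∈ weightSpace (N : Type u) m
  ne_zero : ∀ m ∈ O, e m ≠ 0
  exists_smul : ∀ m ∈ O, ∀ v ∈ weightSpace (N : Type u) m, ∃ r : R, v = r • e m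

variable {N : WMod σ O γ} {e : MaximalSpectrum R → N}

theorem IsLineBasis.exists_eq_smul (he : IsLineBasis N e) {m : MaximalSpectrum R} (hm : m ∈ O)
    {v : N} (hv : v ∈ weightSpace (N : Type u) m) (hv0 : v ≠ 0) :
    ∃ r : R, r ∉ m.asIdeal ∧ v = r • e m := by
  obtain ⟨r, rfl⟩ := he.exists_smul m hm v hv
  exact ⟨r, fun hr => hv0 (mem_weightSpace.1 (he.mem m hm) r hr), rfl⟩

/-- A non-zero submodule contains a non-zero weight vector, and words carry it to a non-zero vector
of every other weight line over `O`. -/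
theorem IsLineBasis.isSimpleModule (hσ : ∀ i j, Commute (σ i) (σ j)) (hO : IsOrbit σ O)
    (hγ : γ ∈ OmegaUnits σ O) (he : IsLineBasis N e) : IsSimpleModule (Alg σ γ) N := by
  obtain ⟨m₀, hm₀⟩ := hO.nonempty
  have : Nontrivial (Submodule (Alg σ γ) N) :=
    (Submodule.nontrivial_iff _).2 ⟨e m₀, 0, he.ne_zero m₀ hm₀⟩
  refine isSimpleModule_iff _ _ |>.2 ⟨fun P => or_iff_not_imp_left.2 fun hP => ?_⟩
  have hR (r : R) {v : N} (hv : v ∈ P) : r • v ∈ P := by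
    rw [← N.coeff_smul]; exact P.smul_mem _ hv
  have hW (w : List (Fin n × ℤˣ)) {v : N} (hv : v ∈ P) : opWord N.op w v ∈ P := by
    rw [← N.hom_word]; exact P.smul_mem (Alg.mk σ γ (word σ γ w)) hv
  let P' : Submodule R N :=
    { P.toAddSubmonoid with smul_mem' := fun r v hv => hR r hv }
  have hline {m : MaximalSpectrum R} (hm : m ∈ O) {v : N} (hv : v ∈ weightSpace (N : Type u) m)
      (hv0 : v ≠ 0) (hvP : v ∈ P) : e m ∈ P := by
    obtain ⟨r, hr, rfl⟩ := he.exists_eq_smul hm hv hv0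
    obtain ⟨d, hd⟩ := exists_mul_sub_one_mem hr
    have := hR d hvP
    rwa [smul_smul, mul_comm, smul_eq_of_sub_mem (he.mem m hm) hd, one_smul] at this
  obtain ⟨m, hm, v, hv, hv0, hvP⟩ : ∃ m ∈ O, ∃ v ∈ weightSpace (N : Type u) m, v ≠ 0 ∧ v ∈ P := by
    -- Since `N` is semisimple over `R`, there is an `R`-linear retraction `q` onto `P`. It
    -- preserves weights, so without non-zero weight vectors in `P` it would be zero, although it is
    -- the identity on `P ≠ 0`.
    by_contra! hcon
    have := N.isSemisimple
    obtain ⟨q, hq⟩ := IsSemisimpleModule.extension_property P'.subtype P'.injective_subtype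
      LinearMap.id
    have hq0 : q.toAddMonoidHom = 0 := N.hom_ext fun m hm v hv => by
      by_contra h0
      exact hcon m hm (q v) (map_mem_weightSpace (P'.subtype.comp q) hv)
        (fun h => h0 (Subtype.ext h)) (q v).2
    obtain ⟨v, hv, hv0⟩ := P.exists_mem_ne_zero_of_ne_bot hP
    have h1 : q v = ⟨v, hv⟩ := LinearMap.congr_fun hq ⟨v, hv⟩
    have h2 : q v = 0 := DFunLike.congr_fun hq0 v
    exact hv0 (congrArg Subtype.val (h1.symm.trans h2))
  have hall : ∀ m' ∈ O, e m' ∈ P := by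
    intro m' hm'
    obtain ⟨g, rfl⟩ := hO.exists_translate hσ hm hm'
    obtain ⟨w, rfl⟩ := exists_degree_eq g
    exact hline hm' (N.isSkew.opWord_mem hσ w hv) (N.opWord_ne_zero hσ hO hγ hm hv hv0 w)
      (hW w hvP)
  rw [eq_top_iff]
  have hP' : P' = ⊤ := by
    rw [eq_top_iff, ← N.iSup_weightSpace, iSup_le_iff]
    intro m' v hv
    by_cases hm' : m' ∈ O
    · obtain ⟨r, rfl⟩ := he.exists_smul m' hm' v hv
      exact hR r (hall m' hm')
    · rw [N.eq_zero_of_mem hm' hv]; exact P'.zero_mem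
  intro v _
  have : v ∈ P' := by rw [hP']; trivial
  exact this

end Weights

end TGWA

/-! ### The induced module and the unique simple object. -/

namespace TGWA

section Induced

variable {R : Type u} [CommRing R] {n : ℕ}

/-! ### The simple object of `A(γ)-wmod_O` -/

theorem Alg.coeff_eq (σ : Fin n → RingAut R) (t : Fin n → R) (r : R) :
    Alg.coeff σ t r = Alg.mk σ t (Constr.coeff σ t r) := rfl

theorem Alg.mk_surjective (σ : Fin n → RingAut R) (t : Fin n → R) :
    Function.Surjective (Alg.mk σ t) := RingQuot.mkRingHom_surjective _

/-- The left ideal `A(t) m`. -/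
def leftIdeal (σ : Fin n → RingAut R) (t : Fin n → R) (m : MaximalSpectrum R) :
    Submodule (Alg σ t) (Alg σ t) :=
  Submodule.span (Alg σ t) (Alg.coeff σ t '' (m.asIdeal : Set R))

/-- The induced module `A(t) / A(t) m`. -/
def Induced (σ : Fin n → RingAut R) (t : Fin n → R) (m : MaximalSpectrum R) : Type u :=
  Alg σ t ⧸ leftIdeal σ t m

noncomputable instance (σ : Fin n → RingAut R) (t : Fin n → R) (m : MaximalSpectrum R) :
    AddCommGroup (Induced σ t m) := inferInstanceAs (AddCommGroup (Alg σ t ⧸ leftIdeal σ t m))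

noncomputable instance (σ : Fin n → RingAut R) (t : Fin n → R) (m : MaximalSpectrum R) :
    Module (Alg σ t) (Induced σ t m) :=
  inferInstanceAs (Module (Alg σ t) (Alg σ t ⧸ leftIdeal σ t m))

noncomputable instance (σ : Fin n → RingAut R) (t : Fin n → R) (m : MaximalSpectrum R) :
    Module R (Induced σ t m) := Module.compHom _ (Alg.coeff σ t)

/-- The generator of the induced module. -/
noncomputable def Induced.one (σ : Fin n → RingAut R) (t : Fin n → R) (m : MaximalSpectrum R) :
    Induced σ t m := (leftIdeal σ t m).mkQ 1

variable {σ : Fin n → RingAut R} {O : Set (MaximalSpectrum R)} {t : Fin n → R}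
  {m : MaximalSpectrum R}

theorem Induced.coeff_smul (r : R) (v : Induced σ t m) : Alg.coeff σ t r • v = r • v := rfl

theorem Induced.smul_one (a : Alg σ t) : a • one σ t m = (leftIdeal σ t m).mkQ a := by
  refine (map_smul (leftIdeal σ t m).mkQ a 1).symm.trans ?_
  rw [smul_eq_mul, mul_one]

theorem Induced.exists_smul_one (v : Induced σ t m) : ∃ a : Alg σ t, a • one σ t m = v := by
  obtain ⟨a, rfl⟩ := (leftIdeal σ t m).mkQ_surjective v
  exact ⟨a, smul_one a⟩

theorem Induced.smul_one_eq_zero {a : Alg σ t} : a • one σ t m = 0 ↔ a ∈ leftIdeal σ t m := by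
  rw [smul_one]
  exact Submodule.Quotient.mk_eq_zero _

theorem Induced.one_mem : one σ t m ∈ weightSpace (Induced σ t m) m :=
  mem_weightSpace.2 fun a ha =>
    (smul_one_eq_zero (a := Alg.coeff σ t a)).2 (Submodule.subset_span ⟨a, ha, rfl⟩)

/-- Moving an element of `m` to the left of a word `w` places it in the translate of `m` by the
degree of `w`. Combinations with such coefficients are stable under left multiplication. -/
theorem exists_combination_of_mem_leftIdeal (hσ : ∀ i j, Commute (σ i) (σ j)) {a : Alg σ t}
    (ha : a ∈ leftIdeal σ t m) : ∃ f : List (Fin n × ℤˣ) →₀ R,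
      (∀ w, f w ∈ (translate σ (degree w) m).asIdeal) ∧
        Alg.mk σ t (combination σ t f) = a := by
  let K : AddSubgroup (List (Fin n × ℤˣ) →₀ R) :=
    { carrier := {f | ∀ w, f w ∈ (translate σ (degree w) m).asIdeal}
      zero_mem' := fun w => zero_mem _
      add_mem' := fun hf hg w => add_mem (hf w) (hg w)
      neg_mem' := fun hf w => neg_mem (hf w) }
  let D : AddSubgroup (Alg σ t) := K.map ((Alg.mk σ t).toAddMonoidHom.comp (combination σ t))
  have hD {w : List (Fin n × ℤˣ)} {r : R} (hr : r ∈ (translate σ (degree w) m).asIdeal) :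
      Alg.mk σ t (Constr.coeff σ t r * word σ t w) ∈ D := by
    classical
    refine ⟨Finsupp.single w r, fun w' => ?_, ?_⟩
    · rw [Finsupp.single_apply]
      split_ifs with h
      · exact h ▸ hr
      · exact zero_mem _
    · exact congrArg _ (combination_single σ t w r)
  change a ∈ D
  induction ha using Submodule.span_induction with
  | mem _ h =>
    obtain ⟨r, hr, rfl⟩ := h
    have h := hD (w := []) (r := r) (by rwa [degree_nil, translate_zero])
    rwa [word_nil, mul_one] at h
  | zero => exact zero_mem _
  | add a b _ _ ha hb => exact add_mem ha hb
  | smul b a _ ha =>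
    obtain ⟨f, hf, rfl⟩ := ha
    obtain ⟨b, rfl⟩ := Alg.mk_surjective σ t b
    obtain ⟨h, rfl⟩ := combination_surjective hσ t b
    change Alg.mk σ t _ * Alg.mk σ t (combination σ t f) ∈ D
    rw [← map_mul, combination_apply, combination_apply, Finset.sum_mul_sum, map_sum]
    refine sum_mem fun w _ => ?_
    rw [map_sum]
    refine sum_mem fun w' _ => ?_
    have e : Constr.coeff σ t (h w) * word σ t w * (Constr.coeff σ t (f w') * word σ t w') =
        Constr.coeff σ t (h w * shift σ (degree w) (f w')) * word σ t (w ++ w') := by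
      rw [word_append, map_mul, mul_assoc, mul_assoc, ← mul_assoc (word σ t w),
        word_mul_coeff hσ, mul_assoc]
    rw [e]
    refine hD (Ideal.mul_mem_left _ _ ?_)
    rw [degree_append, translate_add hσ, shift_mem_translate]
    exact hf w'

/-- If `1 ∈ A(γ)m`, then `1` agrees up to torsion with a combination whose coefficients in degree
zero lie in `m`. By consistency the degree zero part becomes an identity in `R` that puts `c_∅(γ)`,
for the empty word `∅`, into `m`, contrary to `monomial_notMem`. -/
theorem Induced.one_ne_zero [IsDomain R] (hσ : ∀ i j, Commute (σ i) (σ j)) (hO : IsOrbit σ O)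
    {γ : Fin n → R} (hγ : γ ∈ OmegaUnits σ O) (hm : m ∈ O) : one σ γ m ≠ 0 := by
  intro h0
  rw [← one_smul (Alg σ γ) (one σ γ m), smul_one_eq_zero] at h0
  obtain ⟨f, hf, h⟩ := exists_combination_of_mem_leftIdeal hσ h0
  have h1 : Constr.IsTorsion σ γ (combination σ γ (f - Finsupp.single [] 1)) := by
    refine isTorsion_of_mk_eq_zero ?_
    rw [map_sub, map_sub, h, combination_single, map_one, word_nil, mul_one, map_one, sub_self]
  classical
  set h' := f - Finsupp.single [] 1 with hh'
  -- The empty word is added to the index set so that its term can be split off even if its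
  -- coefficient is zero.
  have h2 : combination σ γ h' =
      ∑ w ∈ insert [] h'.support, Constr.coeff σ γ (h' w) * word σ γ w := by
    rw [combination_apply]
    refine Finset.sum_subset (Finset.subset_insert _ _) fun w _ hw => ?_
    rw [Finsupp.notMem_support_iff.1 hw, map_zero, zero_mul]
  rw [h2] at h1
  have h3 := sum_monomial_eq_zero_of_isTorsion hγ.1.2 _ _ (fun w hw => (Finset.mem_filter.1 hw).2)
    (isTorsion_component _ _ h1 0) (u := []) (by simp)
  have hmem : ([] : List (Fin n × ℤˣ)) ∈ (insert [] h'.support).filter (fun w => degree w = 0) := by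
    simp
  rw [← Finset.add_sum_erase _ _ hmem] at h3
  have hmon := monomial_notMem hσ hO hγ ([] ++ []) hm
  have hprime := m.isMaximal.isPrime
  have hf0 : ∀ w, degree w = 0 → f w ∈ m.asIdeal := fun w hw => by
    have := hf w
    rwa [hw, translate_zero] at this
  have h4 : ∑ w ∈ ((insert [] h'.support).filter (fun w => degree w = 0)).erase [],
      h' w * monomial σ (w ++ []) γ ∈ m.asIdeal := by
    refine sum_mem fun w hw => Ideal.mul_mem_right _ _ ?_
    rw [Finset.mem_erase, Finset.mem_filter] at hw
    rw [hh', Finsupp.sub_apply, Finsupp.single_eq_of_ne hw.1, sub_zero]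
    exact hf0 w hw.2.2
  have h5 : h' [] * monomial σ ([] ++ []) γ ∈ m.asIdeal := by
    rw [eq_neg_of_add_eq_zero_left h3]
    exact neg_mem h4
  have h6 := (hprime.mem_or_mem h5).resolve_right hmon
  rw [hh', Finsupp.sub_apply, Finsupp.single_eq_same] at h6
  have h7 := sub_mem (hf0 [] rfl) h6
  rw [sub_sub_cancel] at h7
  exact hprime.ne_top ((Ideal.eq_top_iff_one _).2 h7)

/-- The image of a word in the induced module. -/
noncomputable def Induced.ofWord (σ : Fin n → RingAut R) (t : Fin n → R) (m : MaximalSpectrum R)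
    (w : List (Fin n × ℤˣ)) : Induced σ t m := Alg.mk σ t (word σ t w) • one σ t m

theorem Induced.ofWord_mem (hσ : ∀ i j, Commute (σ i) (σ j)) (w : List (Fin n × ℤˣ)) :
    ofWord σ t m w ∈ weightSpace (Induced σ t m) (translate σ (degree w) m) := by
  refine mem_weightSpace.2 fun a ha => ?_
  obtain ⟨x, hx, rfl⟩ := mem_translate.1 ha
  rw [← coeff_smul, ofWord, smul_smul, Alg.coeff_eq, ← map_mul, ← word_mul_coeff hσ, map_mul,
    mul_smul, ← Alg.coeff_eq, coeff_smul, mem_weightSpace.1 one_mem x hx, smul_zero]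

theorem Induced.span_ofWord (hσ : ∀ i j, Commute (σ i) (σ j)) :
    Submodule.span R (Set.range (ofWord σ t m)) = ⊤ := by
  rw [eq_top_iff]
  intro v _
  obtain ⟨a, rfl⟩ := exists_smul_one v
  obtain ⟨a, rfl⟩ := Alg.mk_surjective σ t a
  obtain ⟨f, rfl⟩ := combination_surjective hσ t a
  rw [combination_apply, map_sum, Finset.sum_smul]
  refine sum_mem fun w _ => ?_
  rw [map_mul, mul_smul, ← Alg.coeff_eq, coeff_smul]
  exact Submodule.smul_mem _ _ (Submodule.subset_span ⟨w, rfl⟩)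

section Units

variable {γ : Fin n → R}

/-- Read `w u w'` in two ways: `u w'` is a coefficient that is invertible on the generator, and `w
u` is a coefficient in front of `w'`. So `w` and `w'` give proportional vectors. -/
theorem Induced.exists_ofWord_eq_smul (hσ : ∀ i j, Commute (σ i) (σ j)) (hO : IsOrbit σ O)
    (hγ : γ ∈ OmegaUnits σ O) (hm : m ∈ O) {w w' : List (Fin n × ℤˣ)}
    (h : degree w = degree w') : ∃ r : R, ofWord σ γ m w = r • ofWord σ γ m w' := by
  obtain ⟨u, hu⟩ := exists_degree_eq (-degree w')
  obtain ⟨d, hd⟩ := exists_mul_sub_one_mem (monomial_notMem hσ hO hγ (u ++ w') hm)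
  have h1 : one σ γ m = (monomial σ (u ++ w') γ * d) • one σ γ m := by
    rw [smul_eq_of_sub_mem one_mem hd, one_smul]
  have h2 : word σ γ w * Constr.coeff σ γ (monomial σ (u ++ w') γ * d) =
      Constr.coeff σ γ (monomial σ (w ++ u) γ * shift σ (degree w') d) * word σ γ w' := by
    rw [map_mul, ← word_eq_monomial σ γ (w := u ++ w') (by rw [degree_append, hu, neg_add_cancel]),
      word_append, ← mul_assoc, ← mul_assoc, ← word_append,
      word_eq_monomial σ γ (w := w ++ u) (by rw [degree_append, hu, h, add_neg_cancel]),
      mul_assoc, word_mul_coeff hσ, ← mul_assoc, ← map_mul]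
  refine ⟨monomial σ (w ++ u) γ * shift σ (degree w') d, ?_⟩
  rw [ofWord, h1, ← coeff_smul, smul_smul, Alg.coeff_eq, ← map_mul, h2, map_mul, mul_smul]
  rfl

theorem Induced.ofWord_ne_zero [IsDomain R] (hσ : ∀ i j, Commute (σ i) (σ j)) (hO : IsOrbit σ O)
    (hγ : γ ∈ OmegaUnits σ O) (hm : m ∈ O) (w : List (Fin n × ℤˣ)) : ofWord σ γ m w ≠ 0 := by
  intro h
  obtain ⟨u, hu⟩ := exists_degree_eq (-degree w)
  have h1 : Alg.mk σ γ (word σ γ u) • ofWord σ γ m w = 0 := by rw [h, smul_zero]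
  rw [ofWord, smul_smul, ← map_mul, ← word_append,
    word_eq_monomial σ γ (w := u ++ w) (by rw [degree_append, hu, neg_add_cancel]),
    ← Alg.coeff_eq, coeff_smul] at h1
  exact one_ne_zero hσ hO hγ hm
    (eq_zero_of_smul_eq_zero one_mem (monomial_notMem hσ hO hγ _ hm) h1)

open scoped Classical in
/-- Basis vectors of the weight spaces of the induced module. -/
noncomputable def Induced.basis (σ : Fin n → RingAut R) (t : Fin n → R) (m m' : MaximalSpectrum R) :
    Induced σ t m :=
  if h : ∃ g, translate σ g m = m' then ofWord σ t m (exists_degree_eq h.choose).choose else 0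

theorem Induced.exists_basis_eq {m' : MaximalSpectrum R} (h : ∃ g, translate σ g m = m') :
    ∃ w, translate σ (degree w) m = m' ∧ basis σ t m m' = ofWord σ t m w := by
  refine ⟨(exists_degree_eq h.choose).choose, ?_, dif_pos h⟩
  rw [(exists_degree_eq h.choose).choose_spec, h.choose_spec]

/-- The chosen vectors lie in the weight spaces and together span, since words leading to the same
weight have the same degree and so are proportional on the generator. Independence of the weight
spaces forces equality. -/
theorem Induced.weightSpace_eq (hσ : ∀ i j, Commute (σ i) (σ j)) (hO : IsTorsionFreeOrbit σ O)
    (hγ : γ ∈ OmegaUnits σ O) (hm : m ∈ O) :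
    (⨆ m', Submodule.span R {basis σ γ m m'} = ⊤) ∧
      (fun m' => Submodule.span R {basis σ γ m m'}) = weightSpace (Induced σ γ m) := by
  have h1 : ⨆ m', Submodule.span R {basis σ γ m m'} = ⊤ := by
    rw [eq_top_iff, ← span_ofWord hσ, Submodule.span_le]
    rintro _ ⟨w, rfl⟩
    obtain ⟨w', hw', h⟩ := exists_basis_eq (σ := σ) (t := γ) (m := m)
      (m' := translate σ (degree w) m) ⟨_, rfl⟩
    obtain ⟨r, hr⟩ := exists_ofWord_eq_smul hσ hO.1 hγ hm (hO.translate_injective hσ hm hw').symm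
    refine Submodule.mem_iSup_of_mem (translate σ (degree w) m) ?_
    rw [Submodule.mem_span_singleton, h]
    exact ⟨r, hr.symm⟩
  refine ⟨h1, ((iSupIndep_weightSpace (R := R) (Induced σ γ m)).le_iff_eq_of_iSup_eq_top h1).1
    fun m' => ?_⟩
  rw [Submodule.span_singleton_le_iff_mem]
  by_cases h : ∃ g, translate σ g m = m'
  · obtain ⟨w, rfl, h⟩ := exists_basis_eq (t := γ) h
    rw [h]
    exact ofWord_mem hσ w
  · rw [basis, dif_neg h]
    exact zero_mem _

/-- The induced module as an object of `A(γ)-wmod_O`. -/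
noncomputable def Induced.obj (hσ : ∀ i j, Commute (σ i) (σ j)) (hO : IsTorsionFreeOrbit σ O)
    (hγ : γ ∈ OmegaUnits σ O) (hm : m ∈ O) : WMod σ O γ where
  carrier := Induced σ γ m
  coeff_smul := coeff_smul
  iSup_weightSpace := by
    rw [← (weightSpace_eq hσ hO hγ hm).2]
    exact (weightSpace_eq hσ hO hγ hm).1
  finite m' := by
    rw [← congrFun (weightSpace_eq hσ hO hγ hm).2 m']
    infer_instance
  support m' hm' := by
    rw [← congrFun (weightSpace_eq hσ hO hγ hm).2 m', basis, dif_neg, Submodule.span_zero_singleton]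
    rintro ⟨g, rfl⟩
    exact hm' (hO.1.translate_mem hσ hm g)

theorem Induced.isLineBasis [IsDomain R] (hσ : ∀ i j, Commute (σ i) (σ j))
    (hO : IsTorsionFreeOrbit σ O) (hγ : γ ∈ OmegaUnits σ O) (hm : m ∈ O) :
    IsLineBasis (obj hσ hO hγ hm) (basis σ γ m) where
  mem m' _ := by
    change basis σ γ m m' ∈ weightSpace (Induced σ γ m) m'
    rw [← congrFun (weightSpace_eq hσ hO hγ hm).2 m']
    exact Submodule.mem_span_singleton_self _
  ne_zero m' hm' := by
    obtain ⟨w, -, h⟩ := exists_basis_eq (t := γ) (hO.1.exists_translate hσ hm hm')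
    rw [h]
    exact ofWord_ne_zero hσ hO.1 hγ hm w
  exists_smul m' _ v hv := by
    change v ∈ weightSpace (Induced σ γ m) m' at hv
    rw [← congrFun (weightSpace_eq hσ hO hγ hm).2 m'] at hv
    obtain ⟨r, hr⟩ := (Submodule.mem_span_singleton (M := Induced σ γ m)).1 hv
    exact ⟨r, hr.symm⟩

/-- Every simple object is isomorphic to the induced module. -/
theorem Induced.nonempty_equiv [IsDomain R] (hσ : ∀ i j, Commute (σ i) (σ j))
    (hO : IsTorsionFreeOrbit σ O) (hγ : γ ∈ OmegaUnits σ O) (hm : m ∈ O) (S : WMod σ O γ)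
    (hS : IsSimpleModule (Alg σ γ) S) : Nonempty (S ≃ₗ[Alg σ γ] obj hσ hO hγ hm) := by
  -- A non-zero module has a non-zero weight vector over some point of `O`, and a suitable word
  -- carries it to weight `m`.
  obtain ⟨x, hx, hx0⟩ : ∃ x ∈ weightSpace (S : Type u) m, x ≠ 0 := by
    have := IsSimpleModule.nontrivial (Alg σ γ) S
    obtain ⟨v, hv⟩ := exists_ne (0 : S)
    by_contra! hcon
    refine hv (DFunLike.congr_fun (f := AddMonoidHom.id S) (g := 0)
      (S.hom_ext fun m' hm' v hv => ?_) v)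
    by_contra hv0
    obtain ⟨g, rfl⟩ := hO.1.exists_translate hσ hm' hm
    obtain ⟨w, rfl⟩ := exists_degree_eq g
    exact S.opWord_ne_zero hσ hO.1 hγ hm' hv hv0 w (hcon _ (S.isSkew.opWord_mem hσ w hv))
  let f : (obj hσ hO hγ hm : Type u) →ₗ[Alg σ γ] S :=
    (leftIdeal σ γ m).liftQ (LinearMap.toSpanSingleton (Alg σ γ) S x) (by
      rw [leftIdeal, Submodule.span_le]
      rintro _ ⟨a, ha, rfl⟩
      change Alg.coeff σ γ a • x = 0
      rw [S.coeff_smul, mem_weightSpace.1 hx a ha])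
  have hf1 : f (one σ γ m) = x := by
    refine ((leftIdeal σ γ m).liftQ_apply _ _).trans ?_
    simp
  have := (isLineBasis hσ hO hγ hm).isSimpleModule hσ hO.1 hγ
  have hf0 : f ≠ 0 := fun h => hx0 (hf1.symm.trans (LinearMap.congr_fun h _))
  exact ⟨(LinearEquiv.ofBijective f (f.bijective_or_eq_zero.resolve_right hf0)).symm⟩

theorem nonempty_equiv_of_isSimpleModule [IsDomain R] (hσ : ∀ i j, Commute (σ i) (σ j))
    (hO : IsTorsionFreeOrbit σ O) (hγ : γ ∈ OmegaUnits σ O) (S S' : WMod σ O γ)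
    (hS : IsSimpleModule (Alg σ γ) S) (hS' : IsSimpleModule (Alg σ γ) S') :
    Nonempty (S ≃ₗ[Alg σ γ] S') := by
  obtain ⟨m, hm⟩ := hO.1.nonempty
  obtain ⟨e⟩ := Induced.nonempty_equiv hσ hO hγ hm S hS
  obtain ⟨e'⟩ := Induced.nonempty_equiv hσ hO hγ hm S' hS'
  exact ⟨e.trans e'.symm⟩

theorem exists_isLineBasis [IsDomain R] (hσ : ∀ i j, Commute (σ i) (σ j))
    (hO : IsTorsionFreeOrbit σ O) (hγ : γ ∈ OmegaUnits σ O) :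
    ∃ (S : WMod σ O γ) (e : MaximalSpectrum R → S), IsLineBasis S e := by
  obtain ⟨m, hm⟩ := hO.1.nonempty
  exact ⟨_, _, Induced.isLineBasis hσ hO hγ hm⟩

end Units

end Induced

end TGWA

/-! ### Actions on tensor products, and lines. -/

namespace TGWA

section Twist

variable {R : Type u} [CommRing R] {n : ℕ} {σ : Fin n → RingAut R} {O : Set (MaximalSpectrum R)}
  {s t t' γ : Fin n → R}

/-! ### The action on tensor products -/

theorem tensorHom_coeff (hs : s = t * t') (M : WMod σ O t) (N : WMod σ O t') (r : R)
    (x : M ⊗[R] N) : tensorHom hs M N (Constr.coeff σ s r) x = r • x := by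
  change tensorHom hs M N (Constr.mk σ s _) x = _
  rw [tensorHom_mk, FreeAlgebra.lift_ι_apply]
  rfl

theorem tensorHom_X (hs : s = t * t') (M : WMod σ O t) (N : WMod σ O t') (i : Fin n) (ε : ℤˣ) :
    tensorHom hs M N (Constr.X σ s i ε) = tensorX M N i ε := by
  change tensorHom hs M N (Constr.mk σ s _) = _
  rw [tensorHom_mk, FreeAlgebra.lift_ι_apply]
  rfl

theorem tensorHom_word_tmul (hs : s = t * t') (M : WMod σ O t) (N : WMod σ O t')
    (w : List (Fin n × ℤˣ)) (x : M) (y : N) :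
    tensorHom hs M N (word σ s w) (x ⊗ₜ y) = opWord M.op w x ⊗ₜ[R] opWord N.op w y := by
  induction w with
  | nil => rw [word_nil, map_one]; rfl
  | cons z w ih =>
    rw [word_cons, map_mul, end_mul_apply, ih, tensorHom_X, tensorX_tmul, opWord_cons,
      opWord_cons]
    rfl

theorem tensorObj_hom {hs : s = t * t'} {M : WMod σ O t} {N : WMod σ O t'}
    (h : TensorActs hs M N) (a : Constr σ s) (x : M ⊗[R] N) :
    (tensorObj h).hom a x = tensorHom hs M N a x := by
  rw [← tensorAlgHom_mk h]; rfl

theorem tensorObj_op_tmul {hs : s = t * t'} {M : WMod σ O t} {N : WMod σ O t'}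
    (h : TensorActs hs M N) (i : Fin n) (ε : ℤˣ) (x : M) (y : N) :
    (tensorObj h).op i ε (x ⊗ₜ[R] y) = M.op i ε x ⊗ₜ[R] N.op i ε y := by
  refine (tensorObj_hom h _ _).trans ?_
  rw [tensorHom_X]; rfl

theorem tensorObj_opWord_tmul {hs : s = t * t'} {M : WMod σ O t} {N : WMod σ O t'}
    (h : TensorActs hs M N) (w : List (Fin n × ℤˣ)) (x : M) (y : N) :
    opWord (tensorObj h).op w (x ⊗ₜ[R] y) = opWord M.op w x ⊗ₜ[R] opWord N.op w y := by
  refine ((tensorObj h).hom_word w _).symm.trans ((tensorObj_hom h _ _).trans ?_)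
  rw [tensorHom_word_tmul]

theorem tmul_mem_weightSpace {M N : Type u} [AddCommGroup M] [Module R M] [AddCommGroup N]
    [Module R N] {m : MaximalSpectrum R} {x : M} (hx : x ∈ weightSpace M m) (y : N) :
    x ⊗ₜ[R] y ∈ weightSpace (M ⊗[R] N) m :=
  mem_weightSpace.2 fun a ha => by
    rw [TensorProduct.smul_tmul', mem_weightSpace.1 hx a ha, TensorProduct.zero_tmul]

/-- Vectors of distinct weights have zero tensor product, as they are killed by coprime ideals, so
tensors of vectors of equal weight suffice. -/
theorem tensor_hom_ext (M : WMod σ O t) (N : WMod σ O t') {A : Type*} [AddCommGroup A]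
    {f g : M ⊗[R] N →+ A} (h : ∀ m ∈ O, ∀ x ∈ weightSpace (M : Type u) m,
      ∀ y ∈ weightSpace (N : Type u) m, f (x ⊗ₜ y) = g (x ⊗ₜ y)) : f = g := by
  have htop : ⨆ m : MaximalSpectrum R, weightSpace (R := R) (M ⊗[R] N) m = ⊤ := by
    rw [← iSup_range_weight M N]
    exact iSup_congr fun m => (congrFun (range_weight_eq M N) m).symm
  refine ext_weightSpace htop fun m v hv => ?_
  rw [← congrFun (range_weight_eq M N) m] at hv
  obtain ⟨z, rfl⟩ := hv
  induction z with
  | zero => simp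
  | add x y hx hy => rw [map_add, map_add, map_add, hx, hy]
  | tmul x y =>
    rw [TensorProduct.map_tmul]
    by_cases hm : m ∈ O
    · exact h m hm x x.2 y y.2
    · have hx : (weightSpace (M : Type u) m).subtype x = 0 := M.eq_zero_of_mem hm x.2
      rw [hx, TensorProduct.zero_tmul, map_zero, map_zero]

/-- A criterion for `M ⊗_R N` to be a module over `A(tt')`. -/
theorem tensorActs_of_forall (hσ : ∀ i j, Commute (σ i) (σ j)) (hs : s = t * t')
    (hs' : Consistent σ s) (M : WMod σ O t) (N : WMod σ O t')
    (h : ∀ (g : Fin n → ℤ) (u : List (Fin n × ℤˣ)) (F : Finset (List (Fin n × ℤˣ)))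
      (r : List (Fin n × ℤˣ) → R), (∀ w ∈ F, degree w = g) → degree u = -g →
      ∑ w ∈ F, r w * monomial σ (w ++ u) s = 0 → ∀ m ∈ O, ∀ x ∈ weightSpace (M : Type u) m,
      ∀ y ∈ weightSpace (N : Type u) m,
        ∑ w ∈ F, r w • (opWord M.op w x ⊗ₜ[R] opWord N.op w y) = 0) : TensorActs hs M N := by
  refine map_isTorsion_eq_zero hσ hs' (tensorHom hs M N).toAddMonoidHom
    fun g u F r hF hu hsum => ?_
  refine tensor_hom_ext M N fun m hm x hx y hy => ?_
  refine ((end_sum_apply _ _ _).trans (Finset.sum_congr rfl fun w _ => ?_)).trans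
    (h g u F r hF hu hsum m hm x hx y hy)
  change tensorHom hs M N _ _ = _
  rw [map_mul, end_mul_apply, tensorHom_coeff, tensorHom_word_tmul]

/-! ### Twisting by a line -/

/-- An object of `A(γ)-wmod_O` whose weight spaces are lines, with basis vectors and the matrix
coefficients `κ` of `X_i^±`, which are invertible, with inverses given by `η`. -/
structure Line (σ : Fin n → RingAut R) (O : Set (MaximalSpectrum R)) (γ : Fin n → R) where
  obj : WMod σ O γ
  vec : MaximalSpectrum R → obj
  isLineBasis : IsLineBasis obj vec
  κ : Fin n → ℤˣ → MaximalSpectrum R → R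
  η : Fin n → ℤˣ → MaximalSpectrum R → R
  op_vec : ∀ i (ε : ℤˣ), ∀ m ∈ O,
    obj.op i ε (vec m) = κ i ε m • vec (translate σ (Pi.single i (ε : ℤ)) m)
  inv : ∀ i (ε : ℤˣ), ∀ m ∈ O, (σ i ^ (2 * (ε : ℤ))) (η i ε m) * κ i ε m - 1 ∈
    (translate σ (Pi.single i (ε : ℤ)) m).asIdeal

theorem IsLineBasis.exists_line (hσ : ∀ i j, Commute (σ i) (σ j)) (hO : IsOrbit σ O)
    (hγ : γ ∈ OmegaUnits σ O) {S : WMod σ O γ} {e : MaximalSpectrum R → S}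
    (he : IsLineBasis S e) : ∃ L : Line σ O γ, L.obj = S := by
  have h : ∀ i (ε : ℤˣ) m, ∃ κ η : R, m ∈ O →
      S.op i ε (e m) = κ • e (translate σ (Pi.single i (ε : ℤ)) m) ∧
      (σ i ^ (2 * (ε : ℤ))) η * κ - 1 ∈ (translate σ (Pi.single i (ε : ℤ)) m).asIdeal := by
    intro i ε m
    by_cases hm : m ∈ O
    · have h0 := S.opWord_ne_zero hσ hO hγ hm (he.mem m hm) (he.ne_zero m hm) [(i, ε)]
      obtain ⟨κ, hκ, h⟩ := he.exists_eq_smul (hO.translate_mem hσ hm (Pi.single i (ε : ℤ)))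
        (S.isSkew.op_mem hσ i ε (he.mem m hm)) (by simpa using h0)
      obtain ⟨d, hd⟩ := exists_mul_sub_one_mem hκ
      -- The inverse scalar is pulled back along `σ_i^{±1}` because it will be applied before
      -- `X_i^±`.
      refine ⟨κ, (σ i ^ (2 * (ε : ℤ)))⁻¹ d, fun _ => ⟨h, ?_⟩⟩
      rw [← RingAut.mul_apply, mul_inv_cancel, RingAut.one_apply, mul_comm]
      exact hd
    · exact ⟨0, 0, fun h => absurd h hm⟩
  choose κ η h using h
  exact ⟨⟨S, e, he, κ, η, fun i ε m hm => (h i ε m hm).1, fun i ε m hm => (h i ε m hm).2⟩, rfl⟩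

variable [IsDomain R]

/-- Tensor products with modules over `A(γ)`, `γ ∈ Ω_O^×`, are defined. -/
theorem tensorActs_of_units (hσ : ∀ i j, Commute (σ i) (σ j)) (hO : IsOrbit σ O)
    (hγ : γ ∈ OmegaUnits σ O) (hs : s = t * γ) (hs' : Consistent σ s) (ht : ∀ i, t i ≠ 0)
    (M : WMod σ O t) (N : WMod σ O γ) : TensorActs hs M N := by
  refine tensorActs_of_forall hσ hs hs' M N fun g u F r hF hu hsum m hm x hx y hy => ?_
  -- Replacing `y` by `uy` turns the second factor `wuy` into `c_{wu}(γ) y`, which depends on `w`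
  -- only through a scalar.
  obtain ⟨y, -, rfl⟩ := N.exists_opWord_eq hσ hO hγ hm hy u hu
  -- As `c_{wu}(tγ) = c_{wu}(t) c_{wu}(γ)`, the relation for `tγ` with coefficients `r_w` is the
  -- relation for `t` with coefficients `r_w c_{wu}(γ)`.
  have h := M.sum_smul_opWord_eq_zero hσ ht F (fun w => r w * monomial σ (w ++ u) γ) hF hu (by
    rw [← hsum]
    refine Finset.sum_congr rfl fun w _ => ?_
    rw [hs, map_mul]; ring) x
  rw [← TensorProduct.zero_tmul M y, ← h, TensorProduct.sum_tmul]
  refine Finset.sum_congr rfl fun w hw => ?_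
  rw [N.opWord_opWord (by rw [hF w hw, hu, neg_neg]), mul_smul, TensorProduct.tmul_smul,
    TensorProduct.smul_tmul', TensorProduct.smul_tmul']

end Twist

end TGWA

/-! ### Twisting modules by a line. -/

namespace TGWA

section Untwist

variable {R : Type u} [CommRing R] {n : ℕ} {σ : Fin n → RingAut R} {O : Set (MaximalSpectrum R)}
  {s t t' γ γ' : Fin n → R}

theorem exists_linearMap_of_surjective {A B C : Type*} [AddCommGroup A] [Module R A]
    [AddCommGroup B] [Module R B] [AddCommGroup C] [Module R C] (f : A →ₗ[R] B)
    (hf : Function.Surjective f) (g : A →ₗ[R] C) (h : ∀ a, f a = 0 → g a = 0) :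
    ∃ k : B →ₗ[R] C, ∀ a, k (f a) = g a := by
  have hle : LinearMap.ker f ≤ LinearMap.ker g := fun a ha =>
    LinearMap.mem_ker.2 (h a (LinearMap.mem_ker.1 ha))
  refine ⟨((LinearMap.ker f).liftQ g hle).comp
    (f.quotKerEquivOfSurjective hf).symm.toLinearMap, fun a => ?_⟩
  have : (f.quotKerEquivOfSurjective hf).symm (f a) = Submodule.Quotient.mk a := by
    rw [LinearEquiv.symm_apply_eq]; rfl
  rw [LinearMap.comp_apply, LinearEquiv.coe_coe, this]
  exact (LinearMap.ker f).liftQ_apply g a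

/-- Tensoring with a line does not change the `R`-module. -/
theorem Line.exists_theta (L : Line σ O γ) (M : WMod σ O t) :
    ∃ Θ : M ≃ₗ[R] M ⊗[R] L.obj, ∀ m ∈ O, ∀ v ∈ weightSpace (M : Type u) m,
      Θ v = v ⊗ₜ[R] L.vec m := by
  classical
  obtain ⟨F, hF⟩ := exists_linearMap_weightSpace M.iSup_weightSpace fun m =>
    ((TensorProduct.mk R M L.obj).flip (L.vec m)).comp (weightSpace (M : Type u) m).subtype
  have hF' : ∀ m, ∀ v ∈ weightSpace (M : Type u) m, F v = v ⊗ₜ[R] L.vec m :=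
    fun m v hv => hF m ⟨v, hv⟩
  -- `p m` is the projection to `M_m`. The left inverse of `F` will be built from `v ⊗ e_m ↦ p m v`.
  let p : MaximalSpectrum R → M →ₗ[R] M := fun m =>
    scaleWeights M.iSup_weightSpace (Pi.single m 1)
  have hp : ∀ m, ∀ v ∈ weightSpace (M : Type u) m, p m v = v := fun m v hv => by
    rw [scaleWeights_apply _ _ hv, Pi.single_eq_same, one_smul]
  have hpm : ∀ m, ∀ r ∈ m.asIdeal, r • p m = 0 := fun m r hr => by
    refine ext_weightSpace_linear M.iSup_weightSpace fun m' v hv => ?_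
    rw [LinearMap.smul_apply, scaleWeights_apply _ _ hv, LinearMap.zero_apply]
    by_cases h : m' = m
    · subst h
      rw [Pi.single_eq_same, one_smul, mem_weightSpace.1 hv r hr]
    · rw [Pi.single_eq_of_ne h, zero_smul, smul_zero]
  -- Sending `e_m` to `p m` is well defined: scalars that kill `e_m ≠ 0` lie in `m`, and these kill
  -- `p m`.
  have hG : ∀ m, ∃ g : weightSpace (L.obj : Type u) m →ₗ[R] M →ₗ[R] M,
      ∀ hm : m ∈ O, g ⟨L.vec m, L.isLineBasis.mem m hm⟩ = p m := by
    intro m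
    by_cases hm : m ∈ O
    · obtain ⟨k, hk⟩ := exists_linearMap_of_surjective
        (LinearMap.toSpanSingleton R (weightSpace (L.obj : Type u) m)
          ⟨L.vec m, L.isLineBasis.mem m hm⟩) (fun ⟨v, hv⟩ => by
            obtain ⟨r, rfl⟩ := L.isLineBasis.exists_smul m hm v hv
            exact ⟨r, rfl⟩)
        (LinearMap.toSpanSingleton R (M →ₗ[R] M) (p m)) (fun r hr => by
          refine hpm m r ?_
          by_contra hrm
          exact L.isLineBasis.ne_zero m hm (eq_zero_of_smul_eq_zero (L.isLineBasis.mem m hm) hrm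
            (congrArg Subtype.val hr)))
      refine ⟨k, fun _ => ?_⟩
      have := hk 1
      rwa [LinearMap.toSpanSingleton_apply, LinearMap.toSpanSingleton_apply, one_smul,
        one_smul] at this
    · exact ⟨0, fun h => absurd h hm⟩
  choose g hg using hG
  obtain ⟨G, hG⟩ := exists_linearMap_weightSpace L.obj.iSup_weightSpace g
  have hinj : Function.Injective F := by
    refine Function.LeftInverse.injective (g := TensorProduct.lift G.flip) fun v => ?_
    refine DFunLike.congr_fun (f := (TensorProduct.lift G.flip).toAddMonoidHom.comp
      F.toAddMonoidHom) (g := AddMonoidHom.id M) (M.hom_ext fun m hm v hv => ?_) v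
    change TensorProduct.lift G.flip (F v) = v
    rw [hF' m v hv, TensorProduct.lift.tmul, LinearMap.flip_apply,
      hG m ⟨L.vec m, L.isLineBasis.mem m hm⟩, hg m hm, hp m v hv]
  have hsurj : Function.Surjective F := by
    rw [← LinearMap.range_eq_top, eq_top_iff, ← iSup_range_weight M L.obj, iSup_le_iff]
    rintro m _ ⟨z, rfl⟩
    induction z with
    | zero => simp
    | add x y hx hy => rw [map_add]; exact add_mem hx hy
    | tmul x y =>
      rw [TensorProduct.map_tmul]
      by_cases hm : m ∈ O
      · obtain ⟨r, hr⟩ := L.isLineBasis.exists_smul m hm y y.2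
        refine ⟨r • (x : M), ?_⟩
        rw [hF' m _ (Submodule.smul_mem _ _ x.2), Submodule.subtype_apply, Submodule.subtype_apply,
          hr, TensorProduct.smul_tmul]
      · have hx : (weightSpace (M : Type u) m).subtype x = 0 := M.eq_zero_of_mem hm x.2
        rw [hx, TensorProduct.zero_tmul]
        exact zero_mem _
  exact ⟨LinearEquiv.ofBijective F ⟨hinj, hsurj⟩, fun m _ v hv => hF' m v hv⟩

/-- The isomorphism `M ≅ M ⊗_R L` over `R`. -/
noncomputable def Line.theta (L : Line σ O γ) (M : WMod σ O t) : M ≃ₗ[R] M ⊗[R] L.obj :=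
  (L.exists_theta M).choose

theorem Line.theta_apply (L : Line σ O γ) (M : WMod σ O t) {m : MaximalSpectrum R} (hm : m ∈ O)
    {v : M} (hv : v ∈ weightSpace (M : Type u) m) : L.theta M v = v ⊗ₜ[R] L.vec m :=
  (L.exists_theta M).choose_spec m hm v hv

/-! ### Twisted modules -/

section IsTwist

variable {V V' : Type u} [AddCommGroup V] [Module R V] [AddCommGroup V'] [Module R V']
  {T : Fin n → ℤˣ → AddMonoid.End V} {T' : Fin n → ℤˣ → AddMonoid.End V'}

/-- Along `ψ`, the operators `T'` are the operators `T` multiplied by the matrix coefficients of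
the line `L`. -/
def Line.IsTwist (L : Line σ O γ) (T : Fin n → ℤˣ → AddMonoid.End V)
    (T' : Fin n → ℤˣ → AddMonoid.End V') (ψ : V ≃ₗ[R] V') : Prop :=
  ∀ i ε, ∀ m ∈ O, ∀ v ∈ weightSpace V m, T' i ε (ψ v) = L.κ i ε m • ψ (T i ε v)

/-- Along a word, the scalars of the single letters are shifted and multiplied in the same way on
the line and in the twist. The scalar `k` is determined only modulo the ideal of the target weight,
and this suffices since both sides live in that weight space. -/
theorem Line.IsTwist.opWord (hσ : ∀ i j, Commute (σ i) (σ j)) (hO : IsOrbit σ O) {L : Line σ O γ}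
    {ψ : V ≃ₗ[R] V'} (h : L.IsTwist T T' ψ) (hT : IsSkew σ T) (hT' : IsSkew σ T')
    {m : MaximalSpectrum R} (hm : m ∈ O) {v : V} (hv : v ∈ weightSpace V m)
    (w : List (Fin n × ℤˣ)) {k : R}
    (hk : TGWA.opWord L.obj.op w (L.vec m) = k • L.vec (translate σ (degree w) m)) :
    TGWA.opWord T' w (ψ v) = k • ψ (TGWA.opWord T w v) := by
  induction w generalizing k with
  | nil =>
    rw [degree_nil, translate_zero, opWord_nil] at hk
    have h1 := sub_mem_of_smul_eq (L.isLineBasis.mem m hm) (L.isLineBasis.ne_zero m hm)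
      ((one_smul R _).trans hk)
    exact (one_smul R _).symm.trans
      (smul_eq_of_sub_mem (map_mem_weightSpace ψ.toLinearMap hv) h1)
  | cons x w ih =>
    obtain ⟨k', hk'⟩ := L.isLineBasis.exists_smul _ (hO.translate_mem hσ hm (degree w)) _
      (L.obj.isSkew.opWord_mem hσ w (L.isLineBasis.mem m hm))
    have hm1 := hO.translate_mem hσ hm (degree w)
    have hm2 := hO.translate_mem hσ hm1 (Pi.single x.1 (x.2 : ℤ))
    rw [degree_cons, translate_add hσ, opWord_cons, hk', L.obj.isSkew, L.op_vec _ _ _ hm1,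
      smul_smul] at hk
    have h1 := sub_mem_of_smul_eq (L.isLineBasis.mem _ hm2) (L.isLineBasis.ne_zero _ hm2) hk
    have hw := hT.opWord_mem hσ w hv
    rw [opWord_cons, opWord_cons, ih hk', hT', h _ _ _ hm1 _ hw, smul_smul]
    exact smul_eq_of_sub_mem (map_mem_weightSpace ψ.toLinearMap (hT.op_mem hσ _ _ hw)) h1

/-- Write `e_m = u(l e_{g(m)})`; then `w e_m = wu(l e_{g(m)})`, and `wu` acts by `c_{wu}(γ)`. Only
this monomial depends on `w`. -/
theorem Line.exists_opWord_vec (hσ : ∀ i j, Commute (σ i) (σ j)) (hO : IsOrbit σ O)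
    (hγ : γ ∈ OmegaUnits σ O) (L : Line σ O γ) {m : MaximalSpectrum R} (hm : m ∈ O)
    {g : Fin n → ℤ} {u : List (Fin n × ℤˣ)} (hu : degree u = -g) :
    ∃ l : R, l ∉ (translate σ g m).asIdeal ∧ ∀ w, degree w = g →
      TGWA.opWord L.obj.op w (L.vec m) = (monomial σ (w ++ u) γ * l) • L.vec (translate σ g m) := by
  obtain ⟨v, hv, h⟩ := L.obj.exists_opWord_eq hσ hO hγ hm (L.isLineBasis.mem m hm) u hu
  have hv0 : v ≠ 0 := by
    rintro rfl
    rw [map_zero] at h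
    exact L.isLineBasis.ne_zero m hm h.symm
  obtain ⟨l, hl, rfl⟩ := L.isLineBasis.exists_eq_smul (hO.translate_mem hσ hm g) hv hv0
  refine ⟨l, hl, fun w hw => ?_⟩
  rw [← h, L.obj.opWord_opWord (by rw [hw, hu, neg_neg]), smul_smul]

/-- A twist multiplies the words of degree `g` by their values in degree zero, up to a common
unit. -/
theorem Line.exists_twist (hσ : ∀ i j, Commute (σ i) (σ j)) (hO : IsOrbit σ O)
    (hγ : γ ∈ OmegaUnits σ O) (L : Line σ O γ) {ψ : V ≃ₗ[R] V'} (h : L.IsTwist T T' ψ)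
    (hT : IsSkew σ T) (hT' : IsSkew σ T') {m : MaximalSpectrum R} (hm : m ∈ O)
    {g : Fin n → ℤ} {u : List (Fin n × ℤˣ)} (hu : degree u = -g) :
    ∃ l : R, l ∉ (translate σ g m).asIdeal ∧ ∀ w, degree w = g → ∀ v ∈ weightSpace V m,
      TGWA.opWord T' w (ψ v) = (monomial σ (w ++ u) γ * l) • ψ (TGWA.opWord T w v) := by
  obtain ⟨l, hl, h'⟩ := L.exists_opWord_vec hσ hO hγ hm hu
  refine ⟨l, hl, fun w hw v hv => h.opWord hσ hO hT hT' hm hv w ?_⟩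
  rw [h' w hw, hw]

end IsTwist

end Untwist

end TGWA

/-! ### Undoing a twist. -/

namespace TGWA

section Untwist

variable {R : Type u} [CommRing R] {n : ℕ} {σ : Fin n → RingAut R} {O : Set (MaximalSpectrum R)}
  {s t t' γ γ' : Fin n → R}

theorem eq_of_smul_eq_smul {M : Type u} [AddCommGroup M] [Module R M] {m : MaximalSpectrum R}
    {x y : M} (hx : x ∈ weightSpace M m) (hy : y ∈ weightSpace M m) {k : R} (hk : k ∉ m.asIdeal)
    (h : k • x = k • y) : x = y :=
  sub_eq_zero.1 (eq_zero_of_smul_eq_zero (Submodule.sub_mem _ hx hy) hk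
    (by rw [smul_sub, h, sub_self]))

theorem WMod.op_op (M : WMod σ O t) (i : Fin n) (ε : ℤˣ) (v : M) :
    M.op i ε (M.op i (-ε) v) = (σ i ^ (ε : ℤ)) (t i) • v := by
  rw [← M.hom_coeff, ← Constr.X_mul_X, map_mul]; rfl

theorem WMod.op_comm (M : WMod σ O t) {i j : Fin n} (hij : i ≠ j) (ε : ℤˣ) (v : M) :
    M.op i ε (M.op j (-ε) v) = M.op j (-ε) (M.op i ε v) := by
  change (M.hom _ * M.hom _) v = (M.hom _ * M.hom _) v
  rw [← map_mul, ← map_mul, Constr.X_comm σ t hij]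

/-! ### Modules from operators -/

section Operators

variable {V : Type u} [AddCommGroup V] [Module R V]

/-- The action of the generators through given operators. -/
def opGen (T : Fin n → ℤˣ → AddMonoid.End V) : Gen R n → AddMonoid.End V
  | .coeff r => Module.toAddMonoidEnd R V r
  | .X i ε => T i ε

/-- The action of `Ã(t)` through operators that satisfy its relations. -/
def opHom (t : Fin n → R) (T : Fin n → ℤˣ → AddMonoid.End V) (hT : IsSkew σ T)
    (h : ∀ i (ε : ℤˣ) v, T i ε (T i (-ε) v) = (σ i ^ (ε : ℤ)) (t i) • v)
    (h' : ∀ i j, i ≠ j → ∀ (ε : ℤˣ) v, T i ε (T j (-ε) v) = T j (-ε) (T i ε v)) :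
    Constr σ t →+* AddMonoid.End V :=
  RingQuot.lift ⟨(FreeAlgebra.lift ℤ (opGen (R := R) T)).toRingHom, by
    intro a b hab
    refine DFunLike.ext _ _ fun x => ?_
    simp only [AlgHom.toRingHom_eq_coe, RingHom.coe_coe]
    induction hab with
    | coeff_one => simp [opGen]
    | coeff_add r s => simp [opGen]
    | coeff_mul r s => simp [opGen]
    | X_coeff i ε r =>
      simp only [map_mul, FreeAlgebra.lift_ι_apply, opGen, end_mul_apply, toAddMonoidEnd_apply']
      exact hT i ε r x
    | X_X i ε =>
      simp only [map_mul, FreeAlgebra.lift_ι_apply, opGen, end_mul_apply, toAddMonoidEnd_apply']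
      exact h i ε x
    | X_comm i j hij ε =>
      simp only [map_mul, FreeAlgebra.lift_ι_apply, opGen, end_mul_apply]
      exact h' i j hij ε x⟩

variable {T : Fin n → ℤˣ → AddMonoid.End V} {hT : IsSkew σ T}
  {h : ∀ i (ε : ℤˣ) v, T i ε (T i (-ε) v) = (σ i ^ (ε : ℤ)) (t i) • v}
  {h' : ∀ i j, i ≠ j → ∀ (ε : ℤˣ) v, T i ε (T j (-ε) v) = T j (-ε) (T i ε v)}

theorem opHom_coeff (r : R) (v : V) : opHom t T hT h h' (Constr.coeff σ t r) v = r • v :=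
  DFunLike.congr_fun ((RingQuot.lift_mkRingHom_apply _ _ _).trans
    (FreeAlgebra.lift_ι_apply (opGen (R := R) T) (Gen.coeff r))) v

theorem opHom_X (i : Fin n) (ε : ℤˣ) : opHom t T hT h h' (Constr.X σ t i ε) = T i ε :=
  (RingQuot.lift_mkRingHom_apply _ _ _).trans
    (FreeAlgebra.lift_ι_apply (opGen (R := R) T) (Gen.X i ε))

/-- An object of `A(t)-wmod_O` from an action of `Ã(t)` that kills torsion. -/
def WMod.ofHom (H : Constr σ t →+* AddMonoid.End V)
    (hH : ∀ r v, H (Constr.coeff σ t r) v = r • v)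
    (hH' : ∀ a, Constr.IsTorsion σ t a → H a = 0)
    (htop : ⨆ m : MaximalSpectrum R, weightSpace V m = ⊤)
    (hfin : ∀ m : MaximalSpectrum R, Module.Finite R (weightSpace V m))
    (hsupp : ∀ m : MaximalSpectrum R, m ∉ O → weightSpace V m = ⊥) : WMod σ O t where
  carrier := V
  module := Module.compHom V (RingQuot.lift ⟨H, fun a b hab => by
    rw [hab.2, hH' a hab.1, map_zero]⟩ : Alg σ t →+* AddMonoid.End V)
  coeff_smul r v := by
    rw [← hH]
    exact DFunLike.congr_fun (RingQuot.lift_mkRingHom_apply _ _ _) v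
  iSup_weightSpace := htop
  finite := hfin
  support := hsupp

theorem WMod.ofHom_hom {H : Constr σ t →+* AddMonoid.End V}
    {hH : ∀ r v, H (Constr.coeff σ t r) v = r • v}
    {hH' : ∀ a, Constr.IsTorsion σ t a → H a = 0}
    {htop : ⨆ m : MaximalSpectrum R, weightSpace V m = ⊤}
    {hfin : ∀ m : MaximalSpectrum R, Module.Finite R (weightSpace V m)}
    {hsupp : ∀ m : MaximalSpectrum R, m ∉ O → weightSpace V m = ⊥} (a : Constr σ t) (v : V) :
    (WMod.ofHom H hH hH' htop hfin hsupp).hom a v = H a v :=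
  DFunLike.congr_fun (RingQuot.lift_mkRingHom_apply _ _ _) v

end Operators

/-! ### The inverse twist -/

/-- The operators `X_i^±` divided by the matrix coefficients of the line `L`. -/
noncomputable def Line.untwistOp (L : Line σ O γ) (P : WMod σ O s) (i : Fin n) (ε : ℤˣ) :
    AddMonoid.End P :=
  (P.op i ε).comp (scaleWeights P.iSup_weightSpace (L.η i ε)).toAddMonoidHom

theorem Line.untwistOp_apply (L : Line σ O γ) (P : WMod σ O s) (i : Fin n) (ε : ℤˣ) (v : P) :
    L.untwistOp P i ε v = P.op i ε (scaleWeights P.iSup_weightSpace (L.η i ε) v) := rfl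

theorem Line.untwistOp_isSkew (L : Line σ O γ) (P : WMod σ O s) :
    IsSkew σ (L.untwistOp P) := fun i ε r v => by
  rw [untwistOp_apply, map_smul, P.isSkew, untwistOp_apply]

theorem Line.smul_untwistOp (hσ : ∀ i j, Commute (σ i) (σ j)) (L : Line σ O γ) (P : WMod σ O s)
    (i : Fin n) (ε : ℤˣ) {m : MaximalSpectrum R} (hm : m ∈ O) {v : P}
    (hv : v ∈ weightSpace (P : Type u) m) :
    L.κ i ε m • L.untwistOp P i ε v = P.op i ε v := by
  rw [untwistOp_apply, scaleWeights_apply _ _ hv, P.isSkew, smul_smul, mul_comm,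
    smul_eq_of_sub_mem (P.isSkew.op_mem hσ i ε hv) (L.inv i ε m hm), one_smul]

theorem Line.isTwist_untwistOp (hσ : ∀ i j, Commute (σ i) (σ j)) (L : Line σ O γ)
    (P : WMod σ O s) : L.IsTwist (L.untwistOp P) P.op (LinearEquiv.refl R P) :=
  fun i ε _ hm _ hv => (L.smul_untwistOp hσ P i ε hm hv).symm

/-- The tensor `x ⊗ y`, as an element of the object `M ⊗_R N`. -/
def tmulObj {hs : s = t * t'} {M : WMod σ O t} {N : WMod σ O t'} (h : TensorActs hs M N) (x : M)
    (y : N) : tensorObj h := x ⊗ₜ[R] y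

section tmulObj

variable {hs : s = t * t'} {M : WMod σ O t} {N : WMod σ O t'} (h : TensorActs hs M N)

theorem tensorObj_op_tmulObj (i : Fin n) (ε : ℤˣ) (x : M) (y : N) :
    (tensorObj h).op i ε (tmulObj h x y) = tmulObj h (M.op i ε x) (N.op i ε y) :=
  tensorObj_op_tmul h i ε x y

theorem tensorObj_opWord_tmulObj (w : List (Fin n × ℤˣ)) (x : M) (y : N) :
    opWord (tensorObj h).op w (tmulObj h x y) = tmulObj h (opWord M.op w x) (opWord N.op w y) :=
  tensorObj_opWord_tmul h w x y

theorem tmulObj_smul_right (r : R) (x : M) (y : N) :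
    tmulObj h x (r • y) = r • tmulObj h x y := TensorProduct.tmul_smul r x y

theorem tmulObj_mem {m : MaximalSpectrum R} {x : M} (hx : x ∈ weightSpace (M : Type u) m) (y : N) :
    tmulObj h x y ∈ weightSpace (tensorObj h : Type u) m := tmul_mem_weightSpace hx y

end tmulObj

/-- The isomorphism `M ≅ M ⊗_R L` over `R`. -/
noncomputable def Line.thetaObj {hs : s = t * γ} (L : Line σ O γ) {M : WMod σ O t}
    (h : TensorActs hs M L.obj) : M ≃ₗ[R] tensorObj h := L.theta M

theorem Line.thetaObj_apply {hs : s = t * γ} (L : Line σ O γ) {M : WMod σ O t}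
    (h : TensorActs hs M L.obj) {m : MaximalSpectrum R} (hm : m ∈ O) {v : M}
    (hv : v ∈ weightSpace (M : Type u) m) : L.thetaObj h v = tmulObj h v (L.vec m) :=
  L.theta_apply M hm hv

theorem Line.isTwist_thetaObj {hs : s = t * γ} (hσ : ∀ i j, Commute (σ i) (σ j)) (hO : IsOrbit σ O)
    (L : Line σ O γ) {M : WMod σ O t} (h : TensorActs hs M L.obj) :
    L.IsTwist M.op (tensorObj h).op (L.thetaObj h) := by
  intro i ε m hm v hv
  rw [L.thetaObj_apply h hm hv, tensorObj_op_tmulObj, L.op_vec i ε m hm,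
    L.thetaObj_apply h (hO.translate_mem hσ hm _) (M.isSkew.op_mem hσ i ε hv), tmulObj_smul_right]

/-- This clears denominators in the quotients `r_w / c_w`, which need not exist in `R`. In the
applications the common factor `∏ c_i` is a unit modulo the ideals in `O`, so it can be cancelled on
weight vectors. -/
theorem exists_common_multiple {ι : Type*} (F : Finset ι) (r c : ι → R) :
    ∃ q : ι → R, ∀ w ∈ F, q w * c w = (∏ i ∈ F, c i) * r w := by
  classical
  refine ⟨fun w => r w * ∏ i ∈ F.erase w, c i, fun w hw => ?_⟩
  rw [← Finset.mul_prod_erase F c hw]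
  ring

section Untwist

variable (hσ : ∀ i j, Commute (σ i) (σ j)) (hO : IsOrbit σ O) (hγ : γ ∈ OmegaUnits σ O)
  (L : Line σ O γ) (hs : s = t * γ) (P : WMod σ O s)

include hσ hO hγ hs in
-- The line acts through `X_i^ε X_i^{-ε}` by `σ_i^{ε/2}(γ_i)`, and `P` by `σ_i^{ε/2}(t_iγ_i)`. Their
-- quotient is the required scalar, because the first is a unit on each weight space.
theorem Line.untwistOp_untwistOp (i : Fin n) (ε : ℤˣ) (v : P) :
    L.untwistOp P i ε (L.untwistOp P i (-ε) v) = (σ i ^ (ε : ℤ)) (t i) • v := by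
  refine DFunLike.congr_fun (f := L.untwistOp P i ε * L.untwistOp P i (-ε))
    (g := Module.toAddMonoidEnd R P ((σ i ^ (ε : ℤ)) (t i)))
    (P.hom_ext fun m hm v hv => ?_) v
  change L.untwistOp P i ε (L.untwistOp P i (-ε) v) = (σ i ^ (ε : ℤ)) (t i) • v
  have hd : degree [(i, ε), (i, -ε)] = 0 := by simp [Pi.single_neg]
  have hT := L.untwistOp_isSkew P
  have hk : opWord L.obj.op [(i, ε), (i, -ε)] (L.vec m) =
      (σ i ^ (ε : ℤ)) (γ i) • L.vec (translate σ (degree [(i, ε), (i, -ε)]) m) := by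
    rw [hd, translate_zero, opWord_cons, opWord_cons, opWord_nil, L.obj.op_op]
  have h := (L.isTwist_untwistOp hσ P).opWord hσ hO hT P.isSkew hm hv _ hk
  have hk0 : (σ i ^ (ε : ℤ)) (γ i) ∉ m.asIdeal := by
    intro h0
    refine L.obj.opWord_ne_zero hσ hO hγ hm (L.isLineBasis.mem m hm) (L.isLineBasis.ne_zero m hm)
      [(i, ε), (i, -ε)] ?_
    rw [hk, hd, translate_zero, mem_weightSpace.1 (L.isLineBasis.mem m hm) _ h0]
  have hmem := hT.opWord_mem hσ [(i, ε), (i, -ε)] hv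
  rw [hd, translate_zero] at hmem
  simp only [opWord_cons, opWord_nil, LinearEquiv.refl_apply, P.op_op] at h hmem
  refine eq_of_smul_eq_smul hmem (Submodule.smul_mem _ _ hv) hk0 ?_
  have e : (σ i ^ (ε : ℤ)) (s i) = (σ i ^ (ε : ℤ)) (γ i) * (σ i ^ (ε : ℤ)) (t i) := by
    rw [hs, Pi.mul_apply, map_mul, mul_comm]
  rw [← h, smul_smul, e]

include hσ hO hγ in
-- Both orders of the two letters act on `e_m` by the same invertible scalar, so commutation in `P`
-- passes to the quotients.
theorem Line.untwistOp_comm {i j : Fin n} (hij : i ≠ j) (ε : ℤˣ) (v : P) :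
    L.untwistOp P i ε (L.untwistOp P j (-ε) v) = L.untwistOp P j (-ε) (L.untwistOp P i ε v) := by
  refine DFunLike.congr_fun (f := L.untwistOp P i ε * L.untwistOp P j (-ε))
    (g := L.untwistOp P j (-ε) * L.untwistOp P i ε) (P.hom_ext fun m hm v hv => ?_) v
  change L.untwistOp P i ε (L.untwistOp P j (-ε) v) = L.untwistOp P j (-ε) (L.untwistOp P i ε v)
  have hd : degree [(i, ε), (j, -ε)] = degree [(j, -ε), (i, ε)] := by simp [add_comm]
  have hT := L.untwistOp_isSkew P
  have hm' := hO.translate_mem hσ hm (degree [(i, ε), (j, -ε)])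
  obtain ⟨k, hk0, hk⟩ := L.isLineBasis.exists_eq_smul hm'
    (L.obj.isSkew.opWord_mem hσ [(i, ε), (j, -ε)] (L.isLineBasis.mem m hm))
    (L.obj.opWord_ne_zero hσ hO hγ hm (L.isLineBasis.mem m hm) (L.isLineBasis.ne_zero m hm) _)
  have hk' : opWord L.obj.op [(j, -ε), (i, ε)] (L.vec m) =
      k • L.vec (translate σ (degree [(j, -ε), (i, ε)]) m) := by
    rw [← hd, ← hk]
    simp only [opWord_cons, opWord_nil, L.obj.op_comm hij]
  have h := (L.isTwist_untwistOp hσ P).opWord hσ hO hT P.isSkew hm hv _ hk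
  have h' := (L.isTwist_untwistOp hσ P).opWord hσ hO hT P.isSkew hm hv _ hk'
  have hmem := hT.opWord_mem hσ [(i, ε), (j, -ε)] hv
  have hmem' := hT.opWord_mem hσ [(j, -ε), (i, ε)] hv
  rw [← hd] at hmem'
  refine eq_of_smul_eq_smul (k := k) (m := translate σ (degree [(i, ε), (j, -ε)]) m)
    (by simpa using hmem) (by simpa using hmem') hk0 ?_
  simp only [opWord_cons, opWord_nil, LinearEquiv.refl_apply] at h h'
  rw [← h, ← h', P.op_comm hij]

/-- The action of `Ã(t)` on a module over `A(tγ)`, through the untwisted operators. -/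
noncomputable def Line.untwistHom : Constr σ t →+* AddMonoid.End P :=
  opHom t (L.untwistOp P) (L.untwistOp_isSkew P)
    (L.untwistOp_untwistOp hσ hO hγ hs P)
    (fun _ _ hij => L.untwistOp_comm hσ hO hγ P hij)

theorem Line.untwistHom_word (w : List (Fin n × ℤˣ)) :
    L.untwistHom hσ hO hγ hs P (word σ t w) = opWord (L.untwistOp P) w := by
  rw [map_word_apply]
  congr 1
  funext i ε
  exact opHom_X i ε

/-- A relation `∑ r_w c_{wu}(t) = 0` would be one for `tγ` with coefficients `r_w / c_{wu}(γ)`. With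
denominators cleared it acts by zero on `P`; expressed in the untwisted operators, it is the wanted
sum times `(∏ c_{wu}(γ)) l`, which is a unit on the target weight space. -/
theorem Line.untwistHom_isTorsion [IsDomain R] (ht : Consistent σ t) (hs' : ∀ i, s i ≠ 0)
    (a : Constr σ t) (ha : Constr.IsTorsion σ t a) : L.untwistHom hσ hO hγ hs P a = 0 := by
  refine map_isTorsion_eq_zero hσ ht (L.untwistHom hσ hO hγ hs P).toAddMonoidHom
    (fun g u F r hF hu hsum => P.hom_ext fun m hm v hv => ?_) a ha
  have hT := L.untwistOp_isSkew P
  have e : (∑ w ∈ F, L.untwistHom hσ hO hγ hs P (Constr.coeff σ t (r w) * word σ t w)) v =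
      ∑ w ∈ F, r w • opWord (L.untwistOp P) w v := by
    rw [end_sum_apply]
    refine Finset.sum_congr rfl fun w _ => ?_
    rw [map_mul, end_mul_apply, L.untwistHom_word]
    exact opHom_coeff _ _
  refine e.trans ?_
  obtain ⟨l, hl, htw⟩ := L.exists_twist hσ hO hγ (L.isTwist_untwistOp hσ P) hT P.isSkew hm hu
  obtain ⟨q, hq⟩ := exists_common_multiple F r fun w => monomial σ (w ++ u) γ
  have hm' := hO.translate_mem hσ hm g
  have h := P.sum_smul_opWord_eq_zero hσ hs' F q hF hu (by
    rw [← mul_zero (∏ w ∈ F, monomial σ (w ++ u) γ), ← hsum, Finset.mul_sum]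
    refine Finset.sum_congr rfl fun w hw => ?_
    rw [hs, map_mul, mul_left_comm, hq w hw]; ring) v
  have hprime := (translate σ g m).isMaximal.isPrime
  refine eq_zero_of_smul_eq_zero (m := translate σ g m)
    (r := (∏ w ∈ F, monomial σ (w ++ u) γ) * l)
    (Submodule.sum_mem _ fun w hw => Submodule.smul_mem _ _ ?_) ?_ ?_
  · rw [← hF w hw]
    exact hT.opWord_mem hσ w hv
  · intro h0
    rcases hprime.mem_or_mem h0 with h0 | h0
    · obtain ⟨w, -, hw⟩ := (hprime.prod_mem_iff).1 h0
      exact monomial_notMem hσ hO hγ _ hm' hw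
    · exact hl h0
  · rw [← h, Finset.smul_sum]
    refine Finset.sum_congr rfl fun w hw => ?_
    have := htw w (hF w hw) v hv
    rw [LinearEquiv.refl_apply, LinearEquiv.refl_apply] at this
    rw [this, smul_smul, smul_smul, ← mul_assoc (q w), hq w hw]
    congr 1; ring

/-- The inverse of tensoring with the line `L`. -/
noncomputable def Line.untwist [IsDomain R] (ht : Consistent σ t) (hs' : ∀ i, s i ≠ 0) :
    WMod σ O t :=
  WMod.ofHom (L.untwistHom hσ hO hγ hs P) (fun _ _ => opHom_coeff _ _)
    (L.untwistHom_isTorsion hσ hO hγ hs P ht hs') P.iSup_weightSpace P.finite P.support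

theorem Line.untwist_op [IsDomain R] (ht : Consistent σ t) (hs' : ∀ i, s i ≠ 0) (i : Fin n)
    (ε : ℤˣ) (v : P) :
    (L.untwist hσ hO hγ hs P ht hs').op i ε v = L.untwistOp P i ε v :=
  (WMod.ofHom_hom _ _).trans (DFunLike.congr_fun (opHom_X i ε) v)

end Untwist

end Untwist

end TGWA

/-! ### Admissibility under twists. -/

namespace TGWA

section Admissible

variable {R : Type u} [CommRing R] [IsDomain R] {n : ℕ} {σ : Fin n → RingAut R}
  {O : Set (MaximalSpectrum R)} {s s₁ s₂ t t₁ t₂ γ₁ γ₂ : Fin n → R}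

/-! ### Admissibility and twists -/

/-- On `P ⊗ Q` a word `w` acts as `c_{wu}(γ₁γ₂) l₁ l₂` times its action on `M ⊗ N`. A relation for
`s` with coefficients `r_w` is thus one for `t` with coefficients `r_w c_{wu}(γ₁γ₂)`. -/
theorem tensorActs_of_isTwist (hσ : ∀ i j, Commute (σ i) (σ j)) (hO : IsOrbit σ O)
    (hγ₁ : γ₁ ∈ OmegaUnits σ O) (hγ₂ : γ₂ ∈ OmegaUnits σ O) (L₁ : Line σ O γ₁) (L₂ : Line σ O γ₂)
    {M : WMod σ O t₁} {N : WMod σ O t₂} {P : WMod σ O s₁} {Q : WMod σ O s₂} (ht : t = t₁ * t₂)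
    (hs : s = s₁ * s₂) (hst : s = t * (γ₁ * γ₂)) {ψ₁ : M ≃ₗ[R] P} {ψ₂ : N ≃ₗ[R] Q}
    (h₁ : L₁.IsTwist M.op P.op ψ₁) (h₂ : L₂.IsTwist N.op Q.op ψ₂) (hs' : Consistent σ s)
    (ht' : ∀ i, t i ≠ 0) (h : TensorActs ht M N) : TensorActs hs P Q := by
  refine tensorActs_of_forall hσ hs hs' P Q fun g u F r hF hu hsum m hm x hx y hy => ?_
  obtain ⟨x, rfl⟩ := ψ₁.surjective x
  obtain ⟨y, rfl⟩ := ψ₂.surjective y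
  have hx' : x ∈ weightSpace (M : Type u) m := by
    simpa using map_mem_weightSpace ψ₁.symm.toLinearMap hx
  have hy' : y ∈ weightSpace (N : Type u) m := by
    simpa using map_mem_weightSpace ψ₂.symm.toLinearMap hy
  obtain ⟨l₁, -, e₁⟩ := L₁.exists_twist hσ hO hγ₁ h₁ M.isSkew P.isSkew hm hu
  obtain ⟨l₂, -, e₂⟩ := L₂.exists_twist hσ hO hγ₂ h₂ N.isSkew Q.isSkew hm hu
  have hz := (tensorObj h).sum_smul_opWord_eq_zero hσ ht' F
    (fun w => r w * monomial σ (w ++ u) (γ₁ * γ₂)) hF hu (by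
      rw [← hsum]
      refine Finset.sum_congr rfl fun w _ => ?_
      rw [hst, map_mul _ t]; ring) (tmulObj h x y)
  have hz' : ∑ w ∈ F, (r w * monomial σ (w ++ u) (γ₁ * γ₂)) •
      (opWord M.op w x ⊗ₜ[R] opWord N.op w y) = 0 := by
    simp only [tensorObj_opWord_tmulObj] at hz
    exact hz
  have hz'' := congrArg (fun z => (l₁ * l₂) • TensorProduct.congr ψ₁ ψ₂ z) hz'
  simp only [map_sum, map_smul, TensorProduct.congr_tmul, map_zero, smul_zero,
    Finset.smul_sum, smul_smul] at hz''
  rw [← hz'']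
  refine Finset.sum_congr rfl fun w hw => ?_
  rw [e₁ w (hF w hw) x hx', e₂ w (hF w hw) y hy', TensorProduct.smul_tmul_smul, smul_smul, map_mul]
  congr 1; ring

/-- Here the coefficients have to be divided by `c_{wu}(γ₁γ₂)`. Denominators are cleared, and the
resulting common factor is cancelled because all terms have weight `g(m)`, where it is a unit. -/
theorem tensorActs_of_isTwist_symm (hσ : ∀ i j, Commute (σ i) (σ j)) (hO : IsOrbit σ O)
    (hγ₁ : γ₁ ∈ OmegaUnits σ O) (hγ₂ : γ₂ ∈ OmegaUnits σ O) (L₁ : Line σ O γ₁) (L₂ : Line σ O γ₂)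
    {M : WMod σ O t₁} {N : WMod σ O t₂} {P : WMod σ O s₁} {Q : WMod σ O s₂} (ht : t = t₁ * t₂)
    (hs : s = s₁ * s₂) (hst : s = t * (γ₁ * γ₂)) {ψ₁ : M ≃ₗ[R] P} {ψ₂ : N ≃ₗ[R] Q}
    (h₁ : L₁.IsTwist M.op P.op ψ₁) (h₂ : L₂.IsTwist N.op Q.op ψ₂) (ht' : Consistent σ t)
    (hs' : ∀ i, s i ≠ 0) (h : TensorActs hs P Q) : TensorActs ht M N := by
  refine tensorActs_of_forall hσ ht ht' M N fun g u F r hF hu hsum m hm x hx y hy => ?_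
  obtain ⟨l₁, hl₁, e₁⟩ := L₁.exists_twist hσ hO hγ₁ h₁ M.isSkew P.isSkew hm hu
  obtain ⟨l₂, hl₂, e₂⟩ := L₂.exists_twist hσ hO hγ₂ h₂ N.isSkew Q.isSkew hm hu
  obtain ⟨q, hq⟩ := exists_common_multiple F r fun w => monomial σ (w ++ u) (γ₁ * γ₂)
  have hm' := hO.translate_mem hσ hm g
  have hprime := (translate σ g m).isMaximal.isPrime
  have hz := (tensorObj h).sum_smul_opWord_eq_zero hσ hs' F q hF hu (by
    rw [← mul_zero (∏ w ∈ F, monomial σ (w ++ u) (γ₁ * γ₂)), ← hsum, Finset.mul_sum]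
    refine Finset.sum_congr rfl fun w hw => ?_
    rw [hst, map_mul, mul_left_comm, hq w hw]; ring) (tmulObj h (ψ₁ x) (ψ₂ y))
  have hz' : ∑ w ∈ F, q w • (opWord P.op w (ψ₁ x) ⊗ₜ[R] opWord Q.op w (ψ₂ y)) = 0 := by
    simp only [tensorObj_opWord_tmulObj] at hz
    exact hz
  refine eq_zero_of_smul_eq_zero (m := translate σ g m)
    (r := (∏ w ∈ F, monomial σ (w ++ u) (γ₁ * γ₂)) * (l₁ * l₂))
    (Submodule.sum_mem _ fun w hw => Submodule.smul_mem _ _ (tmul_mem_weightSpace ?_ _)) ?_ ?_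
  · rw [← hF w hw]
    exact M.isSkew.opWord_mem hσ w hx
  · intro h0
    rcases hprime.mem_or_mem h0 with h0 | h0
    · obtain ⟨w, -, hw⟩ := (hprime.prod_mem_iff).1 h0
      rw [map_mul] at hw
      exact (hprime.mem_or_mem hw).elim (monomial_notMem hσ hO hγ₁ _ hm')
        (monomial_notMem hσ hO hγ₂ _ hm')
    · exact (hprime.mem_or_mem h0).elim hl₁ hl₂
  · refine (TensorProduct.congr ψ₁ ψ₂).injective ?_
    rw [map_zero, ← hz', Finset.smul_sum, map_sum]
    refine Finset.sum_congr rfl fun w hw => ?_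
    rw [e₁ w (hF w hw) x hx, e₂ w (hF w hw) y hy, TensorProduct.smul_tmul_smul, smul_smul,
      smul_smul, map_smul, TensorProduct.congr_tmul]
    congr 1
    have := hq w hw
    rw [map_mul] at this
    linear_combination (-l₁ * l₂) * this

end Admissible

/-! ### Grothendieck groups under twists. -/

section Equivalence

variable {R : Type u} [CommRing R] {n : ℕ} {σ : Fin n → RingAut R}
  {O : Set (MaximalSpectrum R)} {s t γ : Fin n → R}

/-! ### Tensoring with a line on Grothendieck groups -/

/-- The zero object. -/
def WMod.zero (σ : Fin n → RingAut R) (O : Set (MaximalSpectrum R)) (t : Fin n → R) :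
    WMod σ O t where
  carrier := PUnit
  coeff_smul _ _ := rfl
  iSup_weightSpace := Subsingleton.elim _ _
  finite _ := ⟨⟨∅, Subsingleton.elim _ _⟩⟩
  support _ _ := Subsingleton.elim _ _

theorem K0.cls_zero (κ : Kind) : K0.cls κ (WMod.zero σ O t) = 0 := by
  have h : IsExtension κ (WMod.zero σ O t) (WMod.zero σ O t) (WMod.zero σ O t) := by
    have : Subsingleton (WMod.zero σ O t : Type u) := inferInstanceAs (Subsingleton PUnit)
    cases κ with
    | ordinary =>
      exact ⟨0, 0, fun _ _ _ => Subsingleton.elim _ _,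
        fun x => ⟨fun _ => ⟨0, Subsingleton.elim _ _⟩, fun _ => rfl⟩,
        fun x => ⟨0, Subsingleton.elim _ _⟩⟩
    | split => exact ⟨LinearEquiv.ofLinearMap 0 0 (Subsingleton.elim _ _) (Subsingleton.elim _ _)⟩
  simpa using K0.cls_add κ h

/-- An isomorphism exhibits `M` as an extension of the zero object by `N`, and the zero object has
class zero. -/
theorem K0.cls_congr (κ : Kind) {M N : WMod σ O t} (e : M ≃ₗ[Alg σ t] N) :
    K0.cls κ M = K0.cls κ N := by
  have h : IsExtension κ N M (WMod.zero σ O t) := by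
    have : Subsingleton (WMod.zero σ O t : Type u) := inferInstanceAs (Subsingleton PUnit)
    cases κ with
    | ordinary =>
      exact ⟨e.symm.toLinearMap, 0, e.symm.injective,
        fun x => ⟨fun _ => ⟨e x, e.symm_apply_apply x⟩, fun _ => rfl⟩,
        fun x => ⟨0, Subsingleton.elim _ _⟩⟩
    | split =>
      exact isExtension_split_iff.2 ⟨e.toLinearMap, 0, e.symm.toLinearMap, 0, e.apply_symm_apply,
        fun _ => rfl, fun _ => map_zero e, fun _ => Subsingleton.elim _ _,
        fun x => (add_zero _).trans (e.symm_apply_apply x)⟩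
  rw [K0.cls_add κ h, K0.cls_zero, add_zero]

theorem K0.induction {κ : Kind} {p : K0 κ σ O t → Prop} (cls : ∀ M, p (K0.cls κ M))
    (add : ∀ x y, p x → p y → p (x + y)) (neg : ∀ x, p x → p (-x)) (zero : p 0)
    (x : K0 κ σ O t) : p x := by
  obtain ⟨x, rfl⟩ := QuotientAddGroup.mk_surjective x
  induction x using FreeAbelianGroup.induction_on with
  | zero => exact zero
  | of M => exact cls M
  | neg M h => exact neg _ h
  | add x y hx hy => exact add _ _ hx hy

variable [IsDomain R] (hσ : ∀ i j, Commute (σ i) (σ j)) (hO : IsOrbit σ O)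
  (hγ : γ ∈ OmegaUnits σ O) (L : Line σ O γ) (hs : s = t * γ) (ht' : t ∈ Omega σ) (hs' : s ∈ Omega σ)

/-- The functor from modules over `A(tγ)` to modules over `A(t)` on morphisms. -/
noncomputable def Line.untwistMap {P Q : WMod σ O s} (f : P →ₗ[Alg σ s] Q) :
    L.untwist hσ hO hγ hs P ht'.2 hs'.1 →ₗ[Alg σ t] L.untwist hσ hO hγ hs Q ht'.2 hs'.1 :=
  linearMapOfOp _ _ (toRLinear (M := P) (N := Q) f) fun i ε (v : P) => by
    refine ((congrArg f (L.untwist_op hσ hO hγ hs P ht'.2 hs'.1 i ε v)).trans ?_).trans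
      (L.untwist_op hσ hO hγ hs Q ht'.2 hs'.1 i ε (f v)).symm
    rw [L.untwistOp_apply, L.untwistOp_apply, linearMap_op]
    exact congrArg _ (map_scaleWeights P.iSup_weightSpace Q.iSup_weightSpace _ (toRLinear f) v)

/-- Untwisting changes neither the underlying groups nor the underlying maps, so exactness and
splitting identities carry over verbatim. -/
theorem Line.isExtension_untwist {κ : Kind} {M P N : WMod σ O s} (h : IsExtension κ M P N) :
    IsExtension κ (L.untwist hσ hO hγ hs M ht'.2 hs'.1) (L.untwist hσ hO hγ hs P ht'.2 hs'.1)
      (L.untwist hσ hO hγ hs N ht'.2 hs'.1) := by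
  cases κ with
  | ordinary =>
    obtain ⟨f, g, hf, hfg, hg⟩ := h
    exact ⟨L.untwistMap hσ hO hγ hs ht' hs' f, L.untwistMap hσ hO hγ hs ht' hs' g, hf, hfg, hg⟩
  | split =>
    obtain ⟨p₁, p₂, i₁, i₂, h11, h21, h12, h22, h⟩ := isExtension_split_iff.1 h
    exact isExtension_split_iff.2 ⟨L.untwistMap hσ hO hγ hs ht' hs' p₁,
      L.untwistMap hσ hO hγ hs ht' hs' p₂, L.untwistMap hσ hO hγ hs ht' hs' i₁,
      L.untwistMap hσ hO hγ hs ht' hs' i₂, h11, h21, h12, h22, h⟩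

include hσ hO hγ ht' hs' in
theorem Line.tensorActs (M : WMod σ O t) : TensorActs hs M L.obj :=
  tensorActs_of_units hσ hO hγ hs hs'.2 ht'.1 M L.obj

/-- `M` is recovered from `M ⊗_R L`. -/
noncomputable def Line.untwistTensor (M : WMod σ O t) :
    M ≃ₗ[Alg σ t] L.untwist hσ hO hγ hs
      (tensorObj (L.tensorActs hσ hO hγ hs ht' hs' M)) ht'.2 hs'.1 :=
  linearEquivOfOp _ _ (L.thetaObj (L.tensorActs hσ hO hγ hs ht' hs' M)) fun i ε v => by
    let h := L.tensorActs hσ hO hγ hs ht' hs' M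
    refine Eq.trans ?_ (L.untwist_op hσ hO hγ hs (tensorObj h) ht'.2 hs'.1 i ε
      (L.thetaObj h v)).symm
    refine DFunLike.congr_fun (f := (L.thetaObj h).toAddMonoidHom.comp (M.op i ε))
      (g := (L.untwistOp (tensorObj h) i ε).comp (L.thetaObj h).toAddMonoidHom)
      (M.hom_ext fun m hm v hv => ?_) v
    change L.thetaObj h (M.op i ε v) = L.untwistOp (tensorObj h) i ε (L.thetaObj h v)
    have hv' : L.thetaObj h v ∈ weightSpace (tensorObj h : Type u) m :=
      map_mem_weightSpace (L.thetaObj h).toLinearMap hv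
    rw [L.untwistOp_apply, scaleWeights_apply _ _ hv', (tensorObj h).isSkew,
      L.isTwist_thetaObj hσ hO h i ε m hm v hv, smul_smul]
    -- The scalars of `L` and their chosen inverses cancel modulo the ideal of the target weight.
    refine ((smul_eq_of_sub_mem ?_ (L.inv i ε m hm)).trans (one_smul R _)).symm
    exact map_mem_weightSpace (L.thetaObj h).toLinearMap (M.isSkew.op_mem hσ i ε hv)

/-- Tensoring with `L` after dividing by `L` is the identity. -/
noncomputable def Line.tensorUntwist (P : WMod σ O s) :
    P ≃ₗ[Alg σ s] tensorObj (L.tensorActs hσ hO hγ hs ht' hs'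
      (L.untwist hσ hO hγ hs P ht'.2 hs'.1)) :=
  linearEquivOfOp _ _ (L.thetaObj (L.tensorActs hσ hO hγ hs ht' hs'
      (L.untwist hσ hO hγ hs P ht'.2 hs'.1))) fun i ε v => by
    let M := L.untwist hσ hO hγ hs P ht'.2 hs'.1
    let h := L.tensorActs hσ hO hγ hs ht' hs' M
    let θ : P →+ tensorObj h := (L.thetaObj h).toAddMonoidHom
    refine DFunLike.congr_fun (f := θ.comp (P.op i ε)) (g := ((tensorObj h).op i ε).comp θ)
      (P.hom_ext fun m hm v hv => ?_) v
    change L.thetaObj h (P.op i ε v) = (tensorObj h).op i ε (L.thetaObj h v)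
    rw [← L.smul_untwistOp hσ P i ε hm hv]
    refine Eq.trans ?_ (L.isTwist_thetaObj hσ hO h i ε m hm v hv).symm
    have e : M.op i ε v = L.untwistOp P i ε v := L.untwist_op hσ hO hγ hs P ht'.2 hs'.1 i ε v
    rw [e]
    exact map_smul (L.thetaObj h) _ _

/-- Tensoring with the line `L`, as a map of Grothendieck groups. -/
noncomputable def Line.k0Hom (κ : Kind) : K0 κ σ O t →+ K0 κ σ O s :=
  K0.lift κ (fun M => K0.cls κ (tensorObj (L.tensorActs hσ hO hγ hs ht' hs' M)))
    fun _ _ _ h => K0.cls_add κ (isExtension_tensor_left L.obj _ _ _ h)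

theorem Line.k0Hom_cls (κ : Kind) (M : WMod σ O t) :
    L.k0Hom hσ hO hγ hs ht' hs' κ (K0.cls κ M) =
      K0.cls κ (tensorObj (L.tensorActs hσ hO hγ hs ht' hs' M)) := by
  rw [k0Hom, K0.lift_cls]

/-- Tensoring with the line `L`, as an isomorphism of Grothendieck groups. -/
noncomputable def Line.k0Equiv (κ : Kind) : K0 κ σ O t ≃+ K0 κ σ O s :=
  AddMonoidHom.toAddEquiv (L.k0Hom hσ hO hγ hs ht' hs' κ)
    (K0.lift κ (fun P => K0.cls κ (L.untwist hσ hO hγ hs P ht'.2 hs'.1))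
      fun _ _ _ h => K0.cls_add κ (L.isExtension_untwist hσ hO hγ hs ht' hs' h))
    (K0.hom_ext κ fun M => by
      rw [AddMonoidHom.comp_apply, L.k0Hom_cls, K0.lift_cls, AddMonoidHom.id_apply]
      exact (K0.cls_congr κ (L.untwistTensor hσ hO hγ hs ht' hs' M)).symm)
    (K0.hom_ext κ fun P => by
      rw [AddMonoidHom.comp_apply, K0.lift_cls, L.k0Hom_cls, AddMonoidHom.id_apply]
      exact (K0.cls_congr κ (L.tensorUntwist hσ hO hγ hs ht' hs' P)).symm)

theorem Line.k0Equiv_cls (κ : Kind) (M : WMod σ O t) :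
    L.k0Equiv hσ hO hγ hs ht' hs' κ (K0.cls κ M) =
      K0.cls κ (tensorObj (L.tensorActs hσ hO hγ hs ht' hs' M)) :=
  L.k0Hom_cls hσ hO hγ hs ht' hs' κ M

end Equivalence

end TGWA

/-! ### Twists and products. -/

namespace TGWA

section Multiplicativity

variable {R : Type u} [CommRing R] {n : ℕ} {σ : Fin n → RingAut R}
  {O : Set (MaximalSpectrum R)} {s s₁ s₂ t t₁ t₂ γ₁ γ₂ γ₃ : Fin n → R}

/-! ### Compatibility with products -/

theorem tensorObj_induction {hs : s = t₁ * t₂} {M : WMod σ O t₁} {N : WMod σ O t₂}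
    {h : TensorActs hs M N} {p : tensorObj h → Prop} (zero : p 0)
    (add : ∀ x y, p x → p y → p (x + y)) (tmul : ∀ x y, p (tmulObj h x y)) (v : tensorObj h) :
    p v :=
  TensorProduct.induction_on (motive := p) v zero tmul add

/-- Isomorphisms of the factors induce an isomorphism of tensor products. -/
noncomputable def tensorEquiv {hs : s = t₁ * t₂} {M M' : WMod σ O t₁} {N N' : WMod σ O t₂}
    (h : TensorActs hs M N) (h' : TensorActs hs M' N') (e : M ≃ₗ[Alg σ t₁] M')
    (f : N ≃ₗ[Alg σ t₂] N') : tensorObj h ≃ₗ[Alg σ s] tensorObj h' :=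
  { tensorMap h h' e.toLinearMap f.toLinearMap with
    invFun := tensorMap h' h e.symm.toLinearMap f.symm.toLinearMap
    left_inv := fun x => by
      refine (tensorMap_tensorMap h h' h _ _ _ _ x).trans ?_
      rw [LinearEquiv.symm_comp, LinearEquiv.symm_comp]
      exact tensorMap_id h x
    right_inv := fun x => by
      refine (tensorMap_tensorMap h' h h' _ _ _ _ x).trans ?_
      rw [LinearEquiv.comp_symm, LinearEquiv.comp_symm]
      exact tensorMap_id h' x }

/-- `(M ⊗ N) ⊗ (P ⊗ Q) ≅ (M ⊗ P) ⊗ (N ⊗ Q)`. -/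
noncomputable def tensorTensorEquiv {hs : s = t * γ₃} {ht : t = t₁ * t₂} {hγ : γ₃ = γ₁ * γ₂}
    {hs' : s = s₁ * s₂} {h₁ : s₁ = t₁ * γ₁} {h₂ : s₂ = t₂ * γ₂} {M : WMod σ O t₁} {N : WMod σ O t₂}
    {P : WMod σ O γ₁} {Q : WMod σ O γ₂} {hMN : TensorActs ht M N} {hPQ : TensorActs hγ P Q}
    {hMP : TensorActs h₁ M P} {hNQ : TensorActs h₂ N Q}
    (h : TensorActs hs (tensorObj hMN) (tensorObj hPQ))
    (h' : TensorActs hs' (tensorObj hMP) (tensorObj hNQ)) :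
    tensorObj h ≃ₗ[Alg σ s] tensorObj h' :=
  linearEquivOfOp (tensorObj h) (tensorObj h')
    (TensorProduct.tensorTensorTensorComm R M N P Q) fun i ε v => by
    let f : tensorObj h ≃ₗ[R] tensorObj h' := TensorProduct.tensorTensorTensorComm R M N P Q
    have hf (x : M) (y : N) (z : P) (w : Q) :
        f (tmulObj h (tmulObj hMN x y) (tmulObj hPQ z w)) =
          tmulObj h' (tmulObj hMP x z) (tmulObj hNQ y w) := rfl
    change f ((tensorObj h).op i ε v) = (tensorObj h').op i ε (f v)
    induction v using tensorObj_induction with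
    | zero => simp only [map_zero]
    | add x y hx hy => simp only [map_add, hx, hy]
    | tmul a b =>
      induction a using tensorObj_induction with
      | zero =>
        have e : tmulObj h 0 b = 0 := TensorProduct.zero_tmul _ b
        simp only [e, map_zero]
      | add x y hx hy =>
        have e : tmulObj h (x + y) b = tmulObj h x b + tmulObj h y b :=
          TensorProduct.add_tmul x y b
        simp only [e, map_add, hx, hy]
      | tmul x y =>
        induction b using tensorObj_induction with
        | zero =>
          have e : tmulObj h (tmulObj hMN x y) 0 = 0 := TensorProduct.tmul_zero _ _
          simp only [e, map_zero]
        | add z w hz hw =>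
          have e : tmulObj h (tmulObj hMN x y) (z + w) =
              tmulObj h (tmulObj hMN x y) z + tmulObj h (tmulObj hMN x y) w :=
            TensorProduct.tmul_add _ z w
          simp only [e, map_add, hz, hw]
        | tmul z w =>
          rw [tensorObj_op_tmulObj, tensorObj_op_tmulObj, tensorObj_op_tmulObj, hf, hf,
            tensorObj_op_tmulObj, tensorObj_op_tmulObj, tensorObj_op_tmulObj]

/-- The `R`-isomorphism `L₁ ≅ L₁ ⊗ L₂` sends basis vectors to these tensors. It follows that the
tensor product of two lines is simple. -/
theorem Line.isLineBasis_tensor (L₁ : Line σ O γ₁) (L₂ : Line σ O γ₂) {hγ : γ₃ = γ₁ * γ₂}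
    (h : TensorActs hγ L₁.obj L₂.obj) :
    IsLineBasis (tensorObj h) fun m => tmulObj h (L₁.vec m) (L₂.vec m) where
  mem m hm := tmulObj_mem h (L₁.isLineBasis.mem m hm) _
  ne_zero m hm h0 := by
    rw [← L₂.thetaObj_apply h hm (L₁.isLineBasis.mem m hm), LinearEquiv.map_eq_zero_iff] at h0
    exact L₁.isLineBasis.ne_zero m hm h0
  exists_smul m hm v hv := by
    obtain ⟨v, rfl⟩ := (L₂.thetaObj h).surjective v
    have hv' : v ∈ weightSpace (L₁.obj : Type u) m := by
      simpa using map_mem_weightSpace (L₂.thetaObj h).symm.toLinearMap hv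
    obtain ⟨r, rfl⟩ := L₁.isLineBasis.exists_smul m hm v hv'
    exact ⟨r, by rw [map_smul, L₂.thetaObj_apply h hm (L₁.isLineBasis.mem m hm)]⟩

variable [IsDomain R] (hσ : ∀ i j, Commute (σ i) (σ j))

/-- The identity as an `R`-linear isomorphism from the untwisted module. -/
def Line.untwistEquiv (hO : IsOrbit σ O) (hγ₁ : γ₁ ∈ OmegaUnits σ O) (L₁ : Line σ O γ₁)
    (h₁ : s₁ = t₁ * γ₁) (ht₁ : t₁ ∈ Omega σ) (hs₁ : s₁ ∈ Omega σ) (P : WMod σ O s₁) :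
    L₁.untwist hσ hO hγ₁ h₁ P ht₁.2 hs₁.1 ≃ₗ[R] P := LinearEquiv.refl R P

theorem Line.isTwist_untwist (hO : IsOrbit σ O) (hγ₁ : γ₁ ∈ OmegaUnits σ O) (L₁ : Line σ O γ₁)
    (h₁ : s₁ = t₁ * γ₁) (ht₁ : t₁ ∈ Omega σ) (hs₁ : s₁ ∈ Omega σ) (P : WMod σ O s₁) :
    L₁.IsTwist (L₁.untwist hσ hO hγ₁ h₁ P ht₁.2 hs₁.1).op P.op
      (L₁.untwistEquiv hσ hO hγ₁ h₁ ht₁ hs₁ P) := fun i ε m hm (v : P) hv =>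
  (L₁.smul_untwistOp hσ P i ε hm hv).symm.trans
    (congrArg (L₁.κ i ε m • ·) (L₁.untwist_op hσ hO hγ₁ h₁ P ht₁.2 hs₁.1 i ε v).symm)

variable (hO : IsTorsionFreeOrbit σ O)
  (hγ₁ : γ₁ ∈ OmegaUnits σ O) (hγ₂ : γ₂ ∈ OmegaUnits σ O) (hγ₃ : γ₃ ∈ OmegaUnits σ O)
  (L₁ : Line σ O γ₁) (L₂ : Line σ O γ₂) (L₃ : Line σ O γ₃)
  (hs : s = t * γ₃) (ht : t = t₁ * t₂) (hγ : γ₃ = γ₁ * γ₂) (hs' : s = s₁ * s₂)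
  (h₁ : s₁ = t₁ * γ₁) (h₂ : s₂ = t₂ * γ₂) (hsΩ : s ∈ Omega σ) (htΩ : t ∈ Omega σ)
  (hs₁ : s₁ ∈ Omega σ) (hs₂ : s₂ ∈ Omega σ) (ht₁ : t₁ ∈ Omega σ) (ht₂ : t₂ ∈ Omega σ)

include hσ hO hγ₁ hγ₂ L₁ L₂ hs hγ h₁ h₂ hsΩ htΩ hs₁ hs₂ ht₁ ht₂ in
-- Every pair over `(s₁, s₂)` is a twist of its untwisted pair over `(t₁, t₂)`, and every pair over
-- `(t₁, t₂)` has a twist over `(s₁, s₂)`, by tensoring with the lines.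
theorem tensorDefined_iff : TensorDefined σ O ht ↔ TensorDefined σ O hs' := by
  have hst : s = t * (γ₁ * γ₂) := hγ ▸ hs
  constructor
  · intro h P Q
    exact tensorActs_of_isTwist hσ hO.1 hγ₁ hγ₂ L₁ L₂ ht hs' hst
      (L₁.isTwist_untwist hσ hO.1 hγ₁ h₁ ht₁ hs₁ P) (L₂.isTwist_untwist hσ hO.1 hγ₂ h₂ ht₂ hs₂ Q)
      hsΩ.2 htΩ.1 (h _ _)
  · intro h M N
    exact tensorActs_of_isTwist_symm hσ hO.1 hγ₁ hγ₂ L₁ L₂ ht hs' hst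
      (L₁.isTwist_thetaObj hσ hO.1 (L₁.tensorActs hσ hO.1 hγ₁ h₁ ht₁ hs₁ M))
      (L₂.isTwist_thetaObj hσ hO.1 (L₂.tensorActs hσ hO.1 hγ₂ h₂ ht₂ hs₂ N))
      htΩ.2 hsΩ.1 (h _ _)

include hγ in
-- In admissible degrees this is `(M ⊗ N) ⊗ L₃ ≅ (M ⊗ L₁) ⊗ (N ⊗ L₂)`. In the others both products
-- are zero by convention, since admissibility is invariant.
theorem Line.k0Equiv_mul (κ : Kind) (x : K0 κ σ O t₁) (y : K0 κ σ O t₂) :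
    L₃.k0Equiv hσ hO.1 hγ₃ hs htΩ hsΩ κ (K0.mul κ ht x y) =
      K0.mul κ hs' (L₁.k0Equiv hσ hO.1 hγ₁ h₁ ht₁ hs₁ κ x)
        (L₂.k0Equiv hσ hO.1 hγ₂ h₂ ht₂ hs₂ κ y) := by
  have hiff := tensorDefined_iff hσ hO hγ₁ hγ₂ L₁ L₂ hs ht hγ hs' h₁ h₂ hsΩ htΩ hs₁ hs₂ ht₁ ht₂
  by_cases hdef : TensorDefined σ O ht
  · have hdef' := hiff.1 hdef
    induction x using K0.induction with
    | zero => simp only [map_zero, AddMonoidHom.zero_apply]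
    | add x x' hx hx' => simp only [map_add, AddMonoidHom.add_apply, hx, hx']
    | neg x hx => simp only [map_neg, AddMonoidHom.neg_apply, hx]
    | cls M =>
      induction y using K0.induction with
      | zero => simp only [map_zero]
      | add y y' hy hy' => simp only [map_add, hy, hy']
      | neg y hy => simp only [map_neg, hy]
      | cls N =>
        rw [K0.mul_cls κ hdef, L₁.k0Equiv_cls, L₂.k0Equiv_cls, L₃.k0Equiv_cls, K0.mul_cls κ hdef']
        have hPQ : TensorActs hγ L₁.obj L₂.obj :=
          tensorActs_of_units hσ hO.1 hγ₂ hγ hγ₃.1.2 hγ₁.1.1 _ _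
        -- `L₃` and `L₁ ⊗ L₂` are both simple over `A(γ₃)`, so uniqueness identifies them.
        obtain ⟨f⟩ := nonempty_equiv_of_isSimpleModule hσ hO hγ₃ L₃.obj (tensorObj hPQ)
          (L₃.isLineBasis.isSimpleModule hσ hO.1 hγ₃)
          ((L₁.isLineBasis_tensor L₂ hPQ).isSimpleModule hσ hO.1 hγ₃)
        have h := tensorActs_of_units hσ hO.1 hγ₃ hs hsΩ.2 htΩ.1 (tensorObj (hdef M N))
          (tensorObj hPQ)
        exact K0.cls_congr κ ((tensorEquiv _ h (LinearEquiv.refl _ _) f).trans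
          (tensorTensorEquiv h (hdef' _ _)))
  · rw [K0.mul, K0.mul, dif_neg hdef, dif_neg (fun h => hdef (hiff.2 h))]
    simp only [AddMonoidHom.zero_apply, map_zero]

end Multiplicativity

/-! ### From compatible isomorphisms of components to graded algebras. -/

section Graded

variable {R : Type u} [CommRing R] {n : ℕ} {σ : Fin n → RingAut R}
  {O : Set (MaximalSpectrum R)} {κ : Kind} {Γ Γ₁ Γ₂ : Submonoid (Fin n → R)}

/-! ### Isomorphisms of graded algebras -/

open scoped Classical in
/-- Linear maps on `𝒜(Γ, O)` are given by their restrictions to the components. -/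
noncomputable def GrAlg.lift {W : Type*} [AddCommMonoid W] [Module ℂ W]
    (f : ∀ t : Γ, Component κ σ O Γ (Additive.ofMul t) →ₗ[ℂ] W) : GrAlg κ σ O Γ →ₗ[ℂ] W :=
  DirectSum.toModule ℂ (Additive Γ) W fun t => f t.toMul

theorem GrAlg.lift_of {W : Type*} [AddCommMonoid W] [Module ℂ W]
    (f : ∀ t : Γ, Component κ σ O Γ (Additive.ofMul t) →ₗ[ℂ] W) (t : Γ)
    (x : Component κ σ O Γ (Additive.ofMul t)) :
    GrAlg.lift f (GrAlg.of κ σ O Γ t x) = f t x := by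
  classical
  exact DirectSum.toModule_lof ℂ (φ := fun t : Additive Γ => f t.toMul) (Additive.ofMul t) x

theorem GrAlg.induction {p : GrAlg κ σ O Γ → Prop} (zero : p 0)
    (add : ∀ x y, p x → p y → p (x + y))
    (tmul : ∀ (t : Γ) (c : ℂ) (x : K0 κ σ O (t : Fin n → R)),
      p (GrAlg.of κ σ O Γ t (c ⊗ₜ x))) (a : GrAlg κ σ O Γ) : p a := by
  classical
  refine DirectSum.induction_on (motive := p) a zero (fun t x => ?_) add
  induction x using TensorProduct.induction_on with
  | zero => exact (map_zero (DirectSum.of (Component κ σ O Γ) t)).symm ▸ zero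
  | add x y hx hy => exact (map_add (DirectSum.of (Component κ σ O Γ) t) x y).symm ▸ add _ _ hx hy
  | tmul c x => exact tmul t.toMul c x

theorem GrAlg.of_mul_of (t t' : Γ) (c c' : ℂ) (x : K0 κ σ O (t : Fin n → R))
    (y : K0 κ σ O (t' : Fin n → R)) :
    GrAlg.of κ σ O Γ t (c ⊗ₜ x) * GrAlg.of κ σ O Γ t' (c' ⊗ₜ y) =
      GrAlg.of κ σ O Γ (t * t') ((c * c') ⊗ₜ
        K0.mul κ (rfl : ((t * t' : Γ) : Fin n → R) = t * t') x y) := by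
  classical
  exact DirectSum.of_mul_of (A := Component κ σ O Γ) (i := Additive.ofMul t)
    (j := Additive.ofMul t') (c ⊗ₜ x) (c' ⊗ₜ y)

/-- Compatible isomorphisms of the Grothendieck groups induce an isomorphism of the graded
algebras. -/
theorem GrAlg.exists_equiv (φ : Γ₁ ≃* Γ₂)
    (e : ∀ (t : Γ₁) (s : Γ₂), φ t = s → (K0 κ σ O (t : Fin n → R) ≃+ K0 κ σ O (s : Fin n → R)))
    (he : ∀ (t t' : Γ₁) x y,
      e (t * t') (φ t * φ t') (map_mul φ t t')
          (K0.mul κ (rfl : ((t * t' : Γ₁) : Fin n → R) = t * t') x y) =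
        K0.mul κ (rfl : ((φ t * φ t' : Γ₂) : Fin n → R) = φ t * φ t')
          (e t (φ t) rfl x) (e t' (φ t') rfl y)) :
    ∃ E : GrAlg κ σ O Γ₁ ≃ₗ[ℂ] GrAlg κ σ O Γ₂, (∀ x y, E (x * y) = E x * E y) ∧
      ∀ (t : Γ₁) (c : ℂ) (x : K0 κ σ O (t : Fin n → R)),
        E (GrAlg.of κ σ O Γ₁ t (c ⊗ₜ x)) = GrAlg.of κ σ O Γ₂ (φ t) (c ⊗ₜ e t (φ t) rfl x) := by
  let F : GrAlg κ σ O Γ₁ →ₗ[ℂ] GrAlg κ σ O Γ₂ := GrAlg.lift fun t =>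
    (GrAlg.of κ σ O Γ₂ (φ t)).comp ((e t (φ t) rfl).toAddMonoidHom.toIntLinearMap.baseChange ℂ)
  let G : GrAlg κ σ O Γ₂ →ₗ[ℂ] GrAlg κ σ O Γ₁ := GrAlg.lift fun s =>
    (GrAlg.of κ σ O Γ₁ (φ.symm s)).comp
      ((e (φ.symm s) s (φ.apply_symm_apply s)).symm.toAddMonoidHom.toIntLinearMap.baseChange ℂ)
  have hF (t : Γ₁) (c : ℂ) (x : K0 κ σ O (t : Fin n → R)) :
      F (GrAlg.of κ σ O Γ₁ t (c ⊗ₜ x)) = GrAlg.of κ σ O Γ₂ (φ t) (c ⊗ₜ e t (φ t) rfl x) :=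
    GrAlg.lift_of _ t _
  have hG (s : Γ₂) (c : ℂ) (x : K0 κ σ O (s : Fin n → R)) :
      G (GrAlg.of κ σ O Γ₂ s (c ⊗ₜ x)) = GrAlg.of κ σ O Γ₁ (φ.symm s)
        (c ⊗ₜ (e (φ.symm s) s (φ.apply_symm_apply s)).symm x) :=
    GrAlg.lift_of _ s _
  -- The next three facts absorb the transport between degrees that are equal only propositionally,
  -- such as `φ (φ.symm s)` and `s`, or `φ (t * t')` and `φ t * φ t'`.
  have h1 (t t' : Γ₁) (h : t' = t) (h' : φ t' = φ t) (c : ℂ) (x : K0 κ σ O (t : Fin n → R)) :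
      GrAlg.of κ σ O Γ₁ t' (c ⊗ₜ (e t' (φ t) h').symm (e t (φ t) rfl x)) =
        GrAlg.of κ σ O Γ₁ t (c ⊗ₜ x) := by
    subst h
    rw [AddEquiv.symm_apply_apply]
  have h2 (t : Γ₁) (s : Γ₂) (h : φ t = s) (c : ℂ) (x : K0 κ σ O (s : Fin n → R)) :
      GrAlg.of κ σ O Γ₂ (φ t) (c ⊗ₜ e t (φ t) rfl ((e t s h).symm x)) =
        GrAlg.of κ σ O Γ₂ s (c ⊗ₜ x) := by
    subst h
    rw [AddEquiv.apply_symm_apply]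
  have h3 (t : Γ₁) (s : Γ₂) (h : φ t = s) (c : ℂ) (x : K0 κ σ O (t : Fin n → R)) :
      GrAlg.of κ σ O Γ₂ (φ t) (c ⊗ₜ e t (φ t) rfl x) =
        GrAlg.of κ σ O Γ₂ s (c ⊗ₜ e t s h x) := by
    subst h
    rfl
  have hGF (a : GrAlg κ σ O Γ₁) : G (F a) = a := by
    induction a using GrAlg.induction with
    | zero => rw [map_zero, map_zero]
    | add x y hx hy => rw [map_add, map_add, hx, hy]
    | tmul t c x => rw [hF, hG, h1 t _ (φ.symm_apply_apply t)]
  have hFG (a : GrAlg κ σ O Γ₂) : F (G a) = a := by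
    induction a using GrAlg.induction with
    | zero => rw [map_zero, map_zero]
    | add x y hx hy => rw [map_add, map_add, hx, hy]
    | tmul s c x => rw [hG, hF, h2 _ s (φ.apply_symm_apply s)]
  refine ⟨{ F with invFun := G, left_inv := hGF, right_inv := hFG }, fun a b => ?_, hF⟩
  change F (a * b) = F a * F b
  induction a using GrAlg.induction with
  | zero => rw [zero_mul, map_zero, zero_mul]
  | add x y hx hy => rw [add_mul, map_add, map_add, hx, hy, add_mul]
  | tmul t c x =>
    induction b using GrAlg.induction with
    | zero => rw [mul_zero, map_zero, mul_zero]
    | add x y hx hy => rw [mul_add, map_add, map_add, hx, hy, mul_add]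
    | tmul t' c' y =>
      rw [GrAlg.of_mul_of, hF, hF, hF, GrAlg.of_mul_of, ← he, h3 _ _ (map_mul φ t t')]

end Graded

end TGWA

/-! ### The main theorem. -/

theorem mainTheorem11 {R : Type u} [CommRing R] [IsDomain R] {n : ℕ} (hn : 0 < n)
    (σ : Fin n → RingAut R) (hσ : ∀ i j, Commute (σ i) (σ j))
    (O : Set (MaximalSpectrum R)) (hO : TGWA.IsTorsionFreeOrbit σ O)
    (Γ₁ Γ₂ : Submonoid (Fin n → R))
    (hΓ₁ : (Γ₁ : Set (Fin n → R)) ⊆ TGWA.Omega σ) (hΓ₂ : (Γ₂ : Set (Fin n → R)) ⊆ TGWA.Omega σ)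
    (γ : Γ₁ →* (Fin n → R)) (hγ : ∀ t, γ t ∈ TGWA.OmegaUnits σ O)
    (φ : Γ₁ ≃* Γ₂) (hφ : ∀ t, (φ t : Fin n → R) = γ t * t) :
    (∀ t t' : Γ₁,
      TGWA.TensorDefined σ O (rfl : ((t * t' : Γ₁) : Fin n → R) = t * t') ↔
        TGWA.TensorDefined σ O (rfl : ((φ t * φ t' : Γ₂) : Fin n → R) = φ t * φ t')) ∧
    (∀ t : Γ₁, ∃ S : TGWA.WMod σ O (γ t), IsSimpleModule (TGWA.Alg σ (γ t)) S ∧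
      ∀ S' : TGWA.WMod σ O (γ t), IsSimpleModule (TGWA.Alg σ (γ t)) S' →
        Nonempty (S' ≃ₗ[TGWA.Alg σ (γ t)] S)) ∧
    ∀ κ : TGWA.Kind, ∃ E : TGWA.GrAlg κ σ O Γ₁ ≃ₗ[ℂ] TGWA.GrAlg κ σ O Γ₂,
      (∀ x y, E (x * y) = E x * E y) ∧
      (∀ t : Γ₁, (TGWA.GrAlg.deg κ σ O Γ₁ t).map E.toLinearMap =
        TGWA.GrAlg.deg κ σ O Γ₂ (φ t)) ∧
      ∀ (t : Γ₁) (M : TGWA.WMod σ O (t : Fin n → R)) (S : TGWA.WMod σ O (γ t)),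
        IsSimpleModule (TGWA.Alg σ (γ t)) S →
          ∃ h : TGWA.TensorActs ((hφ t).trans (mul_comm _ _)) M S,
            E (TGWA.GrAlg.cls κ t M) = TGWA.GrAlg.cls κ (φ t) (TGWA.tensorObj h) := by
  have hL (t : Γ₁) : Nonempty (TGWA.Line σ O (γ t)) := by
    obtain ⟨S, e, he⟩ := TGWA.exists_isLineBasis hσ hO (hγ t)
    obtain ⟨L, -⟩ := he.exists_line hσ hO.1 (hγ t)
    exact ⟨L⟩
  let L (t : Γ₁) : TGWA.Line σ O (γ t) := (hL t).some
  have hLs (t : Γ₁) : IsSimpleModule (TGWA.Alg σ (γ t)) (L t).obj :=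
    (L t).isLineBasis.isSimpleModule hσ hO.1 (hγ t)
  have hφ' (t : Γ₁) (s : Γ₂) (h : φ t = s) : (s : Fin n → R) = t * γ t := by
    rw [← h, hφ, mul_comm]
  refine ⟨fun t t' => ?_, fun t => ⟨(L t).obj, hLs t, fun S' hS' =>
    TGWA.nonempty_equiv_of_isSimpleModule hσ hO (hγ t) _ _ hS' (hLs t)⟩, fun κ => ?_⟩
  · exact TGWA.tensorDefined_iff hσ hO (hγ t) (hγ t') (L t) (L t')
      (hφ' (t * t') (φ t * φ t') (map_mul φ t t')) rfl (map_mul γ t t') rfl (hφ' t _ rfl)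
      (hφ' t' _ rfl) (hΓ₂ (φ t * φ t').2) (hΓ₁ (t * t').2) (hΓ₂ (φ t).2) (hΓ₂ (φ t').2) (hΓ₁ t.2)
      (hΓ₁ t'.2)
  · obtain ⟨E, hE, hE'⟩ := TGWA.GrAlg.exists_equiv (κ := κ) (σ := σ) (O := O) φ
      (fun t s h => (L t).k0Equiv hσ hO.1 (hγ t) (hφ' t s h) (hΓ₁ t.2) (hΓ₂ s.2) κ)
      fun t t' x y => TGWA.Line.k0Equiv_mul hσ hO (hγ t) (hγ t') (hγ (t * t')) (L t) (L t')
        (L (t * t')) _ rfl (map_mul γ t t') rfl _ _ _ _ _ _ _ _ κ x y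
    refine ⟨E, hE, fun t => ?_, fun t M S hS => ?_⟩
    · refine le_antisymm ?_ ?_
      · rintro _ ⟨_, ⟨x, rfl⟩, rfl⟩
        change E _ ∈ _
        induction x using TensorProduct.induction_on with
        | zero => rw [map_zero, map_zero]; exact zero_mem _
        | add x y hx hy => rw [map_add, map_add]; exact add_mem hx hy
        | tmul c x => rw [hE']; exact ⟨_, rfl⟩
      · rintro _ ⟨x, rfl⟩
        induction x using TensorProduct.induction_on with
        | zero => rw [map_zero]; exact zero_mem _
        | add x y hx hy => rw [map_add]; exact add_mem hx hy
        | tmul c x =>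
          -- Surjectivity on the Grothendieck groups makes the image fill the whole component of
          -- degree `φ t`.
          obtain ⟨x, rfl⟩ := ((L t).k0Equiv hσ hO.1 (hγ t) (hφ' t _ rfl) (hΓ₁ t.2)
            (hΓ₂ (φ t).2) κ).surjective x
          exact ⟨_, ⟨c ⊗ₜ x, rfl⟩, hE' t c x⟩
    · have h : TGWA.TensorActs ((hφ t).trans (mul_comm _ _)) M S :=
        TGWA.tensorActs_of_units hσ hO.1 (hγ t) _ (hΓ₂ (φ t).2).2 (hΓ₁ t.2).1 M S
      refine ⟨h, (hE' t 1 (TGWA.K0.cls κ M)).trans ?_⟩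
      -- `E` was built from the chosen lines; an arbitrary simple `S` is isomorphic to the line for
      -- `γ t`, so it gives the same class.
      obtain ⟨f⟩ := TGWA.nonempty_equiv_of_isSimpleModule hσ hO (hγ t) (L t).obj S (hLs t) hS
      rw [TGWA.Line.k0Equiv_cls, TGWA.GrAlg.cls]
      congr 2
      exact TGWA.K0.cls_congr κ (TGWA.tensorEquiv _ h (LinearEquiv.refl _ _) f)
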